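/- **Setting.** Let $K\ge 2$, $\mathcal T=\{0,\dots,K-1\}$, fix $t\in\mathcal T$, and let $(Y_i,T_i,X_i)$, $i=1,\dots,n$ ($n\ge1$), be i.i.d. copies of $(Y,T,X)$ with $T\in\mathcal T$, $X\in\mathbb R^d$, $Y=Y^{(T)}$ for potential outcomes $Y^{(k)}$, and $R^{(k)}=1\{T=k\}$; assume that $R^{(t)}$ and $Y^{(t)}$ are conditionally independent given $X$. Let $f=(f_0,\dots,f_p)^{\rm T}$ be known functions with $f_0\equiv1$. Write $\tilde{\mathrm E}$ for the sample average. Coefficients $\gamma=(\gamma_k:k\ne t)$ and $\alpha=(\alpha^{(k)}:k\neq t)$ are $(p+1)\times(K-1)$ matrices, with rows $\gamma_{j\cdot}$, $\alpha_{j\cdot}$ ($j=0,\dots,p$), and $\gamma_t\equiv0$. Put $\pi(k,X;\gamma)=e^{\gamma_k^{\rm T}f(X)}/\sum_{l\in\mathcal T}e^{\gamma_l^{\rm T}f(X)}$, $\omega(k,X;\gamma)=\pi(k,X;\gamma)/\pi(t,X;\gamma)$, use the linear outcome model $m(t,X;\alpha^{(k)})=\alpha^{(k){\rm T}}f(X)$,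 and let $$\ell_{\rm CAL}(\gamma)=\tilde{\mathrm E}\sum_{k\ne t}\{R^{(t)}e^{\gamma_k^{\rm T}f(X)}-R^{(k)}\gamma_k^{\rm T}f(X)\},\qquad \ell_{\rm WL}(\alpha;\gamma)=\tfrac12\sum_{k\neq t}\tilde{\mathrm E}[R^{(t)}e^{\gamma_k^{\rm T}f(X)}\{Y-\alpha^{(k){\rm T}}f(X)\}^2],$$ $$\varphi_t(\alpha,\gamma)=R^{(t)}Y+\sum_{k\neq t}\Big[R^{(t)}Y\,\omega(k,X;\gamma)-\{R^{(t)}\omega(k,X;\gamma)-R^{(k)}\}\alpha^{(k){\rm T}}f(X)\Big].$$ Let $\bar\gamma$ minimize $\mathrm E\,\ell_{\rm CAL}(\gamma)$ and $\bar\alpha$ minimize $\mathrm E\,\ell_{\rm WL}(\alpha;\bar\gamma)$. Let $\hat\gamma$ be any minimizer of $\ell_{\rm CAL}(\gamma)+A_1\tilde\lambda_1\sum_{j=1}^p\|\gamma_{j\cdot}\|_2$ and $\hat\alpha$ any minimizer of $\ell_{\rm WL}(\alpha;\hat\gamma)+A_2\tilde\lambda_2\sum_{j=1}^p\|\alpha_{j\cdot}\|_2$.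 For $0<\epsilon<1$ let $r=\sqrt{\{(K-1)+\log((p+1)/\epsilon)\}/n}$, $\tilde\lambda_1=4\sqrt2B_0^2B_1r$ and $\tilde\lambda_2=\max\{\tilde\lambda_1,\sqrt3B_0(B_1-1)\sigma_0r\}$. Let $S_\gamma=\{0\}\cup\{j:\bar\gamma_{j\cdot}\ne0\}$, $S_{\alpha_t}=\{0\}\cup\{j:\bar\alpha_{j\cdot}\neq0\}$, $\hat\varphi_{tc}=\varphi_t(\hat\alpha,\hat\gamma)-\tilde{\mathrm E}\varphi_t(\hat\alpha,\hat\gamma)$, $\bar\varphi_{tc}=\varphi_t(\bar\alpha,\bar\gamma)-\tilde{\mathrm E}\varphi_t(\bar\alpha,\bar\gamma)$, $\hat V_t=\tilde{\mathrm E}\hat\varphi_{tc}^2$ and $V_t=\mathrm{var}\{\varphi_t(\bar\alpha,\bar\gamma)\}$. **Conditions.** The constants satisfy $B_0\ge1$, $B_1>1$, $\xi_1,\xi_2>1$, $\nu_1,\nu_2,\sigma_0>0$, $0<\eta_2<1$, $A_1>(\xi_1+1)/(\xi_1-1)$, $A_2>(\xi_2+1)/(\xi_2-1)$, and: 1. $\sup_{1\le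 j\le p}|f_j(X)|\le B_0$ and $\pi^{-1}(t,X;\bar\gamma)\le B_1$ almost surely. 2. For $(S,\nu,\xi)=(S_\gamma,\nu_1,\xi_1)$ and $(S_{\alpha_t},\nu_2,\xi_2)$: every $(p+1)\times(K-1)$ matrix $b$ with $\sum_{j\notin S}\|b_{j\cdot}\|_2\le\xi\sum_{j\in S}\|b_{j\cdot}\|_2$ satisfies $\nu^2(\sum_{j\in S}\|b_{j\cdot}\|_2)^2\le|S|\sum_{k\ne t}b_k^{\rm T}\mathrm E\{R^{(t)}\omega(k,X;\bar\gamma)f(X)f^{\rm T}(X)\}b_k$. 3. $|S_\gamma|\tilde\lambda_1\le\eta_1$, and for some $\eta_{1,1},\eta_{1,2}\in(0,1)$: $(\xi_1+1)^2\nu_1^{-2}|S_\gamma|\tilde\lambda_1\le\eta_{1,1}$ and $B_0(\xi_1+1)^2(A_1-1)(1-\eta_{1,1})^{-1}\nu_1^{-2}|S_\gamma|\tilde\lambda_1\le\eta_{1,2}$. 4. For every $k\ne t$, $Y^{(t)}-\bar\alpha^{(k){\rm T}}f(X)$ is sub-gaussian with parameter $\sigma_0^2$ uniformly given $X$: $\mathrm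 E[\exp\{(Y^{(t)}-\bar\alpha^{(k){\rm T}}f(X))^2/\sigma_0^2\}\mid X]\le2$ almost surely. 5. $(1+\xi_2^2)\nu_2^{-2}|S_{\alpha_t}|\tilde\lambda_2\le\eta_2$. 6. $\{(K-1)+\log((p+1)/\epsilon)\}/n\le1$. **Theorem.** (a) There is a constant $M_{2,4}>0$ depending only on $(B_0,B_1,A_1,\xi_1,\nu_1,\eta_1,\sigma_0,A_2,\xi_2,\nu_2,\eta_2)$ such that, under these conditions, with probability at least $1-8\epsilon$ minimizers $\hat\gamma,\hat\alpha$ exist and every choice of them satisfies $$|\tilde{\mathrm E}(\hat\varphi_{tc}^2-\bar\varphi_{tc}^2)|\le2M_{2,4}^{1/2}\{\tilde{\mathrm E}\bar\varphi_{tc}^2\}^{1/2}(K-1)^{1/2}(|S_\gamma|\tilde\lambda_1+|S_{\alpha_t}|\tilde\lambda_2)+M_{2,4}(K-1)(|S_\gamma|\tilde\lambda_1+|S_{\alpha_t}|\tilde\lambda_2)^2.$$ (b) Consequently $\hat V_t$ is consistent for $V_t$: for any sequence of such problems (the distribution and $n,K,t,d,p,f,\epsilon$ may vary) satisfying the conditions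 with the same constants $(B_0,\dots,\eta_2)$, with $\epsilon\to0$, $(|S_\gamma|+|S_{\alpha_t}|)(K-1)^{1/2}\tilde\lambda_1\to0$, and $\{\varphi_t(\bar\alpha,\bar\gamma)-\mathrm E\varphi_t(\bar\alpha,\bar\gamma)\}^2$ uniformly integrable along the sequence, one has $\hat V_t-V_t\to0$ in probability (with probability tending to one, minimizers exist and, whichever are chosen, $|\hat V_t-V_t|\le\delta$, for every $\delta>0$). -/

import Mathlib

open MeasureTheory ProbabilityTheory Filter Topology

universe u

noncomputable section

/-- `Z` is sub-gaussian with parameter `s` (the square of a scale), uniformly given the sub-sigma-algebra `m`: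
`E[exp(Z^2 / s) | m] ≤ 2` almost surely.  `Z` is not required to be centred. -/
def SubGaussianGiven {Ω : Type u} (m : MeasurableSpace Ω) [mΩ : MeasurableSpace Ω] (P : Measure Ω)
    (Z : Ω → ℝ) (s : ℝ) : Prop :=
  Integrable (fun ω => Real.exp (Z ω ^ 2 / s)) P ∧
    (P[fun ω => Real.exp (Z ω ^ 2 / s) | m]) ≤ᵐ[P] fun _ => (2 : ℝ)

/-- The events `A` and `Z ∈ B` (all Borel `B`) are conditionally independent given `m`. -/
def CondIndepEventVar {Ω : Type u} (m : MeasurableSpace Ω) [mΩ : MeasurableSpace Ω] (P : Measure Ω)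
    (A : Set Ω) (Z : Ω → ℝ) : Prop :=
  ∀ B : Set ℝ, MeasurableSet B →
    (P[(A ∩ Z ⁻¹' B).indicator (fun _ => (1 : ℝ)) | m]) =ᵐ[P]
      (P[A.indicator (fun _ => (1 : ℝ)) | m]) * (P[(Z ⁻¹' B).indicator (fun _ => (1 : ℝ)) | m])

/-- An observation `(Y, T, X)`: outcome, treatment in `{0, …, K-1}`, covariate vector in `ℝ^d`. -/
abbrev Obs (K d : ℕ) := ℝ × Fin K × (Fin d → ℝ)

/-- An observational study with `K ≥ 2` treatments, a fixed treatment `t` of interest, potential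
outcomes `Ypot k`, a regressor vector `f = (f_0, …, f_p)` with `f_0 = 1`, and `n` i.i.d. copies
`sample i` of the observed `(Y, T, X)`, where `Y = Y^(T)`. -/
structure Study where
  Ω : Type u
  [mΩ : MeasurableSpace Ω]
  P : Measure Ω
  [isProb : IsProbabilityMeasure P]
  K : ℕ
  two_le_K : 2 ≤ K
  t : Fin K
  d : ℕ
  p : ℕ
  n : ℕ
  n_pos : 0 < n
  X : Ω → Fin d → ℝ
  measurable_X : Measurable X
  T : Ω → Fin K
  measurable_T : Measurable T
  Ypot : Fin K → Ω → ℝ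
  measurable_Ypot : ∀ k, Measurable (Ypot k)
  f : (Fin d → ℝ) → Fin (p + 1) → ℝ
  measurable_f : Measurable f
  f_zero : ∀ x, f x 0 = 1
  /-- Unconfoundedness for the treatment of interest. -/
  unconfounded :
    CondIndepEventVar (MeasurableSpace.comap X inferInstance) P {ω | T ω = t} (Ypot t)
  sample : Fin n → Ω → Obs K d
  measurable_sample : ∀ i, Measurable (sample i)
  indep_sample : iIndepFun sample P
  law_sample : ∀ i, IdentDistrib (sample i) (fun ω => (Ypot (T ω) ω, T ω, X ω)) P P

attribute [instance] Study.mΩ Study.isProb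

namespace Study

variable (D : Study.{u})

/-- The generic observation `(Y, T, X)` with `Y = Y^(T)` (consistency). -/
def obs (ω : D.Ω) : Obs D.K D.d := (D.Ypot (D.T ω) ω, D.T ω, D.X ω)

/-- The `K - 1` treatments other than `t`. -/
abbrev Other := {k : Fin D.K // k ≠ D.t}

/-- `(p+1) × (K-1)` coefficient matrices with columns indexed by the treatments `k ≠ t`; used both
for `γ` (with the constraint `γ_t = 0`) and for `α_t^#`. -/
abbrev Coef := Matrix (Fin (D.p + 1)) D.Other ℝ

/-- The column of `b` for `k ≠ t`, and zero for `k = t`. -/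
def col (b : D.Coef) (k : Fin D.K) : Fin (D.p + 1) → ℝ :=
  fun j => if h : k ≠ D.t then b j ⟨k, h⟩ else 0

/-- The linear predictor `b_kᵀ f(x)`. -/
def lin (b : D.Coef) (k : Fin D.K) (x : Fin D.d → ℝ) : ℝ := ∑ j, D.col b k j * D.f x j

/-- The multi-class logistic propensity score `π(k, x; γ)` with `γ_t = 0`. -/
def prop (γ : D.Coef) (k : Fin D.K) (x : Fin D.d → ℝ) : ℝ :=
  Real.exp (D.lin γ k x) / ∑ l, Real.exp (D.lin γ l x)

/-- The probability ratio `ω(k, x; γ) = π(k, x; γ) / π(t, x; γ)`. -/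
def ratio (γ : D.Coef) (k : Fin D.K) (x : Fin D.d → ℝ) : ℝ := D.prop γ k x / D.prop γ D.t x

/-- `R^(k) = 1{T = k}`. -/
def R (k : Fin D.K) (o : Obs D.K D.d) : ℝ := if o.2.1 = k then 1 else 0

/-- The `L_2` norm of the `j`-th row. -/
def rowNorm (b : D.Coef) (j : Fin (D.p + 1)) : ℝ := Real.sqrt (∑ k, b j k ^ 2)

/-- The group Lasso penalty `∑_{j=1}^p ‖b_{j·}‖_2`; the intercept row is not penalized. -/
def penalty (b : D.Coef) : ℝ := ∑ j : Fin D.p, D.rowNorm b j.succ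

/-- The calibration loss of one observation. -/
def lossCAL (γ : D.Coef) (o : Obs D.K D.d) : ℝ :=
  ∑ k : D.Other, (D.R D.t o * Real.exp (D.lin γ k o.2.2) - D.R k o * D.lin γ k o.2.2)

/-- The weighted least squares loss of one observation (linear outcome model), summed over `k ≠ t`. -/
def lossWL (γ α : D.Coef) (o : Obs D.K D.d) : ℝ :=
  ∑ k : D.Other, D.R D.t o * Real.exp (D.lin γ k o.2.2) * (o.1 - D.lin α k o.2.2) ^ 2 / 2

/-- The sample average over the `n` observations. -/
def sampleMean (g : Obs D.K D.d → ℝ) (ω : D.Ω) : ℝ := (∑ i, g (D.sample i ω)) / D.n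

/-- `γ` is a limit value: a minimizer of the expected calibration loss. -/
def IsTargetCAL (γ : D.Coef) : Prop :=
  ∀ γ' : D.Coef, ∫ ω, D.lossCAL γ (D.obs ω) ∂D.P ≤ ∫ ω, D.lossCAL γ' (D.obs ω) ∂D.P

/-- `α` is a limit value: a minimizer of the expected weighted least squares loss with weights
determined by `γ`. -/
def IsTargetWL (γ α : D.Coef) : Prop :=
  ∀ α' : D.Coef, ∫ ω, D.lossWL γ α (D.obs ω) ∂D.P ≤ ∫ ω, D.lossWL γ α' (D.obs ω) ∂D.P

/-- `γ` is a regularized calibrated estimate of the propensity score coefficients. -/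
def IsRCAL (l1 : ℝ) (ω : D.Ω) (γ : D.Coef) : Prop :=
  ∀ γ' : D.Coef, D.sampleMean (D.lossCAL γ) ω + l1 * D.penalty γ ≤
    D.sampleMean (D.lossCAL γ') ω + l1 * D.penalty γ'

/-- `α` is a regularized weighted least squares estimate of the outcome coefficients, with weights
determined by `γ`. -/
def IsRWL (l2 : ℝ) (ω : D.Ω) (γ α : D.Coef) : Prop :=
  ∀ α' : D.Coef, D.sampleMean (D.lossWL γ α) ω + l2 * D.penalty α ≤
    D.sampleMean (D.lossWL γ α') ω + l2 * D.penalty α'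

/-- At the sample point `ω` the estimates exist, and the property `Q γ̂ α̂` holds for every choice
of them: `γ̂` with tuning parameter `l1`, and then `α̂` with weights from `γ̂` and tuning
parameter `l2`. -/
def EstimatesSatisfy (l1 l2 : ℝ) (ω : D.Ω) (Q : D.Coef → D.Coef → Prop) : Prop :=
  (∃ γ, D.IsRCAL l1 ω γ) ∧ ∀ γ, D.IsRCAL l1 ω γ →
    (∃ α, D.IsRWL l2 ω γ α) ∧ ∀ α, D.IsRWL l2 ω γ α → Q γ α

/-- The augmented inverse probability weighted function `φ_t(Y, T, X; α_t^#, γ)` with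
`m(t, X; α) = αᵀ f(X)`. -/
def phi (α γ : D.Coef) (o : Obs D.K D.d) : ℝ :=
  D.R D.t o * o.1 + ∑ k : D.Other,
    (D.R D.t o * o.1 * (D.prop γ k o.2.2 / D.prop γ D.t o.2.2) -
      (D.R D.t o * (D.prop γ k o.2.2 / D.prop γ D.t o.2.2) - D.R k o) * D.lin α k o.2.2)

/-- The sample average of `φ_t(·; α, γ)`, an estimator of the treatment mean. -/
def muHat (α γ : D.Coef) (ω : D.Ω) : ℝ := D.sampleMean (D.phi α γ) ω

/-- `φ_{tc}`: the function `φ_t(·; α, γ)` minus its sample average. -/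
def phiC (α γ : D.Coef) (ω : D.Ω) (o : Obs D.K D.d) : ℝ := D.phi α γ o - D.muHat α γ ω

/-- The sample average of `φ_{tc}^2`; at the estimates this is the variance estimator. -/
def Vhat (α γ : D.Coef) (ω : D.Ω) : ℝ := D.sampleMean (fun o => D.phiC α γ ω o ^ 2) ω

/-- The variance of `φ_t(Y, T, X; α, γ)`. -/
def V (α γ : D.Coef) : ℝ := Var[fun ω => D.phi α γ (D.obs ω); D.P]

/-- `{0} ∪ {j : b_{j·} ≠ 0}`. -/
def support (b : D.Coef) : Finset (Fin (D.p + 1)) :=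
  open Classical in Finset.univ.filter fun j => j = 0 ∨ b j ≠ 0

/-- The entry `(j1, j2)` of `E{R^(t) ω(k, X; γ) f(X) fᵀ(X)}`. -/
def gram (γ : D.Coef) (k : Fin D.K) (j1 j2 : Fin (D.p + 1)) : ℝ :=
  ∫ ω, D.R D.t (D.obs ω) * D.ratio γ k (D.X ω) * (D.f (D.X ω) j1 * D.f (D.X ω) j2) ∂D.P

/-- The theoretical compatibility condition with subset `S` and constants `ν`, `ξ`. -/
def Compatibility (γ : D.Coef) (S : Finset (Fin (D.p + 1))) (ν ξ : ℝ) : Prop :=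
  ∀ b : D.Coef, ∑ j ∈ Sᶜ, D.rowNorm b j ≤ ξ * ∑ j ∈ S, D.rowNorm b j →
    ν ^ 2 * (∑ j ∈ S, D.rowNorm b j) ^ 2 ≤
      S.card * ∑ k : D.Other, ∑ j1, ∑ j2, b j1 k * D.gram γ k j1 j2 * b j2 k

/-- The rate `√((K-1)/n + log((p+1)/ε)/n)`. -/
def rate (ε : ℝ) : ℝ :=
  Real.sqrt (((D.K : ℝ) - 1) / D.n + Real.log (((D.p : ℝ) + 1) / ε) / D.n)

end Study

/-- The constants of the problem. -/
structure Constants where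
  B0 : ℝ
  B1 : ℝ
  A1 : ℝ
  ξ1 : ℝ
  ν1 : ℝ
  η1 : ℝ
  σ0 : ℝ
  A2 : ℝ
  ξ2 : ℝ
  ν2 : ℝ
  η2 : ℝ

/-- The admissible ranges of the constants. -/
structure Constants.Admissible (c : Constants) : Prop where
  one_le_B0 : 1 ≤ c.B0
  one_lt_B1 : 1 < c.B1
  one_lt_ξ1 : 1 < c.ξ1
  ν1_pos : 0 < c.ν1
  A1_gt : (c.ξ1 + 1) / (c.ξ1 - 1) < c.A1
  σ0_pos : 0 < c.σ0
  one_lt_ξ2 : 1 < c.ξ2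
  ν2_pos : 0 < c.ν2
  A2_gt : (c.ξ2 + 1) / (c.ξ2 - 1) < c.A2
  η2_pos : 0 < c.η2
  η2_lt : c.η2 < 1

namespace Study

variable (D : Study.{u}) (c : Constants)

/-- `λ̃_1`. -/
def lam1 (ε : ℝ) : ℝ := 4 * Real.sqrt 2 * c.B0 ^ 2 * c.B1 * D.rate ε

/-- `λ̃_2`. -/
def lam2 (ε : ℝ) : ℝ :=
  max (D.lam1 c ε) (Real.sqrt 3 * c.B0 * (c.B1 - 1) * c.σ0 * D.rate ε)

/-- The conditions on the study, with limit values `γ`, `α` and tail probability `ε`. -/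
structure Conditions (ε : ℝ) (γ α : D.Coef) : Prop where
  ε_pos : 0 < ε
  ε_lt : ε < 1
  target_γ : D.IsTargetCAL γ
  target_α : D.IsTargetWL γ α
  bounded : ∀ᵐ ω ∂D.P, ∀ j : Fin D.p, |D.f (D.X ω) j.succ| ≤ c.B0
  overlap : ∀ᵐ ω ∂D.P, (D.prop γ D.t (D.X ω))⁻¹ ≤ c.B1
  compat_γ : D.Compatibility γ (D.support γ) c.ν1 c.ξ1
  sparse_γ : ∃ η11 η12 : ℝ, 0 < η11 ∧ η11 < 1 ∧ 0 < η12 ∧ η12 < 1 ∧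
    (c.ξ1 + 1) ^ 2 * (c.ν1 ^ 2)⁻¹ * (D.support γ).card * D.lam1 c ε ≤ η11 ∧
    c.B0 * (c.ξ1 + 1) ^ 2 * (c.A1 - 1) * (1 - η11)⁻¹ * (c.ν1 ^ 2)⁻¹ *
      (D.support γ).card * D.lam1 c ε ≤ η12
  bound_η1 : (D.support γ).card * D.lam1 c ε ≤ c.η1
  subgaussian : ∀ k : D.Other,
    SubGaussianGiven (MeasurableSpace.comap D.X inferInstance) D.P
      (fun ω => D.Ypot D.t ω - D.lin α k (D.X ω)) (c.σ0 ^ 2)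
  compat_α : D.Compatibility γ (D.support α) c.ν2 c.ξ2
  sparse_α : (1 + c.ξ2 ^ 2) * (c.ν2 ^ 2)⁻¹ * (D.support α).card * D.lam2 c ε ≤ c.η2
  sample_size : (((D.K : ℝ) - 1) + Real.log (((D.p : ℝ) + 1) / ε)) / D.n ≤ 1

end Study

end

/-! The proof is a deterministic argument on an event of typical samples (`GoodSample`), together
with concentration showing that this event is likely. On the event the scores of both losses at the
limit values have row norms at most `λ̃_1` and `λ̃_2`, and two sample matrices are entrywise close
to their expectations: the weighted Gram matrix, and the same matrix with the squared residuals as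
further weights.

Deterministic part. Put `b = γ̂ - γ̄`. The first-order condition for `γ̂` bounds a symmetrized
Bregman divergence plus `(A_1 - 1) λ̃_1 ‖b‖` by `2 A_1 λ̃_1` times the norm of `b` on the support,
and the condition on `A_1` puts `b` in the compatibility cone. The exponential loss has no uniform
curvature, but with `τ = B_0 ‖b‖` the divergence dominates the weighted square of `bᵀf` up to the
factor `(1 - e^{-τ})/τ`. The `τ` cancels against `‖b‖`, and the sparsity condition forces `1 -
e^{-τ} ≤ ρ < 1`, so `e^τ` is bounded with no prior localization (`calibration_rate`). From then on
the weights at `γ̂` and `γ̄` are comparable.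

The least squares step is similar except for a cross term caused by the estimated weights.
Cauchy–Schwarz reduces it to the residual-weighted prediction error of `γ̂` (`GoodSample.residual`),
which unconfoundedness and the sub-gaussian condition compare with the ordinary one
(`Conditions.quad_residGram_le`); `weightedLS_rate` then asks whether the cross term or the penalty
dominates. Finally `φ_t(α̂, γ̂) - φ_t(ᾱ, γ̄)` splits into a propensity part and an outcome part
(`phi_sub_sq_le`), and (a) follows from `u² - v² = 2(u - v)v + (u - v)²`. Overlap bounds the sum of
all ratios by `B_1 - 1`, so the deterministic bounds carry no factor `K - 1`; the one in the
statement is slack.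

Existence of minimizers comes with the bounds: they are proved for every point that is minimal along
its own segment to the limit value, and a convex function whose segment-minimal points are bounded
has a minimizer (`exists_minimizer`).

Probabilistic part. The norm of a `(K-1)`-dimensional score is handled by Gaussian linearization
(`lintegral_exp_sum_sq_le`), matrix entries by Hoeffding and Bernstein type bounds, and all of it by
a union bound. For (b), a truncation argument gives a weak law for the variance estimator at the
limit values, and (a) transfers it to the estimates. -/

/-! ### Scalar inequalities for the exponential function. -/

section ExpBounds

/-- For a centred variable the linear term integrates to zero and only a sub-gaussian term remains.
The coefficient has to exceed 1/2 because of the expansion at 0; with 9/16, Taylor polynomials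
suffice up to 16/9, and beyond that point `x ≤ 9x²/16`. -/
theorem exp_le_add_exp_sq (x : ℝ) : Real.exp x ≤ x + Real.exp (9 / 16 * x ^ 2) := by
  rcases le_total x 0 with hx | hx
  · have h1 := Real.quadratic_le_exp_of_nonneg (neg_nonneg.2 hx)
    have h2 := Real.add_one_le_exp (9 / 16 * x ^ 2)
    have h3 : Real.exp x * Real.exp (-x) = 1 := by rw [← Real.exp_add]; simp
    have h4 : Real.exp x * (1 + -x + (-x) ^ 2 / 2) ≤ Real.exp x * Real.exp (-x) :=
       mul_le_mul_of_nonneg_left h1 (Real.exp_pos x).le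
    have h5 : 0 < 1 + -x + (-x) ^ 2 / 2 := by nlinarith
    have h6 : 1 ≤ (1 + x + 9 / 16 * x ^ 2) * (1 + -x + (-x) ^ 2 / 2) := by
      nlinarith [sq_nonneg x, sq_nonneg (x ^ 2), mul_nonneg (neg_nonneg.2 hx) (sq_nonneg x)]
    have h7 := le_of_mul_le_mul_right ((h4.trans_eq h3).trans h6) h5
    linarith
  rcases le_total x 1 with h1 | h1
  · have h2 := Real.exp_bound' hx h1 (n := 6) (by norm_num)
    have h3 := Real.sum_le_exp_of_nonneg (x := 9 / 16 * x ^ 2) (by positivity) 4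
    simp only [Finset.sum_range_succ, Finset.sum_range_zero, Nat.factorial] at h2 h3
    norm_num at h2 h3
    have h4 : 0 ≤ x ^ 2 * (1 / 16 - 1 / 6 * x + 29 / 256 * x ^ 2 - 1 / 120 * x ^ 3
        + 1 / 40 * x ^ 4) := by
      refine mul_nonneg (sq_nonneg x) ?_
      nlinarith [sq_nonneg (x - 7 / 10), sq_nonneg (x * (x - 1 / 4)), sq_nonneg (x ^ 2)]
    nlinarith [pow_nonneg hx 6, pow_nonneg hx 4]
  rcases le_total x (16 / 9) with h2 | h2
  · obtain ⟨h, rfl⟩ : ∃ h, x = 1 + h := ⟨x - 1, by ring⟩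
    have hh0 : 0 ≤ h := by linarith
    have hh1 : h ≤ 7 / 9 := by linarith
    have e1 := Real.exp_one_lt_d9
    have e2 := Real.exp_bound' hh0 (by linarith) (n := 3) (by norm_num)
    have e3 := Real.sum_le_exp_of_nonneg (x := 9 / 16) (by positivity) 5
    simp only [Finset.sum_range_succ, Finset.sum_range_zero, Nat.factorial] at e2 e3
    norm_num at e2 e3
    have e4 := Real.add_one_le_exp (h / 8)
    -- Since `9(1+h)²/16 ≥ 9/16 + 9h/8`, writing `9h/8 = h + h/8` lets the common factor `exp h` be
    -- pulled out.
    have e5 : Real.exp (9 / 16) * (Real.exp h * Real.exp (h / 8)) ≤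
        Real.exp (9 / 16 * (1 + h) ^ 2) := by
      rw [← Real.exp_add, ← Real.exp_add]
      apply Real.exp_le_exp.2; nlinarith [sq_nonneg h]
    have e6 : (1.754 : ℝ) * (Real.exp h * (h / 8 + 1)) ≤
        Real.exp (9 / 16) * (Real.exp h * Real.exp (h / 8)) := by
      have := Real.exp_pos h
      gcongr
      linarith
    rw [Real.exp_add]
    have e7 : Real.exp 1 * Real.exp h ≤ 2.7183 * Real.exp h := by
      have := Real.exp_pos h
      gcongr; linarith
    have e8 : Real.exp h * (2.7183 - 1.754 * (h / 8 + 1)) ≤ 1 + h := by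
      have h9 : 0 ≤ 2.7183 - 1.754 * (h / 8 + 1) := by linarith
      refine (mul_le_mul_of_nonneg_right e2 h9).trans ?_
      nlinarith [mul_nonneg hh0 (sub_nonneg.2 hh1), mul_nonneg (mul_nonneg hh0 hh0) (sub_nonneg.2 hh1),
        sq_nonneg h, pow_nonneg hh0 3, pow_nonneg hh0 4, sq_nonneg (h - 1 / 2)]
    linarith
  · have : Real.exp x ≤ Real.exp (9 / 16 * x ^ 2) := Real.exp_le_exp.2 (by nlinarith)
    linarith

/-- Convexity between `v` and `log 2`. This is a pointwise form of Jensen: after integration, `E e^v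
≤ 2` yields `E e^{θv} ≤ 2^θ`. -/
theorem exp_mul_le_of_le_one {θ v : ℝ} (h0 : 0 ≤ θ) (h1 : θ ≤ 1) :
    Real.exp (θ * v) ≤ Real.exp ((θ - 1) * Real.log 2) * (θ * Real.exp v + (1 - θ) * 2) := by
  have h := convexOn_exp.2 (Set.mem_univ v) (Set.mem_univ (Real.log 2)) h0 (sub_nonneg.2 h1)
    (by ring)
  simp only [smul_eq_mul] at h
  rw [Real.exp_log (by norm_num)] at h
  calc Real.exp (θ * v) = Real.exp ((θ - 1) * Real.log 2) *
        Real.exp (θ * v + (1 - θ) * Real.log 2) := by rw [← Real.exp_add]; ring_nf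
    _ ≤ _ := by gcongr

theorem abs_exp_sub_one_le (x : ℝ) : |Real.exp x - 1| ≤ |x| * Real.exp |x| := by
  have h1 := Real.add_one_le_exp x
  rcases le_total 0 x with hx | hx
  · have h2 := Real.add_one_le_exp (-x)
    have h3 : Real.exp x * Real.exp (-x) = 1 := by rw [← Real.exp_add]; simp
    rw [abs_of_nonneg hx, abs_of_nonneg (by linarith)]
    nlinarith [Real.exp_pos x]
  · have h4 : Real.exp x ≤ 1 := Real.exp_le_one_iff.2 hx
    have h5 : 1 ≤ Real.exp |x| := Real.one_le_exp (abs_nonneg x)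
    rw [abs_of_nonpos (by linarith : Real.exp x - 1 ≤ 0)]
    rw [abs_of_nonpos hx] at h5 ⊢
    nlinarith

/-- A first-order expansion with an explicit quadratic remainder. It replaces differentiation of the
calibration loss under sums and integrals, and gives the second-order bound for sub-exponential
variables. -/
theorem exp_le_one_add_add_sq_mul_exp_abs (x : ℝ) :
    Real.exp x ≤ 1 + x + x ^ 2 * Real.exp |x| := by
  have h1 := abs_exp_sub_one_le x
  have h2 := Real.add_one_le_exp (-x)
  have h3 : Real.exp x * Real.exp (-x) = 1 := by rw [← Real.exp_add]; simp
  have h4 : Real.exp x - 1 - x ≤ x * (Real.exp x - 1) := by nlinarith [Real.exp_pos x]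
  have h5 : x * (Real.exp x - 1) ≤ |x| * |Real.exp x - 1| := by
    rw [← abs_mul]; exact le_abs_self _
  have h6 : |x| * |Real.exp x - 1| ≤ |x| * (|x| * Real.exp |x|) := by gcongr
  have h7 : |x| * (|x| * Real.exp |x|) = x ^ 2 * Real.exp |x| := by
    rw [← mul_assoc, ← sq, sq_abs]
  linarith

theorem one_sub_exp_neg_abs_le_abs (x : ℝ) : 1 - Real.exp (-|x|) ≤ |Real.exp x - 1| := by
  rcases le_total 0 x with hx | hx
  · have h1 : 1 ≤ Real.exp x := Real.one_le_exp hx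
    have h3 : Real.exp x * Real.exp (-x) = 1 := by rw [← Real.exp_add]; simp
    rw [abs_of_nonneg hx, abs_of_nonneg (by linarith)]
    nlinarith [Real.exp_pos (-x)]
  · have h4 : Real.exp x ≤ 1 := Real.exp_le_one_iff.2 hx
    rw [abs_of_nonpos hx, abs_of_nonpos (by linarith)]
    simp

theorem mul_exp_sub_one_eq_abs (x : ℝ) : x * (Real.exp x - 1) = |x| * |Real.exp x - 1| := by
  rw [← abs_mul, abs_of_nonneg]
  rcases le_total 0 x with hx | hx
  · exact mul_nonneg hx (by linarith [Real.one_le_exp hx])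
  · exact mul_nonneg_of_nonpos_of_nonpos hx (by linarith [Real.exp_le_one_iff.2 hx])

/-- `|e^x - 1| ≥ 1 - e^{-|x|}`, and convexity makes `(1 - e^{-y})/y` decreasing in `y`. The bounded
numerator `1 - e^{-τ}` is what the self-bounding step of `calibration_rate` exploits. -/
theorem sq_mul_one_sub_exp_neg_le {x τ : ℝ} (h : |x| ≤ τ) :
    (1 - Real.exp (-τ)) * x ^ 2 ≤ τ * (x * (Real.exp x - 1)) := by
  have h0 := abs_nonneg x
  have hτ : 0 ≤ τ := h0.trans h
  rcases hτ.eq_or_lt with h1 | h1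
  · subst h1; simp
  have h2 := convexOn_exp.2 (Set.mem_univ (-τ)) (Set.mem_univ 0)
    (show 0 ≤ |x| / τ by positivity)
    (show 0 ≤ 1 - |x| / τ by rw [sub_nonneg, div_le_one h1]; exact h) (by ring)
  simp only [smul_eq_mul, mul_zero, add_zero, Real.exp_zero, mul_one] at h2
  rw [show |x| / τ * -τ = -|x| by field_simp] at h2
  have h3 := one_sub_exp_neg_abs_le_abs x
  rw [mul_exp_sub_one_eq_abs, ← sq_abs x]
  have h4 : |x| / τ * (1 - Real.exp (-τ)) ≤ |Real.exp x - 1| := by linarith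
  have h5 : |x| * (1 - Real.exp (-τ)) ≤ τ * |Real.exp x - 1| := by
    have := mul_le_mul_of_nonneg_left h4 h1.le
    have e : τ * (|x| / τ * (1 - Real.exp (-τ))) = |x| * (1 - Real.exp (-τ)) := by field_simp
    linarith
  nlinarith

/-- A cruder curvature bound, convenient once `e^τ` is known to be at most a constant. -/
theorem sq_le_exp_mul {x τ : ℝ} (h : |x| ≤ τ) :
    x ^ 2 ≤ Real.exp τ * (x * (Real.exp x - 1)) := by
  have h0 := abs_nonneg x
  rw [mul_exp_sub_one_eq_abs, ← sq_abs x]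
  have h1 := one_sub_exp_neg_abs_le_abs x
  have h2 := Real.add_one_le_exp |x|
  have h3 : Real.exp |x| * Real.exp (-|x|) = 1 := by rw [← Real.exp_add]; simp
  have h4 : Real.exp |x| ≤ Real.exp τ := Real.exp_le_exp.2 h
  have h5 : |x| ≤ Real.exp |x| * |Real.exp x - 1| := by
    have := mul_le_mul_of_nonneg_left h1 (Real.exp_pos |x|).le
    linarith
  have h6 : |x| ≤ Real.exp τ * |Real.exp x - 1| :=
    h5.trans (mul_le_mul_of_nonneg_right h4 (abs_nonneg _))
  nlinarith

theorem sq_mul_exp_half_le {v : ℝ} (hv : 0 ≤ v) : v ^ 2 * Real.exp (v / 2) ≤ 8 * Real.exp v := by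
  have h1 := Real.quadratic_le_exp_of_nonneg (by positivity : 0 ≤ v / 2)
  have h2 : Real.exp v = Real.exp (v / 2) * Real.exp (v / 2) := by rw [← Real.exp_add]; ring_nf
  rw [h2]
  nlinarith [Real.exp_pos (v / 2)]

end ExpBounds

/-! ### Exponential moments of a single centred variable. -/

section Mgf

variable {Ω : Type u} [MeasurableSpace Ω] {P : Measure Ω} [IsProbabilityMeasure P]

/-- For small `q`, `exp_le_add_exp_sq` and the pointwise Jensen bound give `2^{9q²/16}`. For large
`q`, `Z ≤ q²/4 + V²` gives `2 e^{q²/4}`. The regimes meet at `q² = 16/9`, where the second one needs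
`1/4 + (9/16) log 2 ≤ 16/25`; this holds with almost nothing to spare and fixes the constant. -/
theorem lintegral_exp_le_of_sq_exp {Z V : Ω → ℝ} {q : ℝ} (hZ : Integrable Z P)
    (h0 : ∫ ω, Z ω ∂P = 0) (hV : Integrable (fun ω => Real.exp (V ω ^ 2)) P)
    (h2 : ∫ ω, Real.exp (V ω ^ 2) ∂P ≤ 2) (hZV : ∀ᵐ ω ∂P, |Z ω| ≤ q * V ω) :
    ∫⁻ ω, ENNReal.ofReal (Real.exp (Z ω)) ∂P ≤ ENNReal.ofReal (Real.exp (16 / 25 * q ^ 2)) := by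
  have hb : ∀ᵐ ω ∂P, Real.exp (Z ω) ≤ Real.exp (q ^ 2 / 4) * Real.exp (V ω ^ 2) := by
    filter_upwards [hZV] with ω h
    rw [← Real.exp_add]
    apply Real.exp_le_exp.2
    nlinarith [sq_nonneg (V ω - q / 2), le_abs_self (Z ω)]
  have hi : Integrable (fun ω => Real.exp (Z ω)) P := by
    refine (hV.const_mul (Real.exp (q ^ 2 / 4))).mono'
      (Real.continuous_exp.comp_aestronglyMeasurable hZ.1) ?_
    filter_upwards [hb] with ω h
    rwa [Real.norm_of_nonneg (Real.exp_pos _).le]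
  rw [← ofReal_integral_eq_lintegral_ofReal hi (ae_of_all _ fun _ => (Real.exp_pos _).le)]
  apply ENNReal.ofReal_le_ofReal
  have hl2 : Real.log 2 ≤ 0.6931471808 := Real.log_two_lt_d9.le
  rcases le_total (9 / 16 * q ^ 2) 1 with h1 | h1
  · have hp : ∀ᵐ ω ∂P, Real.exp (Z ω) ≤ Z ω + Real.exp ((9 / 16 * q ^ 2 - 1) * Real.log 2) *
        (9 / 16 * q ^ 2 * Real.exp (V ω ^ 2) + (1 - 9 / 16 * q ^ 2) * 2) := by
      filter_upwards [hZV] with ω h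
      have e1 := exp_le_add_exp_sq (Z ω)
      have e2 : Real.exp (9 / 16 * Z ω ^ 2) ≤ Real.exp (9 / 16 * q ^ 2 * V ω ^ 2) := by
        apply Real.exp_le_exp.2
        have := sq_le_sq' (by linarith [abs_nonneg (Z ω)]) h
        rw [sq_abs] at this
        nlinarith
      have e3 := exp_mul_le_of_le_one (θ := 9 / 16 * q ^ 2) (v := V ω ^ 2) (by positivity) h1
      linarith
    have hI : Integrable (fun ω => 9 / 16 * q ^ 2 * Real.exp (V ω ^ 2) + (1 - 9 / 16 * q ^ 2) * 2) P :=
      (hV.const_mul _).add (integrable_const _)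
    have hle := integral_mono_ae hi (hZ.add (hI.const_mul _)) hp
    simp only [Pi.add_apply] at hle
    rw [integral_add hZ (hI.const_mul _), h0, integral_const_mul,
      integral_add (hV.const_mul _) (integrable_const _), integral_const_mul] at hle
    simp only [integral_const, probReal_univ, smul_eq_mul, one_mul, zero_add] at hle
    refine hle.trans ?_
    have e4 : 9 / 16 * q ^ 2 * ∫ ω, Real.exp (V ω ^ 2) ∂P ≤ 9 / 16 * q ^ 2 * 2 := by gcongr
    have e5 : 9 / 16 * q ^ 2 * (∫ ω, Real.exp (V ω ^ 2) ∂P) + (1 - 9 / 16 * q ^ 2) * 2 ≤ 2 := by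
      linarith
    calc _ ≤ Real.exp ((9 / 16 * q ^ 2 - 1) * Real.log 2) * 2 := by gcongr
      _ = Real.exp ((9 / 16 * q ^ 2 - 1) * Real.log 2) * Real.exp (Real.log 2) := by
          rw [Real.exp_log (by norm_num)]
      _ ≤ _ := by
          rw [← Real.exp_add]
          apply Real.exp_le_exp.2
          nlinarith [sq_nonneg q]
  · have hle := integral_mono_ae hi (hV.const_mul _) hb
    rw [integral_const_mul] at hle
    refine hle.trans ?_
    calc _ ≤ Real.exp (q ^ 2 / 4) * 2 := by gcongr
      _ = Real.exp (q ^ 2 / 4) * Real.exp (Real.log 2) := by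
          rw [Real.exp_log (by norm_num)]
      _ ≤ _ := by
          rw [← Real.exp_add]
          apply Real.exp_le_exp.2
          nlinarith

theorem lintegral_exp_le_of_abs_le {Z : Ω → ℝ} {M : ℝ} (hM : 0 ≤ M) (hZ : AEMeasurable Z P)
    (h0 : ∫ ω, Z ω ∂P = 0) (hb : ∀ᵐ ω ∂P, |Z ω| ≤ M) :
    ∫⁻ ω, ENNReal.ofReal (Real.exp (Z ω)) ∂P ≤ ENNReal.ofReal (Real.exp (M ^ 2 / 2)) := by
  have h := hasSubgaussianMGF_of_mem_Icc_of_integral_eq_zero hZ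
    (hb.mono fun ω h => abs_le.1 h) h0
  have h1 := h.integrable_exp_mul 1
  have h2 := h.mgf_le 1
  simp only [one_mul, mgf] at h1 h2
  rw [← ofReal_integral_eq_lintegral_ofReal h1 (ae_of_all _ fun _ => (Real.exp_pos _).le)]
  refine ENNReal.ofReal_le_ofReal (h2.trans (Real.exp_le_exp.2 (le_of_eq ?_)))
  rw [show M - -M = 2 * M by ring]
  simp [abs_of_nonneg hM]

/-- A Bernstein type bound. As `|s| ≤ 1/2`, half of the exponent `V` absorbs `e^{|sU|}` and the
other half absorbs `U²`, through `v² e^{v/2} ≤ 8 e^v`; with `E e^V ≤ 2` this makes 16. -/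
theorem lintegral_exp_le_of_abs_le_exp {U V : Ω → ℝ} {s : ℝ} (hU : Integrable U P)
    (hV0 : ∀ᵐ ω ∂P, 0 ≤ V ω)
    (hV : Integrable (fun ω => Real.exp (V ω)) P) (h2 : ∫ ω, Real.exp (V ω) ∂P ≤ 2)
    (hs : |s| ≤ 1 / 2) (hUV : ∀ᵐ ω ∂P, |U ω| ≤ V ω) :
    ∫⁻ ω, ENNReal.ofReal (Real.exp (s * (U ω - ∫ ω, U ω ∂P))) ∂P ≤
      ENNReal.ofReal (Real.exp (16 * s ^ 2)) := by
  have hb : ∀ᵐ ω ∂P, Real.exp (s * U ω) ≤ 1 + s * U ω + s ^ 2 * 8 * Real.exp (V ω) := by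
    filter_upwards [hUV, hV0] with ω h h0
    have e1 := exp_le_one_add_add_sq_mul_exp_abs (s * U ω)
    have e2 : |s * U ω| ≤ V ω / 2 := by
      rw [abs_mul]
      calc |s| * |U ω| ≤ 1 / 2 * V ω := by gcongr
        _ = _ := by ring
    have e3 : (s * U ω) ^ 2 ≤ s ^ 2 * V ω ^ 2 := by
      rw [mul_pow]
      have := sq_le_sq' (by linarith [abs_nonneg (U ω)]) h
      rw [sq_abs] at this
      gcongr
    have e4 := sq_mul_exp_half_le h0
    have e5 : (s * U ω) ^ 2 * Real.exp |s * U ω| ≤ s ^ 2 * V ω ^ 2 * Real.exp (V ω / 2) := by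
      gcongr
    nlinarith [sq_nonneg s]
  have hI : Integrable (fun ω => 1 + s * U ω + s ^ 2 * 8 * Real.exp (V ω)) P :=
    ((integrable_const _).add (hU.const_mul s)).add (hV.const_mul _)
  have hi : Integrable (fun ω => Real.exp (s * U ω)) P := by
    refine hI.mono' (Real.continuous_exp.comp_aestronglyMeasurable (hU.1.const_mul s)) ?_
    filter_upwards [hb] with ω h
    rwa [Real.norm_of_nonneg (Real.exp_pos _).le]
  have hle := integral_mono_ae hi hI hb
  rw [integral_add (f := fun ω => 1 + s * U ω) ((integrable_const _).add (hU.const_mul s))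
    (hV.const_mul _), integral_add (integrable_const _) (hU.const_mul s), integral_const_mul,
    integral_const_mul] at hle
  simp only [integral_const, probReal_univ, smul_eq_mul, one_mul] at hle
  have hle2 : ∫ ω, Real.exp (s * U ω) ∂P ≤ Real.exp (s * (∫ ω, U ω ∂P) + 16 * s ^ 2) := by
    have := Real.add_one_le_exp (s * (∫ ω, U ω ∂P) + 16 * s ^ 2)
    nlinarith [sq_nonneg s]
  have e : ∀ ω, Real.exp (s * (U ω - ∫ ω, U ω ∂P)) =
      Real.exp (-(s * ∫ ω, U ω ∂P)) * Real.exp (s * U ω) := fun ω => by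
    rw [← Real.exp_add]; ring_nf
  simp_rw [e]
  rw [← ofReal_integral_eq_lintegral_ofReal (hi.const_mul _)
    (ae_of_all _ fun _ => by positivity), integral_const_mul]
  apply ENNReal.ofReal_le_ofReal
  calc _ ≤ Real.exp (-(s * ∫ ω, U ω ∂P)) * Real.exp (s * (∫ ω, U ω ∂P) + 16 * s ^ 2) := by gcongr
    _ = _ := by rw [← Real.exp_add]; ring_nf

end Mgf

/-! ### Gaussian linearization of squared norms. -/

section Gaussian

theorem lintegral_exp_mul_gaussianReal (a : ℝ) :
    ∫⁻ x, ENNReal.ofReal (Real.exp (a * x)) ∂(gaussianReal 0 1) =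
      ENNReal.ofReal (Real.exp (a ^ 2 / 2)) := by
  rw [← ofReal_integral_eq_lintegral_ofReal (integrable_exp_mul_gaussianReal a)
    (ae_of_all _ fun _ => (Real.exp_pos _).le)]
  have := mgf_gaussianReal (p := gaussianReal 0 1) (X := id) (μ := 0) (v := 1) (by simp) a
  simp only [mgf, id] at this
  rw [this]; simp

theorem lintegral_exp_mul_sq_gaussianReal {b : ℝ} (hb : b < 1 / 2) :
    ∫⁻ x, ENNReal.ofReal (Real.exp (b * x ^ 2)) ∂(gaussianReal 0 1) =
      ENNReal.ofReal (Real.sqrt (1 - 2 * b))⁻¹ := by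
  rw [gaussianReal_of_var_ne_zero _ one_ne_zero,
    lintegral_withDensity_eq_lintegral_mul _ (measurable_gaussianPDF _ _) (by fun_prop)]
  have e : ∀ x : ℝ, (gaussianPDF 0 1 * fun x => ENNReal.ofReal (Real.exp (b * x ^ 2))) x =
      ENNReal.ofReal ((Real.sqrt (2 * Real.pi))⁻¹ * Real.exp (-(1 / 2 - b) * x ^ 2)) := fun x => by
    simp only [Pi.mul_apply, gaussianPDF, gaussianPDFReal]
    rw [← ENNReal.ofReal_mul (by positivity), mul_assoc, ← Real.exp_add]
    congr 3
    · simp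
    · simp; ring
  simp_rw [e]
  have hb' : 0 < 1 / 2 - b := by linarith
  rw [← ofReal_integral_eq_lintegral_ofReal ((integrable_exp_neg_mul_sq hb').const_mul _)
    (ae_of_all _ fun _ => by positivity), integral_const_mul, integral_gaussian]
  congr 1
  rw [show Real.pi / (1 / 2 - b) = (2 * Real.pi) * (1 - 2 * b)⁻¹ by field_simp,
    Real.sqrt_mul (show 0 ≤ 2 * Real.pi by positivity), Real.sqrt_inv]
  have : Real.sqrt (2 * Real.pi) ≠ 0 := by positivity
  field_simp

theorem lintegral_pi_gaussianReal_prod {ι : Type*} [Fintype ι] (F : ι → ℝ → ENNReal)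
    (hF : ∀ k, Measurable (F k)) :
    ∫⁻ g : ι → ℝ, ∏ k, F k (g k) ∂(Measure.pi fun _ => gaussianReal 0 1) =
      ∏ k, ∫⁻ x, F k x ∂(gaussianReal 0 1) := by
  rw [lintegral_prod_eq_prod_lintegral_of_indepFun Finset.univ
    (fun k (g : ι → ℝ) => F k (g k)) (iIndepFun_pi fun k => (hF k).aemeasurable)
    (fun k => (hF k).comp (measurable_pi_apply k))]
  refine Finset.prod_congr rfl fun k _ => ?_
  exact (measurePreserving_eval (fun _ : ι => gaussianReal 0 1) k).lintegral_comp (hF k)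

variable {Ω : Type u} [MeasurableSpace Ω] {P : Measure Ω}

/-- Exponential moment of a squared norm from the linear exponential moments. -/
theorem lintegral_exp_sum_sq_le [IsProbabilityMeasure P] {ι : Type*} [Fintype ι] {S : Ω → ι → ℝ} (hS : Measurable S)
    {L θ : ℝ} (hL : 0 < L) (hθ0 : 0 ≤ θ) (hθ1 : θ < 1)
    (h : ∀ v : ι → ℝ, ∫⁻ ω, ENNReal.ofReal (Real.exp (∑ k, v k * S ω k)) ∂P ≤
      ENNReal.ofReal (Real.exp (L / 2 * ∑ k, v k ^ 2))) :
    ∫⁻ ω, ENNReal.ofReal (Real.exp (θ / (2 * L) * ∑ k, S ω k ^ 2)) ∂P ≤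
      ENNReal.ofReal ((Real.sqrt (1 - θ))⁻¹ ^ Fintype.card ι) := by
  -- For a standard Gaussian vector `g`, `exp(s²‖S‖²/2) = E_g exp(s ⟨g, S⟩)`, and `s² = θ/L` matches
  -- the integrand. After Tonelli the hypothesis is used at `v = s g`; what remains is
  -- `exp(θ‖g‖²/2)`, integrable because `θ < 1`. Working with lower integrals avoids any
  -- integrability question for `S`.
  set s := Real.sqrt (θ / L) with hs
  have hs2 : s ^ 2 = θ / L := Real.sq_sqrt (by positivity)
  have hSk : ∀ k, Measurable fun ω => S ω k := fun k => (measurable_pi_apply k).comp hS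
  have e1 : ∀ ω, ENNReal.ofReal (Real.exp (θ / (2 * L) * ∑ k, S ω k ^ 2)) =
      ∫⁻ g : ι → ℝ, ENNReal.ofReal (Real.exp (∑ k, (s * g k) * S ω k))
        ∂(Measure.pi fun _ => gaussianReal 0 1) := fun ω => by
    have : ∀ g : ι → ℝ, ENNReal.ofReal (Real.exp (∑ k, (s * g k) * S ω k)) =
        ∏ k, ENNReal.ofReal (Real.exp ((s * S ω k) * g k)) := fun g => by
      rw [Real.exp_sum, ENNReal.ofReal_prod_of_nonneg fun _ _ => (Real.exp_pos _).le]
      refine Finset.prod_congr rfl fun k _ => ?_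
      ring_nf
    simp_rw [this]
    rw [lintegral_pi_gaussianReal_prod (fun k x => ENNReal.ofReal (Real.exp ((s * S ω k) * x)))
      (fun k => by fun_prop)]
    simp_rw [lintegral_exp_mul_gaussianReal]
    rw [← ENNReal.ofReal_prod_of_nonneg fun _ _ => (Real.exp_pos _).le, ← Real.exp_sum,
      Finset.mul_sum]
    congr 3 with k
    rw [mul_pow, hs2]; field_simp
  simp_rw [e1]
  rw [lintegral_lintegral_swap (by
    apply Measurable.aemeasurable
    apply ENNReal.measurable_ofReal.comp
    apply Real.measurable_exp.comp
    refine Finset.measurable_sum _ fun k _ => ?_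
    have m1 : Measurable fun p : Ω × (ι → ℝ) => S p.1 k := (hSk k).comp measurable_fst
    have m2 : Measurable fun p : Ω × (ι → ℝ) => p.2 k :=
      (measurable_pi_apply k).comp measurable_snd
    exact (m2.const_mul s).mul m1)]
  calc _ ≤ ∫⁻ g : ι → ℝ, ENNReal.ofReal (Real.exp (L / 2 * ∑ k, (s * g k) ^ 2))
        ∂(Measure.pi fun _ => gaussianReal 0 1) := lintegral_mono fun g => h fun k => s * g k
    _ = ∫⁻ g : ι → ℝ, ∏ k, ENNReal.ofReal (Real.exp (θ / 2 * g k ^ 2))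
        ∂(Measure.pi fun _ => gaussianReal 0 1) := by
      refine lintegral_congr fun g => ?_
      rw [← ENNReal.ofReal_prod_of_nonneg fun _ _ => (Real.exp_pos _).le, ← Real.exp_sum,
        Finset.mul_sum]
      congr 3 with k
      rw [mul_pow, hs2]; field_simp
    _ = _ := by
      rw [lintegral_pi_gaussianReal_prod (fun k x => ENNReal.ofReal (Real.exp (θ / 2 * x ^ 2)))
        (fun k => by fun_prop)]
      simp_rw [lintegral_exp_mul_sq_gaussianReal (show θ / 2 < 1 / 2 by linarith)]
      rw [Finset.prod_const, ← ENNReal.ofReal_pow (by positivity), Finset.card_univ]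
      congr 5; ring
    _ ≤ _ := le_rfl

theorem measure_ge_le_of_lintegral_exp {Y : Ω → ℝ} (hY : Measurable Y) {a b : ℝ} {c : ℝ}
    (h : ∫⁻ ω, ENNReal.ofReal (Real.exp (Y ω)) ∂P ≤ ENNReal.ofReal c)
    (hc : c * Real.exp (-a) ≤ b) :
    P {ω | a ≤ Y ω} ≤ ENNReal.ofReal b := by
  have h1 := mul_meas_ge_le_lintegral₀ (μ := P) (f := fun ω => ENNReal.ofReal (Real.exp (Y ω)))
    (by fun_prop) (ENNReal.ofReal (Real.exp a))
  have h2 : {ω | ENNReal.ofReal (Real.exp a) ≤ ENNReal.ofReal (Real.exp (Y ω))} =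
      {ω | a ≤ Y ω} := by
    ext ω
    simp [ENNReal.ofReal_le_ofReal_iff (Real.exp_pos _).le]
  rw [h2] at h1
  have h3 : ENNReal.ofReal (Real.exp (-a)) * ENNReal.ofReal (Real.exp a) = 1 := by
    rw [← ENNReal.ofReal_mul (Real.exp_pos _).le, ← Real.exp_add]; simp
  calc P {ω | a ≤ Y ω} = ENNReal.ofReal (Real.exp (-a)) *
        (ENNReal.ofReal (Real.exp a) * P {ω | a ≤ Y ω}) := by rw [← mul_assoc, h3, one_mul]
    _ ≤ ENNReal.ofReal (Real.exp (-a)) * ENNReal.ofReal c := by gcongr; exact h1.trans h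
    _ = ENNReal.ofReal (Real.exp (-a) * c) := by rw [ENNReal.ofReal_mul (Real.exp_pos _).le]
    _ ≤ _ := ENNReal.ofReal_le_ofReal (by linarith [mul_comm c (Real.exp (-a))])

end Gaussian

/-! ### Concentration of averages of i.i.d. copies. -/

section Sample

variable {Ω 𝒳 : Type*} [MeasurableSpace Ω] [MeasurableSpace 𝒳] {P : Measure Ω}
  {n : ℕ} {X : Fin n → Ω → 𝒳} {X₀ : Ω → 𝒳}

theorem lintegral_exp_sum_iid (hX : ∀ i, Measurable (X i)) (hind : iIndepFun X P)
    (hlaw : ∀ i, IdentDistrib (X i) X₀ P P) {ψ : 𝒳 → ℝ} (hψ : Measurable ψ) :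
    ∫⁻ ω, ENNReal.ofReal (Real.exp (∑ i, ψ (X i ω))) ∂P =
      (∫⁻ ω, ENNReal.ofReal (Real.exp (ψ (X₀ ω))) ∂P) ^ n := by
  have hF : Measurable fun x => ENNReal.ofReal (Real.exp (ψ x)) := by fun_prop
  have e : ∀ ω, ENNReal.ofReal (Real.exp (∑ i, ψ (X i ω))) =
      ∏ i, ENNReal.ofReal (Real.exp (ψ (X i ω))) := fun ω => by
    rw [Real.exp_sum, ENNReal.ofReal_prod_of_nonneg fun _ _ => (Real.exp_pos _).le]
  simp_rw [e]
  rw [lintegral_prod_eq_prod_lintegral_of_indepFun Finset.univ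
    (fun i ω => ENNReal.ofReal (Real.exp (ψ (X i ω)))) (hind.comp _ fun _ => hF)
    (fun i => hF.comp (hX i))]
  have : ∀ i, ∫⁻ ω, ENNReal.ofReal (Real.exp (ψ (X i ω))) ∂P =
      ∫⁻ ω, ENNReal.ofReal (Real.exp (ψ (X₀ ω))) ∂P := fun i =>
    ((hlaw i).comp hF).lintegral_eq
  simp [this]

/-- Concentration of the Euclidean norm of a vector of sums. -/
theorem measure_sum_sq_ge_le [IsProbabilityMeasure P] (hX : ∀ i, Measurable (X i)) (hind : iIndepFun X P)
    (hlaw : ∀ i, IdentDistrib (X i) X₀ P P) (hn : 0 < n) {ι : Type*} [Fintype ι]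
    {ψ : 𝒳 → ι → ℝ} (hψ : Measurable ψ) {L θ τ b : ℝ} (hL : 0 < L) (hθ0 : 0 ≤ θ) (hθ1 : θ < 1)
    (h : ∀ v : ι → ℝ, ∫⁻ ω, ENNReal.ofReal (Real.exp (∑ k, v k * ψ (X₀ ω) k)) ∂P ≤
      ENNReal.ofReal (Real.exp (L / 2 * ∑ k, v k ^ 2)))
    (hb : (Real.sqrt (1 - θ))⁻¹ ^ Fintype.card ι *
      Real.exp (-(θ * n * τ ^ 2 / (2 * L))) ≤ b) :
    P {ω | τ ^ 2 ≤ ∑ k, ((∑ i, ψ (X i ω) k) / n) ^ 2} ≤ ENNReal.ofReal b := by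
  have hn' : (0 : ℝ) < n := by exact_mod_cast hn
  have hψk : ∀ k, Measurable fun x => ψ x k := fun k => (measurable_pi_apply k).comp hψ
  have hS : Measurable fun ω k => ∑ i, ψ (X i ω) k :=
    measurable_pi_lambda _ fun k => Finset.measurable_sum _ fun i _ => (hψk k).comp (hX i)
  -- Independence multiplies the exponents, so the vector of sums has variance proxy `n * L`.
  have h1 := lintegral_exp_sum_sq_le (P := P) hS (L := n * L) (θ := θ) (by positivity) hθ0 hθ1
    (fun v => by
      have e : ∀ ω, ∑ k, v k * ∑ i, ψ (X i ω) k = ∑ i, ∑ k, v k * ψ (X i ω) k := fun ω => by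
        simp_rw [Finset.mul_sum]; exact Finset.sum_comm
      simp_rw [e]
      rw [lintegral_exp_sum_iid hX hind hlaw (ψ := fun x => ∑ k, v k * ψ x k)
        (Finset.measurable_sum _ fun k _ => (hψk k).const_mul _)]
      refine (pow_le_pow_left₀ (zero_le) (h v) n).trans (le_of_eq ?_)
      rw [← ENNReal.ofReal_pow (Real.exp_pos _).le, ← Real.exp_nat_mul]
      congr 2; ring)
  have h2 := measure_ge_le_of_lintegral_exp (by fun_prop) h1 hb
  refine (measure_mono fun ω hω => ?_).trans h2
  simp only [Set.mem_ofPred_eq] at hω ⊢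
  simp_rw [div_pow, ← Finset.sum_div] at hω
  rw [le_div_iff₀ (by positivity)] at hω
  calc θ * n * τ ^ 2 / (2 * L) = θ / (2 * (n * L)) * (τ ^ 2 * n ^ 2) := by field_simp
    _ ≤ _ := by gcongr

/-- Two-sided tail bound for a sample mean from exponential moments at `s` and `-s`. -/
theorem measure_abs_mean_sub_ge_le (hX : ∀ i, Measurable (X i)) (hind : iIndepFun X P)
    (hlaw : ∀ i, IdentDistrib (X i) X₀ P P) (hn : 0 < n)
    {ψ : 𝒳 → ℝ} (hψ : Measurable ψ) {m s c δ b : ℝ} (hs : 0 ≤ s)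
    (h1 : ∫⁻ ω, ENNReal.ofReal (Real.exp (s * (ψ (X₀ ω) - m))) ∂P ≤ ENNReal.ofReal (Real.exp c))
    (h2 : ∫⁻ ω, ENNReal.ofReal (Real.exp (-s * (ψ (X₀ ω) - m))) ∂P ≤ ENNReal.ofReal (Real.exp c))
    (hb : 2 * Real.exp (n * (c - s * δ)) ≤ b) :
    P {ω | δ ≤ |(∑ i, ψ (X i ω)) / n - m|} ≤ ENNReal.ofReal b := by
  have hn' : (0 : ℝ) < n := by exact_mod_cast hn
  have key : ∀ t : ℝ, ∫⁻ ω, ENNReal.ofReal (Real.exp (t * (ψ (X₀ ω) - m))) ∂P ≤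
      ENNReal.ofReal (Real.exp c) →
      P {ω | n * (s * δ) ≤ ∑ i, t * (ψ (X i ω) - m)} ≤ ENNReal.ofReal (b / 2) := fun t ht => by
    have hm : Measurable fun x => t * (ψ x - m) := by fun_prop
    have h3 := lintegral_exp_sum_iid hX hind hlaw hm
    refine measure_ge_le_of_lintegral_exp (c := Real.exp (n * c))
      (Finset.measurable_sum _ fun i _ => hm.comp (hX i)) ?_ ?_
    · refine h3.trans_le ?_
      refine (pow_le_pow_left₀ (zero_le) ht n).trans (le_of_eq ?_)
      rw [← ENNReal.ofReal_pow (Real.exp_pos _).le, ← Real.exp_nat_mul]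
    · rw [← Real.exp_add]
      rw [show n * c + -(n * (s * δ)) = n * (c - s * δ) by ring]
      linarith
  have hsub : {ω | δ ≤ |(∑ i, ψ (X i ω)) / n - m|} ⊆
      {ω | n * (s * δ) ≤ ∑ i, s * (ψ (X i ω) - m)} ∪
      {ω | n * (s * δ) ≤ ∑ i, -s * (ψ (X i ω) - m)} := by
    intro ω hω
    simp only [Set.mem_ofPred_eq, Set.mem_union] at hω ⊢
    have e : ∀ t : ℝ, ∑ i, t * (ψ (X i ω) - m) = n * (t * ((∑ i, ψ (X i ω)) / n - m)) := fun t => by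
      rw [← Finset.mul_sum, Finset.sum_sub_distrib]
      simp only [Finset.sum_const, Finset.card_univ, Fintype.card_fin, nsmul_eq_mul]
      field_simp
    rw [e, e]
    rcases le_abs.1 hω with h | h
    · left; gcongr
    · right
      rw [neg_mul, ← mul_neg]; gcongr
  refine (measure_mono hsub).trans ((measure_union_le _ _).trans ?_)
  have hb0 : 0 ≤ b / 2 := by have := Real.exp_pos (n * (c - s * δ)); linarith
  calc _ ≤ ENNReal.ofReal (b / 2) + ENNReal.ofReal (b / 2) := add_le_add (key s h1) (key (-s) h2)
    _ = _ := by rw [← ENNReal.ofReal_add hb0 hb0]; congr 1; ring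

end Sample

/-! ### The oracle inequalities, reduced to statements about real numbers. -/

section Rates

/-- Clearing denominators shows what the lower bound on `A` is for: it turns `(A - 1) B ≤ 2A S` into
the cone condition `B ≤ (ξ + 1) S`. -/
theorem two_mul_lt_of_div_lt {A ξ : ℝ} (hξ : 1 < ξ) (hA : (ξ + 1) / (ξ - 1) < A) :
    1 < A ∧ 2 * A < (A - 1) * (ξ + 1) := by
  rw [div_lt_iff₀ (by linarith)] at hA
  constructor
  · by_contra h
    nlinarith
  · linarith

/-- The squared ratio of the cone constants is bounded away from one. -/
theorem coneRatio_lt_one {A ξ : ℝ} (hξ : 1 < ξ) (hA : (ξ + 1) / (ξ - 1) < A) :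
    4 * A ^ 2 / ((A - 1) ^ 2 * (ξ + 1) ^ 2) < 1 := by
  obtain ⟨h1, h2⟩ := two_mul_lt_of_div_lt hξ hA
  have h3 : 0 < (A - 1) * (ξ + 1) := mul_pos (by linarith) (by linarith)
  rw [div_lt_one (by nlinarith)]
  nlinarith

-- Here `Dg` is the symmetrized divergence, `B` and `SS` are the norms of the error in total and on
-- the support, and `Q` and `G` are its sample and population quadratic forms. The basic inequality
-- `h1` places the error in the cone, compatibility `h2` then controls `SS` by `G`, and `h3` makes
-- `Q` and `G` comparable. Curvature is used twice: `h4` to bound `exp(B0 * B)`, then `h5` to obtain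
-- the rates.
set_option maxHeartbeats 800000 in
theorem calibration_rate {A ξ lam ν s B0 Dg B SS Q G η11 η12 K : ℝ} (hξ : 1 < ξ)
    (hA : (ξ + 1) / (ξ - 1) < A) (hlam : 0 < lam) (hν : 0 < ν) (hs : 1 ≤ s) (hB0 : 1 ≤ B0)
    (hDg : 0 ≤ Dg) (hSS : 0 ≤ SS) (hSB : SS ≤ B)
    (h1 : Dg + (A - 1) * lam * B ≤ 2 * A * lam * SS)
    (h2 : B - SS ≤ ξ * SS → ν ^ 2 * SS ^ 2 ≤ s * G)
    (h3 : |Q - G| ≤ lam / 2 * B ^ 2)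
    (h4 : (1 - Real.exp (-(B0 * B))) * Q ≤ B0 * B * Dg)
    (h5 : Q ≤ Real.exp (B0 * B) * Dg)
    (hη1 : η11 < 1) (hη2 : η12 < 1)
    (h6 : (ξ + 1) ^ 2 * (ν ^ 2)⁻¹ * s * lam ≤ η11)
    (h7 : B0 * (ξ + 1) ^ 2 * (A - 1) * (1 - η11)⁻¹ * (ν ^ 2)⁻¹ * s * lam ≤ η12)
    (hK : K = (1 - 4 * A ^ 2 / ((A - 1) ^ 2 * (ξ + 1) ^ 2))⁻¹) :
    Real.exp (B0 * B) ≤ K ∧ B ≤ 8 * A ^ 2 * K / (ν ^ 2 * (A - 1)) * (s * lam) ∧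
      G ≤ 16 * A ^ 2 * K ^ 2 / ν ^ 2 * (s * lam ^ 2) ∧ s * lam ≤ ν ^ 2 := by
  obtain ⟨hA1, hA2⟩ := two_mul_lt_of_div_lt hξ hA
  have hρ := coneRatio_lt_one hξ hA
  set ρ := 4 * A ^ 2 / ((A - 1) ^ 2 * (ξ + 1) ^ 2) with hρd
  have hA1' : 0 < A - 1 := by linarith
  have hξ1 : 0 < ξ + 1 := by linarith
  have hρ0 : 0 ≤ ρ := by positivity
  have hρA : ρ * ((A - 1) ^ 2 * (ξ + 1) ^ 2) = 4 * A ^ 2 := by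
    rw [hρd]; field_simp
  have hKpos : 0 < K := by rw [hK]; exact inv_pos.2 (by linarith)
  have hK1 : 1 ≤ K := by rw [hK]; exact (one_le_inv₀ (by linarith)).2 (by linarith)
  have hB : 0 ≤ B := hSS.trans hSB
  have hν2 : 0 < ν ^ 2 := by positivity
  have hcone : B ≤ (ξ + 1) * SS := by
    have e1 : (A - 1) * B ≤ 2 * A * SS := by
      have : lam * ((A - 1) * B) ≤ lam * (2 * A * SS) := by linarith
      exact le_of_mul_le_mul_left this hlam
    have e2 : (A - 1) * B ≤ (A - 1) * ((ξ + 1) * SS) := by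
      linarith [mul_le_mul_of_nonneg_right hA2.le hSS]
    exact le_of_mul_le_mul_left e2 hA1'
  have hc := h2 (by linarith)
  have h6' : (ξ + 1) ^ 2 * (s * lam) ≤ η11 * ν ^ 2 := by
    have := mul_le_mul_of_nonneg_right h6 hν2.le
    field_simp at this
    linarith
  have hη11 : 0 ≤ 1 - η11 := by linarith
  have h7' : B0 * (ξ + 1) ^ 2 * (A - 1) * (s * lam) ≤ (1 - η11) * ν ^ 2 := by
    have h8 : B0 * (ξ + 1) ^ 2 * (A - 1) * (1 - η11)⁻¹ * (ν ^ 2)⁻¹ * s * lam ≤ 1 := by linarith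
    have h9 : 0 < 1 - η11 := by linarith
    have := mul_le_mul_of_nonneg_right h8 (mul_pos h9 hν2).le
    field_simp at this
    linarith
  have hslam : s * lam ≤ ν ^ 2 := by
    have : 1 * (s * lam) ≤ (ξ + 1) ^ 2 * (s * lam) := by
      have : 0 ≤ s * lam := by positivity
      gcongr
      exact one_le_pow₀ (by linarith)
    have h9 : η11 * ν ^ 2 ≤ 1 * ν ^ 2 := by gcongr
    linarith
  have hB2 : B ^ 2 ≤ (ξ + 1) ^ 2 * SS ^ 2 := by
    rw [← mul_pow]; exact pow_le_pow_left₀ hB hcone 2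
  have hG0 : 0 ≤ G := by
    have : 0 ≤ s * G := le_trans (by positivity) hc
    exact nonneg_of_mul_nonneg_right this (by linarith)
  have hGQ : lam / 2 * B ^ 2 ≤ η11 / 2 * G := by
    have e1 : lam / 2 * B ^ 2 * ν ^ 2 ≤ lam / 2 * (ξ + 1) ^ 2 * (s * G) := by
      calc lam / 2 * B ^ 2 * ν ^ 2 ≤ lam / 2 * ((ξ + 1) ^ 2 * SS ^ 2) * ν ^ 2 := by gcongr
        _ = lam / 2 * (ξ + 1) ^ 2 * (ν ^ 2 * SS ^ 2) := by ring
        _ ≤ _ := by gcongr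
    have e2 : lam / 2 * (ξ + 1) ^ 2 * (s * G) ≤ η11 * ν ^ 2 * G / 2 := by
      linarith [mul_le_mul_of_nonneg_right h6' hG0]
    have e3 : ν ^ 2 * (lam / 2 * B ^ 2) ≤ ν ^ 2 * (η11 / 2 * G) := by linarith
    exact le_of_mul_le_mul_left e3 hν2
  have hη0 : 0 ≤ η11 := le_trans (by positivity) h6
  have h3' := abs_le.1 h3
  have hQ1 : (1 - η11) * G ≤ Q := by linarith [mul_nonneg hη0 hG0]
  have hQ2 : G ≤ 2 * Q := by linarith [mul_nonneg hη11 hG0]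
  have hQ0 : 0 ≤ Q := by linarith
  -- Both the divergence and the norm are bounded by `Z`, so a quadratic inequality for `Z` yields
  -- both rates.
  set Z := Dg + (A - 1) * lam * B with hZ
  have hZ0 : 0 ≤ Z := by positivity
  have hZ2 : Z ^ 2 ≤ 4 * A ^ 2 * lam ^ 2 * SS ^ 2 := by
    calc Z ^ 2 ≤ (2 * A * lam * SS) ^ 2 := pow_le_pow_left₀ hZ0 h1 2
      _ = _ := by ring
  have hDZ : Dg ≤ Z := by
    have : 0 ≤ (A - 1) * lam * B := by positivity
    linarith
  have hBZ : (A - 1) * lam * B ≤ Z := by linarith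
  set E := 1 - Real.exp (-(B0 * B)) with hE
  have hE0 : 0 ≤ E := by
    have : Real.exp (-(B0 * B)) ≤ 1 := Real.exp_le_one_iff.2 (neg_nonpos.2 (by positivity))
    linarith
  -- Self-bounding: `h4` has a factor `B` on the right, while `Z` contains `(A - 1) * lam * B` on
  -- the left. Cancelling `B` leaves an inequality for `E` alone, and `η12 < 1` turns it into `E ≤
  -- ρ`.
  have hEρ : E ≤ ρ := by
    rcases hB.eq_or_lt with hB' | hB'
    · rw [hE, ← hB']; simpa using hρ0
    have hZpos : 0 < Z := lt_of_lt_of_le (by positivity) hBZ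
    have e1 : E * (1 - η11) * ν ^ 2 * SS ^ 2 ≤ s * (B0 * B * Z) := by
      calc E * (1 - η11) * ν ^ 2 * SS ^ 2 = E * (1 - η11) * (ν ^ 2 * SS ^ 2) := by ring
        _ ≤ E * (1 - η11) * (s * G) := by gcongr
        _ = s * (E * ((1 - η11) * G)) := by ring
        _ ≤ s * (E * Q) := by gcongr
        _ ≤ s * (B0 * B * Dg) := by gcongr
        _ ≤ _ := by gcongr
    have e2 : E * (1 - η11) * ν ^ 2 * Z ^ 2 ≤ 4 * A ^ 2 * lam ^ 2 * (s * (B0 * B * Z)) := by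
      calc E * (1 - η11) * ν ^ 2 * Z ^ 2
          ≤ E * (1 - η11) * ν ^ 2 * (4 * A ^ 2 * lam ^ 2 * SS ^ 2) := by gcongr
        _ = 4 * A ^ 2 * lam ^ 2 * (E * (1 - η11) * ν ^ 2 * SS ^ 2) := by ring
        _ ≤ _ := by gcongr
    have e3 : E * (1 - η11) * ν ^ 2 * Z ≤ 4 * A ^ 2 * lam ^ 2 * s * (B0 * B) := by
      have : Z * (E * (1 - η11) * ν ^ 2 * Z) ≤ Z * (4 * A ^ 2 * lam ^ 2 * s * (B0 * B)) := by
        linarith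
      exact le_of_mul_le_mul_left this hZpos
    have e4 : E * (1 - η11) * ν ^ 2 * ((A - 1) * lam * B) ≤
        4 * A ^ 2 * lam ^ 2 * s * (B0 * B) := by
      refine le_trans ?_ e3
      gcongr
    have e5 : E * ((1 - η11) * ν ^ 2 * (A - 1)) ≤ ρ * ((1 - η11) * ν ^ 2 * (A - 1)) := by
      have : lam * B * (E * ((1 - η11) * ν ^ 2 * (A - 1))) ≤
          lam * B * (ρ * ((1 - η11) * ν ^ 2 * (A - 1))) := by
        calc lam * B * (E * ((1 - η11) * ν ^ 2 * (A - 1)))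
            = E * (1 - η11) * ν ^ 2 * ((A - 1) * lam * B) := by ring
          _ ≤ _ := e4
          _ = lam * B * (ρ * (A - 1) * (B0 * (ξ + 1) ^ 2 * (A - 1) * (s * lam))) := by
            rw [← hρA]; ring
          _ ≤ lam * B * (ρ * (A - 1) * ((1 - η11) * ν ^ 2)) := by gcongr
          _ = _ := by ring
      exact le_of_mul_le_mul_left this (by positivity)
    have h9 : 0 < 1 - η11 := by linarith
    exact le_of_mul_le_mul_right e5 (by positivity)
  -- Since `ρ < 1`, `e^{-B0 B} ≥ 1 - ρ` can be inverted.
  have hexp : Real.exp (B0 * B) ≤ K := by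
    have e1 : 1 - ρ ≤ Real.exp (-(B0 * B)) := by linarith
    rw [hK, ← inv_inv (Real.exp (B0 * B)), ← Real.exp_neg]
    exact inv_anti₀ (by linarith) e1
  have hQD : Q ≤ K * Dg := h5.trans (by gcongr)
  have hZle : Z ≤ 8 * A ^ 2 * K / ν ^ 2 * (s * lam ^ 2) := by
    rcases hZ0.eq_or_lt with h0 | h0
    · rw [← h0]; positivity
    have : Z * Z ≤ Z * (8 * A ^ 2 * K / ν ^ 2 * (s * lam ^ 2)) := by
      calc Z * Z = Z ^ 2 := by ring
        _ ≤ 4 * A ^ 2 * lam ^ 2 / ν ^ 2 * (ν ^ 2 * SS ^ 2) := by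
          refine hZ2.trans (le_of_eq ?_); field_simp
        _ ≤ 4 * A ^ 2 * lam ^ 2 / ν ^ 2 * (s * (2 * (K * Z))) := by
          refine mul_le_mul_of_nonneg_left (hc.trans ?_) (by positivity)
          refine mul_le_mul_of_nonneg_left ?_ (by linarith)
          exact hQ2.trans (by linarith [hQD.trans (mul_le_mul_of_nonneg_left hDZ hKpos.le)])
        _ = _ := by ring
    exact le_of_mul_le_mul_left this h0
  refine ⟨hexp, ?_, ?_, hslam⟩
  · have e1 : (A - 1) * lam * B ≤ (A - 1) * lam * (8 * A ^ 2 * K / (ν ^ 2 * (A - 1)) * (s * lam)) := by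
      refine (hBZ.trans hZle).trans (le_of_eq ?_)
      field_simp
    exact le_of_mul_le_mul_left e1 (by positivity)
  · calc G ≤ 2 * (K * Z) := by
          linarith [hQD.trans (mul_le_mul_of_nonneg_left hDZ hKpos.le)]
      _ ≤ 2 * (K * (8 * A ^ 2 * K / ν ^ 2 * (s * lam ^ 2))) := by gcongr
      _ = _ := by ring

-- The loss is quadratic, so no self-bounding is needed; `K` compares the fitted weights with the
-- limiting ones. The new feature is the cross term `U * √Q` from estimating the weights, which may
-- push the error out of the cone. Either it is small against the slack in the condition on `A`, and
-- the cone argument survives, or it dominates the basic inequality and bounds the norm without any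
-- compatibility.
set_option maxHeartbeats 800000 in
theorem weightedLS_rate {A ξ l1 l2 ν sγ sα B SS Q G η K U CU : ℝ} (hξ : 1 < ξ)
    (hA : (ξ + 1) / (ξ - 1) < A) (hl1 : 0 < l1) (hl : l1 ≤ l2) (hν : 0 < ν) (hsγ : 0 ≤ sγ)
    (hsα : 1 ≤ sα) (hK : 0 < K) (hSS : 0 ≤ SS) (hSB : SS ≤ B) (hQ : 0 ≤ Q)
    (hCU : 0 ≤ CU) (hU2 : U ^ 2 ≤ CU * (sγ * l1 ^ 2))
    (h1 : Q / K + (A - 1) * l2 * B ≤ 2 * A * l2 * SS + U * Real.sqrt Q)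
    (h2 : B - SS ≤ ξ * SS → ν ^ 2 * SS ^ 2 ≤ sα * G)
    (h3 : |Q - G| ≤ l1 / 2 * B ^ 2) (hη1 : η < 1)
    (h6 : (1 + ξ ^ 2) * (ν ^ 2)⁻¹ * sα * l2 ≤ η) :
    B ≤ ((A - 1) * (1 + ξ) ^ 2 * K / (ν ^ 2 * (1 - η)) +
        (2 * A / ((A - 1) * (ξ + 1) - 2 * A) + 1) ^ 2 * K * CU / (A - 1)) *
      (sγ * l1 + sα * l2) := by
  obtain ⟨hA1, hA2⟩ := two_mul_lt_of_div_lt hξ hA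
  have hA1' : 0 < A - 1 := by linarith
  have hl2 : 0 < l2 := hl1.trans_le hl
  have hB : 0 ≤ B := hSS.trans hSB
  have hν2 : 0 < ν ^ 2 := by positivity
  have hη : 0 < 1 - η := by linarith
  set δ := (A - 1) * (ξ + 1) - 2 * A with hδ
  have hδ0 : 0 < δ := by linarith
  set q := Real.sqrt Q with hq
  have hq0 : 0 ≤ q := Real.sqrt_nonneg _
  have hq2 : q ^ 2 = Q := Real.sq_sqrt hQ
  set Z := Q / K + (A - 1) * l2 * B with hZ
  have hQZ : Q ≤ K * Z := by
    have : 0 ≤ K * ((A - 1) * l2 * B) := by positivity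
    have e : K * Z = Q + K * ((A - 1) * l2 * B) := by rw [hZ]; field_simp
    linarith
  have hBZ : (A - 1) * l2 * B ≤ Z := by
    have : 0 ≤ Q / K := by positivity
    linarith
  have hZ0 : 0 ≤ Z := le_trans (by positivity) hBZ
  have hc2 : 0 ≤ (2 * A / δ + 1) ^ 2 * K * CU / (A - 1) := by positivity
  have hc1 : 0 ≤ (A - 1) * (1 + ξ) ^ 2 * K / (ν ^ 2 * (1 - η)) := by positivity
  have hs1 : 0 ≤ sγ * l1 := by positivity
  have hs2 : 0 ≤ sα * l2 := by positivity
  -- `δ` is the slack: `2A + δ = (A - 1)(ξ + 1)`, so a cross term of at most `δ * l2 * SS` still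
  -- leaves the cone with opening `ξ`.
  rcases le_total (U * q) (δ * l2 * SS) with hcase | hcase
  · have hZ1 : Z ≤ (A - 1) * (1 + ξ) * l2 * SS := by rw [hδ] at hcase; linarith
    have hcone : B ≤ (1 + ξ) * SS := by
      have : (A - 1) * l2 * B ≤ (A - 1) * l2 * ((1 + ξ) * SS) := by linarith
      exact le_of_mul_le_mul_left this (by positivity)
    have hc := h2 (by linarith)
    have hG0 : 0 ≤ G := by
      have : 0 ≤ sα * G := le_trans (by positivity) hc
      exact nonneg_of_mul_nonneg_right this (by linarith)
    have h6' : (1 + ξ ^ 2) * (sα * l2) ≤ η * ν ^ 2 := by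
      have := mul_le_mul_of_nonneg_right h6 hν2.le
      field_simp at this
      linarith
    have hB2 : B ^ 2 ≤ (1 + ξ) ^ 2 * SS ^ 2 := by
      rw [← mul_pow]; exact pow_le_pow_left₀ hB hcone 2
    have hGQ : l1 / 2 * B ^ 2 ≤ η * G := by
      have e0 : (1 + ξ) ^ 2 ≤ 2 * (1 + ξ ^ 2) := by nlinarith [sq_nonneg (ξ - 1)]
      have e1 : ν ^ 2 * (l1 / 2 * B ^ 2) ≤ ν ^ 2 * (η * G) := by
        calc ν ^ 2 * (l1 / 2 * B ^ 2) ≤ ν ^ 2 * (l2 / 2 * (2 * (1 + ξ ^ 2) * SS ^ 2)) := by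
              gcongr
              exact hB2.trans (by gcongr)
          _ = l2 * (1 + ξ ^ 2) * (ν ^ 2 * SS ^ 2) := by ring
          _ ≤ l2 * (1 + ξ ^ 2) * (sα * G) := by gcongr
          _ = (1 + ξ ^ 2) * (sα * l2) * G := by ring
          _ ≤ η * ν ^ 2 * G := by gcongr
          _ = _ := by ring
      exact le_of_mul_le_mul_left e1 hν2
    have hQ1 : (1 - η) * G ≤ Q := by linarith [(abs_le.1 h3).1]
    have hZle : Z ≤ (A - 1) ^ 2 * (1 + ξ) ^ 2 * K / (ν ^ 2 * (1 - η)) * (sα * l2 ^ 2) := by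
      rcases hZ0.eq_or_lt with h0 | h0
      · rw [← h0]; positivity
      have : Z * Z ≤ Z * ((A - 1) ^ 2 * (1 + ξ) ^ 2 * K / (ν ^ 2 * (1 - η)) * (sα * l2 ^ 2)) := by
        calc Z * Z = Z ^ 2 := by ring
          _ ≤ ((A - 1) * (1 + ξ) * l2 * SS) ^ 2 := pow_le_pow_left₀ hZ0 hZ1 2
          _ = (A - 1) ^ 2 * (1 + ξ) ^ 2 * l2 ^ 2 / (ν ^ 2 * (1 - η)) *
              ((1 - η) * (ν ^ 2 * SS ^ 2)) := by field_simp
          _ ≤ (A - 1) ^ 2 * (1 + ξ) ^ 2 * l2 ^ 2 / (ν ^ 2 * (1 - η)) * (sα * (K * Z)) := by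
            refine mul_le_mul_of_nonneg_left ?_ (by positivity)
            calc (1 - η) * (ν ^ 2 * SS ^ 2) ≤ (1 - η) * (sα * G) := by gcongr
              _ = sα * ((1 - η) * G) := by ring
              _ ≤ sα * (K * Z) :=
                mul_le_mul_of_nonneg_left (hQ1.trans hQZ) (by linarith)
          _ = _ := by ring
      exact le_of_mul_le_mul_left this h0
    have e1 : (A - 1) * l2 * B ≤
        (A - 1) * l2 * ((A - 1) * (1 + ξ) ^ 2 * K / (ν ^ 2 * (1 - η)) * (sα * l2)) :=
      (hBZ.trans hZle).trans (le_of_eq (by ring))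
    have e2 := le_of_mul_le_mul_left e1 (by positivity)
    exact e2.trans (mul_le_mul (le_add_of_nonneg_right hc2) (le_add_of_nonneg_left hs1) hs2
      (add_nonneg hc1 hc2))
  · set κ := 2 * A / δ + 1 with hκ
    have hκ0 : 0 ≤ κ := by positivity
    have hZ1 : Z ≤ κ * (U * q) := by
      have e1 : 2 * A * l2 * SS = 2 * A / δ * (δ * l2 * SS) := by field_simp
      have e2 : 2 * A / δ * (δ * l2 * SS) ≤ 2 * A / δ * (U * q) := by gcongr
      rw [hκ]; linarith
    have hZle : Z ≤ κ ^ 2 * K * CU * (sγ * l1 ^ 2) := by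
      rcases hZ0.eq_or_lt with h0 | h0
      · rw [← h0]; positivity
      have : Z * Z ≤ Z * (κ ^ 2 * K * CU * (sγ * l1 ^ 2)) := by
        calc Z * Z = Z ^ 2 := by ring
          _ ≤ (κ * (U * q)) ^ 2 := pow_le_pow_left₀ hZ0 hZ1 2
          _ = κ ^ 2 * (U ^ 2 * Q) := by rw [← hq2]; ring
          _ ≤ κ ^ 2 * (CU * (sγ * l1 ^ 2) * (K * Z)) := by gcongr
          _ = _ := by ring
      exact le_of_mul_le_mul_left this h0
    have e1 : (A - 1) * l2 * B ≤ (A - 1) * l2 * (κ ^ 2 * K * CU / (A - 1) * (sγ * l1)) := by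
      calc _ ≤ _ := hBZ.trans hZle
        _ = κ ^ 2 * K * CU * sγ * (l1 * l1) := by ring
        _ ≤ κ ^ 2 * K * CU * sγ * (l2 * l1) := by gcongr
        _ = _ := by field_simp
    have e2 := le_of_mul_le_mul_left e1 (by positivity)
    exact e2.trans (mul_le_mul (le_add_of_nonneg_left hc1) (le_add_of_nonneg_right hs2) hs1
      (add_nonneg hc1 hc2))

end Rates

/-! ### Group norms, linear predictors, sample means and quadratic forms. -/

noncomputable section

namespace Study

variable (D : Study.{u})

theorem rowNorm_eq_norm (b : D.Coef) (j : Fin (D.p + 1)) :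
    D.rowNorm b j = ‖WithLp.toLp 2 (b j)‖ := by
  simp [rowNorm, EuclideanSpace.norm_eq]

theorem rowNorm_nonneg (b : D.Coef) (j : Fin (D.p + 1)) : 0 ≤ D.rowNorm b j := Real.sqrt_nonneg _

theorem rowNorm_add_le (b c : D.Coef) (j : Fin (D.p + 1)) :
    D.rowNorm (b + c) j ≤ D.rowNorm b j + D.rowNorm c j := by
  simp only [rowNorm_eq_norm]
  exact norm_add_le (WithLp.toLp 2 (b j)) (WithLp.toLp 2 (c j))

theorem rowNorm_smul (s : ℝ) (b : D.Coef) (j : Fin (D.p + 1)) :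
    D.rowNorm (s • b) j = |s| * D.rowNorm b j := by
  simp only [rowNorm_eq_norm]
  exact norm_smul s (WithLp.toLp 2 (b j))

theorem abs_entry_le_rowNorm (b : D.Coef) (j : Fin (D.p + 1)) (k : D.Other) :
    |b j k| ≤ D.rowNorm b j := by
  rw [← Real.sqrt_sq_eq_abs]
  exact Real.sqrt_le_sqrt
    (Finset.single_le_sum (f := fun k => b j k ^ 2) (fun _ _ => sq_nonneg _) (Finset.mem_univ k))

theorem sum_mul_row_le (v : D.Other → ℝ) {τ : ℝ} (hτ : 0 ≤ τ) (hv : ∑ k, v k ^ 2 ≤ τ ^ 2)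
    (b : D.Coef) (j : Fin (D.p + 1)) : ∑ k, v k * b j k ≤ τ * D.rowNorm b j := by
  refine (Real.sum_mul_le_sqrt_mul_sqrt _ _ _).trans ?_
  refine mul_le_mul_of_nonneg_right ?_ (D.rowNorm_nonneg b j)
  rw [← Real.sqrt_sq hτ]
  exact Real.sqrt_le_sqrt hv

/-- The sum of the Euclidean norms of all rows, the intercept row included. -/
def totalNorm (b : D.Coef) : ℝ := ∑ j, D.rowNorm b j

theorem totalNorm_nonneg (b : D.Coef) : 0 ≤ D.totalNorm b :=
  Finset.sum_nonneg fun _ _ => D.rowNorm_nonneg b _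

theorem continuous_rowNorm (j : Fin (D.p + 1)) : Continuous fun b : D.Coef => D.rowNorm b j := by
  unfold rowNorm
  refine Real.continuous_sqrt.comp (continuous_finsetSum _ fun k _ => ?_)
  exact (continuous_id.matrix_elem j k).pow 2

theorem continuous_totalNorm : Continuous D.totalNorm :=
  continuous_finsetSum _ fun j _ => D.continuous_rowNorm j

theorem continuous_penalty : Continuous D.penalty :=
  continuous_finsetSum _ fun j _ => D.continuous_rowNorm j.succ

theorem penalty_segment_le (x y : D.Coef) {s : ℝ} (h0 : 0 ≤ s) (h1 : s ≤ 1) :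
    D.penalty (x + s • (y - x)) ≤ (1 - s) * D.penalty x + s * D.penalty y := by
  unfold penalty
  rw [Finset.mul_sum, Finset.mul_sum, ← Finset.sum_add_distrib]
  refine Finset.sum_le_sum fun j _ => ?_
  rw [show x + s • (y - x) = (1 - s) • x + s • y by module]
  refine (D.rowNorm_add_le _ _ _).trans (le_of_eq ?_)
  rw [rowNorm_smul, rowNorm_smul, abs_of_nonneg h0, abs_of_nonneg (sub_nonneg.2 h1)]

theorem sum_support_add_sum_compl (b c : D.Coef) :
    ∑ j ∈ D.support c, D.rowNorm b j + ∑ j ∈ (D.support c)ᶜ, D.rowNorm b j = D.totalNorm b :=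
  Finset.sum_add_sum_compl _ _

theorem one_le_card_support (c : D.Coef) : (1 : ℝ) ≤ (D.support c).card := by
  have : 0 < (D.support c).card := Finset.card_pos.2 ⟨0, by simp [support]⟩
  exact_mod_cast this

/-- The cone inequality for the penalty. -/
theorem totalNorm_add_penalty_sub_le (x y : D.Coef) :
    D.totalNorm (x - y) + (D.penalty y - D.penalty x) ≤
      2 * ∑ j ∈ D.support y, D.rowNorm (x - y) j := by
  classical
  have hs : ∑ j ∈ D.support y, D.rowNorm (x - y) j =
      D.rowNorm (x - y) 0 + ∑ j : Fin D.p,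
        if j.succ ∈ D.support y then D.rowNorm (x - y) j.succ else 0 := by
    have e : ∑ j ∈ D.support y, D.rowNorm (x - y) j =
        ∑ j, if j ∈ D.support y then D.rowNorm (x - y) j else 0 := by
      rw [← Finset.sum_filter]; simp
    rw [e, Fin.sum_univ_succ, if_pos (by simp [support])]
  unfold totalNorm penalty
  rw [hs, Fin.sum_univ_succ, ← Finset.sum_sub_distrib, add_assoc, ← Finset.sum_add_distrib,
    mul_add, Finset.mul_sum]
  -- The unpenalized intercept row belongs to the support by definition, so the doubled sum covers
  -- it. Rows on the support use the triangle inequality; off the support `y` vanishes, and the rows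
  -- of `x - y` and `x` cancel.
  refine add_le_add ?_ (Finset.sum_le_sum fun j _ => ?_)
  · linarith [D.rowNorm_nonneg (x - y) 0]
  · split_ifs with h
    · have h1 := D.rowNorm_add_le (y - x) x j.succ
      have h2 : D.rowNorm (y - x) j.succ = D.rowNorm (x - y) j.succ := by
        rw [← neg_sub, ← neg_one_smul ℝ, rowNorm_smul]; simp
      rw [sub_add_cancel] at h1
      linarith
    · have hy : y j.succ = 0 := by
        by_contra h'
        exact h (by simp [support, h'])
      have h1 : D.rowNorm (x - y) j.succ = D.rowNorm x j.succ := by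
        simp [rowNorm, hy]
      have h2 : D.rowNorm y j.succ = 0 := by simp [rowNorm, hy]
      linarith

/-! Linear predictors. -/

theorem lin_other (b : D.Coef) (k : D.Other) (x : Fin D.d → ℝ) :
    D.lin b k x = ∑ j, b j k * D.f x j := by
  unfold lin col
  refine Finset.sum_congr rfl fun j _ => ?_
  rw [dif_pos k.2]

theorem lin_t (b : D.Coef) (x : Fin D.d → ℝ) : D.lin b D.t x = 0 := by
  simp [lin, col]

theorem lin_add (b c : D.Coef) (k : D.Other) (x : Fin D.d → ℝ) :
    D.lin (b + c) k x = D.lin b k x + D.lin c k x := by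
  simp [lin_other, add_mul, Finset.sum_add_distrib]

theorem lin_smul (s : ℝ) (b : D.Coef) (k : D.Other) (x : Fin D.d → ℝ) :
    D.lin (s • b) k x = s * D.lin b k x := by
  simp [lin_other, Finset.mul_sum, mul_assoc]

theorem lin_sub (b c : D.Coef) (k : D.Other) (x : Fin D.d → ℝ) :
    D.lin (b - c) k x = D.lin b k x - D.lin c k x := by
  simp [lin_other, sub_mul, Finset.sum_sub_distrib]

theorem continuous_lin (k : D.Other) (x : Fin D.d → ℝ) : Continuous fun b : D.Coef => D.lin b k x := by
  simp_rw [lin_other]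
  exact continuous_finsetSum _ fun j _ => (continuous_id.matrix_elem j k).mul_const _

theorem measurable_lin (b : D.Coef) (k : D.Other) : Measurable (D.lin b k) := by
  have : D.lin b k = fun x => ∑ j, b j k * D.f x j := funext (D.lin_other b k)
  rw [this]
  exact Finset.measurable_sum _ fun j _ =>
    ((measurable_pi_apply j).comp D.measurable_f).const_mul _

theorem abs_lin_le {B0 : ℝ} {x : Fin D.d → ℝ} (hx : ∀ j, |D.f x j| ≤ B0) (b : D.Coef)
    (k : D.Other) : |D.lin b k x| ≤ B0 * D.totalNorm b := by
  rw [lin_other, totalNorm, Finset.mul_sum]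
  refine (Finset.abs_sum_le_sum_abs _ _).trans (Finset.sum_le_sum fun j _ => ?_)
  rw [abs_mul, mul_comm]
  exact mul_le_mul (hx j) (D.abs_entry_le_rowNorm b j k) (abs_nonneg _)
    ((abs_nonneg _).trans (hx j))

theorem ratio_eq (γ : D.Coef) (k : Fin D.K) (x : Fin D.d → ℝ) :
    D.prop γ k x / D.prop γ D.t x = Real.exp (D.lin γ k x) := by
  have h : (0 : ℝ) < ∑ l, Real.exp (D.lin γ l x) :=
    Finset.sum_pos (fun _ _ => Real.exp_pos _) ⟨D.t, Finset.mem_univ _⟩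
  simp only [prop, lin_t, Real.exp_zero]
  field_simp

/-- Through this identity the overlap condition says that all ratios together sum to at most `B1 -
1`. Sums over treatments are then controlled without a factor `K - 1`. -/
theorem inv_prop_t (γ : D.Coef) (x : Fin D.d → ℝ) :
    (D.prop γ D.t x)⁻¹ = 1 + ∑ k : D.Other, Real.exp (D.lin γ k x) := by
  have h := Fintype.sum_subtype_add_sum_subtype (fun k => k ≠ D.t) fun k => Real.exp (D.lin γ k x)
  have h2 : ∑ k : {k // ¬ (k ≠ D.t)}, Real.exp (D.lin γ k x) = 1 := by
    have : Unique {k // ¬ (k ≠ D.t)} := ⟨⟨⟨D.t, by simp⟩⟩, fun k => by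
      obtain ⟨k, hk⟩ := k
      simp only [ne_eq, not_not] at hk
      subst hk; rfl⟩
    rw [Fintype.sum_unique]
    have h3 : (default : {k // ¬ (k ≠ D.t)}).1 = D.t := not_not.1 (default : {k // ¬ (k ≠ D.t)}).2
    rw [h3, lin_t, Real.exp_zero]
  simp only [prop, lin_t, Real.exp_zero]
  rw [one_div, inv_inv]
  rw [← h, h2, add_comm]

/-! Weights and sample means. -/

/-- The weight `R^(t) exp(γ_kᵀ f(X))` of an observation. -/
def wt (γ : D.Coef) (k : D.Other) (o : Obs D.K D.d) : ℝ :=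
  D.R D.t o * Real.exp (D.lin γ k o.2.2)

/-- The residual `Y - α_kᵀ f(X)` of an observation. -/
def res (α : D.Coef) (k : D.Other) (o : Obs D.K D.d) : ℝ := o.1 - D.lin α k o.2.2

theorem R_nonneg (k : Fin D.K) (o : Obs D.K D.d) : 0 ≤ D.R k o := by
  unfold R; split_ifs <;> norm_num

theorem R_le_one (k : Fin D.K) (o : Obs D.K D.d) : D.R k o ≤ 1 := by
  unfold R; split_ifs <;> norm_num

theorem wt_nonneg (γ : D.Coef) (k : D.Other) (o : Obs D.K D.d) : 0 ≤ D.wt γ k o :=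
  mul_nonneg (D.R_nonneg _ _) (Real.exp_pos _).le

theorem measurable_R (k : Fin D.K) : Measurable (D.R k) := by
  unfold R
  exact Measurable.ite (measurableSet_eq_fun (measurable_fst.comp measurable_snd)
    measurable_const) measurable_const measurable_const

theorem measurable_wt (γ : D.Coef) (k : D.Other) : Measurable (D.wt γ k) :=
  (D.measurable_R _).mul (Real.measurable_exp.comp
    ((D.measurable_lin γ k).comp (measurable_snd.comp measurable_snd)))

theorem measurable_res (α : D.Coef) (k : D.Other) : Measurable (D.res α k) :=
  measurable_fst.sub ((D.measurable_lin α k).comp (measurable_snd.comp measurable_snd))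

theorem wt_eq (γ γ' : D.Coef) (k : D.Other) (o : Obs D.K D.d) :
    D.wt γ' k o = D.wt γ k o * Real.exp (D.lin (γ' - γ) k o.2.2) := by
  rw [wt, wt, mul_assoc, ← Real.exp_add, lin_sub]; ring_nf

theorem res_eq (α α' : D.Coef) (k : D.Other) (o : Obs D.K D.d) :
    D.res α' k o = D.res α k o - D.lin (α' - α) k o.2.2 := by
  rw [res, res, lin_sub]; ring

variable {D} {ω : D.Ω}

theorem natCast_n_pos : (0 : ℝ) < D.n := by exact_mod_cast D.n_pos

theorem sampleMean_add (g h : Obs D.K D.d → ℝ) :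
    D.sampleMean (fun o => g o + h o) ω = D.sampleMean g ω + D.sampleMean h ω := by
  simp [sampleMean, Finset.sum_add_distrib, add_div]

theorem sampleMean_sub (g h : Obs D.K D.d → ℝ) :
    D.sampleMean (fun o => g o - h o) ω = D.sampleMean g ω - D.sampleMean h ω := by
  simp [sampleMean, Finset.sum_sub_distrib, sub_div]

theorem sampleMean_const_mul (c : ℝ) (g : Obs D.K D.d → ℝ) :
    D.sampleMean (fun o => c * g o) ω = c * D.sampleMean g ω := by
  simp [sampleMean, ← Finset.mul_sum, mul_div_assoc]

theorem sampleMean_mul_const (c : ℝ) (g : Obs D.K D.d → ℝ) :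
    D.sampleMean (fun o => g o * c) ω = D.sampleMean g ω * c := by
  simp_rw [mul_comm _ c]; exact sampleMean_const_mul c g

theorem sampleMean_const (c : ℝ) : D.sampleMean (fun _ => c) ω = c := by
  have := D.n_pos
  simp [sampleMean]; field_simp

theorem sampleMean_sum {ι : Type*} (s : Finset ι) (g : ι → Obs D.K D.d → ℝ) :
    D.sampleMean (fun o => ∑ k ∈ s, g k o) ω = ∑ k ∈ s, D.sampleMean (g k) ω := by
  simp only [sampleMean, ← Finset.sum_div]
  rw [Finset.sum_comm]

theorem sampleMean_mono {g h : Obs D.K D.d → ℝ}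
    (H : ∀ i, g (D.sample i ω) ≤ h (D.sample i ω)) : D.sampleMean g ω ≤ D.sampleMean h ω :=
  div_le_div_of_nonneg_right (Finset.sum_le_sum fun i _ => H i) (Nat.cast_nonneg _)

theorem sampleMean_congr {g h : Obs D.K D.d → ℝ}
    (H : ∀ i, g (D.sample i ω) = h (D.sample i ω)) : D.sampleMean g ω = D.sampleMean h ω := by
  simp [sampleMean, H]

theorem sampleMean_nonneg {g : Obs D.K D.d → ℝ}
    (H : ∀ i, 0 ≤ g (D.sample i ω)) : 0 ≤ D.sampleMean g ω :=
  div_nonneg (Finset.sum_nonneg fun i _ => H i) (Nat.cast_nonneg _)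

theorem sampleMean_mul_le (g h : Obs D.K D.d → ℝ) :
    D.sampleMean (fun o => g o * h o) ω ≤
      Real.sqrt (D.sampleMean (fun o => g o ^ 2) ω) *
        Real.sqrt (D.sampleMean (fun o => h o ^ 2) ω) := by
  have hn := natCast_n_pos (D := D)
  unfold sampleMean
  rw [← Real.sqrt_mul (div_nonneg (Finset.sum_nonneg fun _ _ => sq_nonneg _) hn.le)]
  apply Real.le_sqrt_of_sq_le
  rw [div_pow, div_mul_div_comm, ← sq]
  gcongr
  exact Finset.sum_mul_sq_le_sq_mul_sq _ _ _

theorem continuous_sampleMean {E : Type*} [TopologicalSpace E] {g : E → Obs D.K D.d → ℝ}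
    (H : ∀ o, Continuous fun e => g e o) : Continuous fun e => D.sampleMean (g e) ω :=
  (continuous_finsetSum _ fun _ _ => H _).div_const _

theorem measurable_sampleMean {g : Obs D.K D.d → ℝ} (hg : Measurable g) :
    Measurable (D.sampleMean g) :=
  (Finset.measurable_sum _ fun i _ => hg.comp (D.measurable_sample i)).div_const _

/-! Quadratic forms. -/

variable (D) in
/-- `∑_k b_kᵀ M_k b_k`. -/
def quad (M : D.Other → Fin (D.p + 1) → Fin (D.p + 1) → ℝ) (b : D.Coef) : ℝ :=
  ∑ k, ∑ j1, ∑ j2, b j1 k * M k j1 j2 * b j2 k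

/-- Cauchy–Schwarz over the treatments is applied for each pair of rows before the rows are summed,
so an entrywise error costs only the squared group norm, whatever the number of treatments. -/
theorem abs_quad_sub_le {M M' : D.Other → Fin (D.p + 1) → Fin (D.p + 1) → ℝ} {δ : ℝ}
    (h : ∀ k j1 j2, |M k j1 j2 - M' k j1 j2| ≤ δ) (b : D.Coef) :
    |D.quad M b - D.quad M' b| ≤ δ * D.totalNorm b ^ 2 := by
  unfold quad
  simp_rw [← Finset.sum_sub_distrib]
  have hcs : ∀ j1 j2, ∑ k, |b j1 k| * |b j2 k| ≤ D.rowNorm b j1 * D.rowNorm b j2 := fun j1 j2 => by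
    refine (Real.sum_mul_le_sqrt_mul_sqrt _ _ _).trans (le_of_eq ?_)
    simp [rowNorm]
  calc _ ≤ ∑ k, ∑ j1, ∑ j2, |b j1 k| * |b j2 k| * δ := by
        refine (Finset.abs_sum_le_sum_abs _ _).trans (Finset.sum_le_sum fun k _ => ?_)
        refine (Finset.abs_sum_le_sum_abs _ _).trans (Finset.sum_le_sum fun j1 _ => ?_)
        refine (Finset.abs_sum_le_sum_abs _ _).trans (Finset.sum_le_sum fun j2 _ => ?_)
        rw [show b j1 k * M k j1 j2 * b j2 k - b j1 k * M' k j1 j2 * b j2 k =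
          b j1 k * b j2 k * (M k j1 j2 - M' k j1 j2) by ring, abs_mul, abs_mul]
        exact mul_le_mul_of_nonneg_left (h k j1 j2) (by positivity)
    _ = ∑ j1, ∑ j2, (∑ k, |b j1 k| * |b j2 k|) * δ := by
        rw [Finset.sum_comm]
        refine Finset.sum_congr rfl fun j1 _ => ?_
        rw [Finset.sum_comm]
        simp_rw [Finset.sum_mul]
    _ ≤ ∑ j1, ∑ j2, D.rowNorm b j1 * D.rowNorm b j2 * δ := by
        refine Finset.sum_le_sum fun j1 _ => Finset.sum_le_sum fun j2 _ => ?_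
        -- Nonnegativity of `δ` can be read off from the entrywise bound only when there is an
        -- entry.
        by_cases hK : Nonempty D.Other
        · obtain ⟨k⟩ := hK
          exact mul_le_mul_of_nonneg_right (hcs j1 j2) ((abs_nonneg _).trans (h k j1 j2))
        · rw [not_nonempty_iff] at hK
          simp [rowNorm]
    _ = _ := by
        unfold totalNorm
        rw [sq, Finset.sum_mul_sum, Finset.mul_sum]
        simp_rw [Finset.mul_sum]
        refine Finset.sum_congr rfl fun _ _ => Finset.sum_congr rfl fun _ _ => by ring

theorem lin_sq (b : D.Coef) (k : D.Other) (x : Fin D.d → ℝ) :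
    D.lin b k x ^ 2 = ∑ j1, ∑ j2, b j1 k * (D.f x j1 * D.f x j2) * b j2 k := by
  rw [lin_other, sq, Finset.sum_mul_sum]
  refine Finset.sum_congr rfl fun _ _ => Finset.sum_congr rfl fun _ _ => by ring

theorem sampleMean_sum_mul_lin_sq (g : D.Other → Obs D.K D.d → ℝ) (b : D.Coef) :
    D.sampleMean (fun o => ∑ k, g k o * D.lin b k o.2.2 ^ 2) ω =
      D.quad (fun k j1 j2 =>
        D.sampleMean (fun o => g k o * (D.f o.2.2 j1 * D.f o.2.2 j2)) ω) b := by
  rw [sampleMean_sum]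
  unfold quad
  refine Finset.sum_congr rfl fun k _ => ?_
  simp_rw [lin_sq, Finset.mul_sum]
  rw [sampleMean_sum]
  refine Finset.sum_congr rfl fun j1 _ => ?_
  rw [sampleMean_sum]
  refine Finset.sum_congr rfl fun j2 _ => ?_
  rw [← sampleMean_const_mul, ← sampleMean_mul_const]
  exact sampleMean_congr fun i => by ring

end Study

end

/-! ### Convexity, existence of minimizers and first-order conditions. -/

noncomputable section

/-- Divide by `s` and let `s` tend to zero. This extracts first-order conditions from minimality
without forming derivatives. -/
theorem le_of_forall_mul_sub_sq_le {a b c : ℝ}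
    (h : ∀ s : ℝ, 0 < s → s ≤ 1 → s * a - s ^ 2 * c ≤ s * b) : a ≤ b := by
  by_contra hab
  push Not at hab
  have hd : 0 < a - b := sub_pos.2 hab
  have hc : 0 < |c| + 1 := by positivity
  set s := min 1 ((a - b) / (2 * (|c| + 1))) with hs
  have hs0 : 0 < s := by positivity
  have h1 := h s hs0 (min_le_left _ _)
  have h2 : s ≤ (a - b) / (2 * (|c| + 1)) := min_le_right _ _
  rw [le_div_iff₀ (by positivity)] at h2
  have h3 : s * (a - b) ≤ s * (s * c) := by nlinarith
  have h4 := le_of_mul_le_mul_left h3 hs0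
  have h5 : s * c ≤ s * |c| := mul_le_mul_of_nonneg_left (le_abs_self c) hs0.le
  nlinarith

namespace Study

variable (D : Study.{u})

/-- `x` minimizes `F` over the segment from `x` to `y`. -/
def SegmentMin (F : D.Coef → ℝ) (y x : D.Coef) : Prop :=
  ∀ s : ℝ, 0 ≤ s → s ≤ 1 → F x ≤ F (x + s • (y - x))

theorem totalNorm_smul (s : ℝ) (b : D.Coef) : D.totalNorm (s • b) = |s| * D.totalNorm b := by
  simp [totalNorm, rowNorm_smul, Finset.mul_sum]

/-- A continuous convex function has a minimizer if the points that are minimal along the segment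
to a fixed point are bounded. -/
theorem exists_minimizer {F : D.Coef → ℝ} (hF : Continuous F) (hconv : ConvexOn ℝ Set.univ F)
    (y : D.Coef) {ρ : ℝ} (hρ : 0 < ρ)
    (h : ∀ x, D.SegmentMin F y x → D.totalNorm (x - y) < ρ) : ∃ x, ∀ z, F x ≤ F z := by
  set B : Set D.Coef := {x | D.totalNorm (x - y) ≤ ρ} with hB
  have hcont : Continuous fun x : D.Coef => D.totalNorm (x - y) :=
    D.continuous_totalNorm.comp (continuous_id.sub continuous_const)
  have hcompact : IsCompact B := by
    have hsub : ∀ x : D.Coef, x ∈ B → ∀ j k, x j k ∈ Set.Icc (y j k - ρ) (y j k + ρ) := by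
      intro x hx j k
      have h1 : |(x - y) j k| ≤ ρ := (D.abs_entry_le_rowNorm _ j k).trans
        ((Finset.single_le_sum (f := fun j => D.rowNorm (x - y) j)
          (fun _ _ => D.rowNorm_nonneg _ _) (Finset.mem_univ j)).trans hx)
      have h2 := abs_le.1 h1
      simp only [Matrix.sub_apply] at h2
      exact ⟨by linarith, by linarith⟩
    have hbox : IsCompact (Set.pi Set.univ fun j => Set.pi Set.univ fun k =>
        Set.Icc (y j k - ρ) (y j k + ρ) : Set D.Coef) :=
      isCompact_univ_pi fun j => isCompact_univ_pi fun k => isCompact_Icc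
    exact hbox.of_isClosed_subset (isClosed_le hcont continuous_const)
      fun x hx j _ k _ => hsub x hx j k
  have hyB : y ∈ B := by
    simp only [hB, Set.mem_ofPred_eq, sub_self]
    have : D.totalNorm 0 = 0 := by simp [totalNorm, rowNorm]
    rw [this]; exact hρ.le
  obtain ⟨x, hxB, hx⟩ := hcompact.exists_isMinOn ⟨y, hyB⟩ hF.continuousOn
  -- The segment to the centre stays in the ball, so a minimizer over the ball is minimal along its
  -- segment. The hypothesis then places it strictly inside, where it is a local and, by convexity,
  -- a global minimizer.
  have hseg : D.SegmentMin F y x := fun s h0 h1 => by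
    apply hx
    simp only [hB, Set.mem_ofPred_eq] at hxB ⊢
    rw [show x + s • (y - x) - y = (1 - s) • (x - y) by module, totalNorm_smul,
      abs_of_nonneg (sub_nonneg.2 h1)]
    nlinarith [D.totalNorm_nonneg (x - y)]
  have hlt := h x hseg
  have hloc : IsLocalMin F x := by
    filter_upwards [(isOpen_lt hcont continuous_const).mem_nhds hlt] with z hz
    exact hx (le_of_lt hz)
  exact ⟨x, fun z => IsMinOn.of_isLocalMin_of_convex_univ hloc hconv z⟩

theorem convexOn_penalty : ConvexOn ℝ Set.univ D.penalty := by
  refine ⟨convex_univ, fun x _ y _ a b ha hb hab => ?_⟩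
  have h := D.penalty_segment_le x y hb (by linarith)
  rw [show x + b • (y - x) = a • x + b • y by
    rw [show a = 1 - b by linarith]; module] at h
  rw [show a = 1 - b by linarith] at h ⊢
  simpa using h

variable {D} {ω : D.Ω}

theorem convexOn_sampleMean {g : D.Coef → Obs D.K D.d → ℝ}
    (h : ∀ o, ConvexOn ℝ Set.univ fun γ => g γ o) :
    ConvexOn ℝ Set.univ fun γ => D.sampleMean (g γ) ω := by
  refine ⟨convex_univ, fun x _ y _ a b ha hb hab => ?_⟩
  simp only [smul_eq_mul]
  rw [← sampleMean_const_mul, ← sampleMean_const_mul, ← sampleMean_add]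
  exact sampleMean_mono fun i => (h _).2 (Set.mem_univ x) (Set.mem_univ y) ha hb hab

variable (D)

theorem convexOn_lossCAL (o : Obs D.K D.d) : ConvexOn ℝ Set.univ fun γ => D.lossCAL γ o := by
  refine ⟨convex_univ, fun x _ y _ a b ha hb hab => ?_⟩
  simp only [lossCAL, smul_eq_mul]
  rw [Finset.mul_sum, Finset.mul_sum, ← Finset.sum_add_distrib]
  refine Finset.sum_le_sum fun k _ => ?_
  rw [lin_add, lin_smul, lin_smul]
  have h := convexOn_exp.2 (Set.mem_univ (D.lin x k o.2.2)) (Set.mem_univ (D.lin y k o.2.2)) ha hb hab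
  simp only [smul_eq_mul] at h
  have := mul_le_mul_of_nonneg_left h (D.R_nonneg D.t o)
  linarith

theorem lossWL_eq (γ α : D.Coef) (o : Obs D.K D.d) :
    D.lossWL γ α o = ∑ k, D.wt γ k o * D.res α k o ^ 2 / 2 := rfl

theorem convexOn_lossWL (γ : D.Coef) (o : Obs D.K D.d) :
    ConvexOn ℝ Set.univ fun α => D.lossWL γ α o := by
  refine ⟨convex_univ, fun x _ y _ a b ha hb hab => ?_⟩
  simp only [lossWL_eq, smul_eq_mul]
  rw [Finset.mul_sum, Finset.mul_sum, ← Finset.sum_add_distrib]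
  refine Finset.sum_le_sum fun k _ => ?_
  have e : D.res (a • x + b • y) k o = a * D.res x k o + b * D.res y k o := by
    simp only [res]
    rw [lin_add, lin_smul, lin_smul]
    linear_combination (-o.1) * hab
  rw [e]
  have h : (a * D.res x k o + b * D.res y k o) ^ 2 ≤ a * D.res x k o ^ 2 + b * D.res y k o ^ 2 := by
    have hb' : b = 1 - a := by linarith
    subst hb'
    nlinarith [mul_nonneg (mul_nonneg ha hb) (sq_nonneg (D.res x k o - D.res y k o))]
  have := mul_le_mul_of_nonneg_left h (D.wt_nonneg γ k o)
  linarith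

theorem continuous_lossCAL (o : Obs D.K D.d) : Continuous fun γ => D.lossCAL γ o :=
  continuous_finsetSum _ fun k _ =>
    ((Real.continuous_exp.comp (D.continuous_lin k o.2.2)).const_mul _).sub
      ((D.continuous_lin k o.2.2).const_mul _)

theorem continuous_lossWL (γ : D.Coef) (o : Obs D.K D.d) : Continuous fun α => D.lossWL γ α o :=
  continuous_finsetSum _ fun k _ =>
    (((continuous_const.sub (D.continuous_lin k o.2.2)).pow 2).const_mul _).div_const _

/-- The penalized calibration objective. -/
def objCAL (l : ℝ) (ω : D.Ω) (γ : D.Coef) : ℝ := D.sampleMean (D.lossCAL γ) ω + l * D.penalty γ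

/-- The penalized weighted least squares objective. -/
def objWL (l : ℝ) (ω : D.Ω) (γ α : D.Coef) : ℝ :=
  D.sampleMean (D.lossWL γ α) ω + l * D.penalty α

theorem exists_isRCAL {l : ℝ} (hl : 0 ≤ l) (γ : D.Coef) {ρ : ℝ} (hρ : 0 < ρ)
    (h : ∀ x, D.SegmentMin (D.objCAL l ω) γ x → D.totalNorm (x - γ) < ρ) :
    ∃ x, D.IsRCAL l ω x :=
  D.exists_minimizer
    ((continuous_sampleMean D.continuous_lossCAL).add (D.continuous_penalty.const_mul l))
    ((convexOn_sampleMean D.convexOn_lossCAL).add (D.convexOn_penalty.smul hl)) γ hρ h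

theorem exists_isRWL {l : ℝ} (hl : 0 ≤ l) (γ α : D.Coef) {ρ : ℝ} (hρ : 0 < ρ)
    (h : ∀ x, D.SegmentMin (D.objWL l ω γ) α x → D.totalNorm (x - α) < ρ) :
    ∃ x, D.IsRWL l ω γ x :=
  D.exists_minimizer
    ((continuous_sampleMean (D.continuous_lossWL γ)).add (D.continuous_penalty.const_mul l))
    ((convexOn_sampleMean (D.convexOn_lossWL γ)).add (D.convexOn_penalty.smul hl)) α hρ h

/-- First-order condition for the calibration objective along the segment to `γ`. -/
theorem SegmentMin.objCAL_le {l : ℝ} (hl : 0 ≤ l) {γ x : D.Coef}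
    (h : D.SegmentMin (D.objCAL l ω) γ x) :
    D.sampleMean (fun o => ∑ k : D.Other, (D.wt x k o - D.R k o) * D.lin (x - γ) k o.2.2) ω ≤
      l * (D.penalty γ - D.penalty x) := by
  refine le_of_forall_mul_sub_sq_le (c := D.sampleMean (fun o => ∑ k : D.Other, D.wt x k o *
    (D.lin (x - γ) k o.2.2 ^ 2 * Real.exp |D.lin (x - γ) k o.2.2|)) ω) fun s h0 h1 => ?_
  have h2 := h s h0.le h1
  have h3 := mul_le_mul_of_nonneg_left (D.penalty_segment_le x γ h0.le h1) hl
  unfold objCAL at h2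
  have h4 : s * D.sampleMean (fun o => ∑ k : D.Other, (D.wt x k o - D.R k o) *
      D.lin (x - γ) k o.2.2) ω - s ^ 2 * D.sampleMean (fun o => ∑ k : D.Other, D.wt x k o *
      (D.lin (x - γ) k o.2.2 ^ 2 * Real.exp |D.lin (x - γ) k o.2.2|)) ω ≤
      D.sampleMean (D.lossCAL x) ω - D.sampleMean (D.lossCAL (x + s • (γ - x))) ω := by
    rw [← sampleMean_const_mul, ← sampleMean_const_mul, ← sampleMean_sub, ← sampleMean_sub]
    refine sampleMean_mono fun i => ?_
    set o := D.sample i ω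
    simp only [lossCAL]
    rw [Finset.mul_sum, Finset.mul_sum, ← Finset.sum_sub_distrib, ← Finset.sum_sub_distrib]
    refine Finset.sum_le_sum fun k _ => ?_
    have e1 : D.lin (x + s • (γ - x)) k o.2.2 = D.lin x k o.2.2 - s * D.lin (x - γ) k o.2.2 := by
      simp only [lin_add, lin_smul, lin_sub]; ring
    set g := D.lin (x - γ) k o.2.2
    rw [e1, sub_eq_add_neg (D.lin x k o.2.2), Real.exp_add]
    have ew : D.wt x k o = D.R D.t o * Real.exp (D.lin x k o.2.2) := rfl
    have e2 := exp_le_one_add_add_sq_mul_exp_abs (-(s * g))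
    -- The restriction `s ≤ 1` makes the exponential factor of the remainder independent of `s`.
    have e3 : |-(s * g)| ≤ |g| := by
      rw [abs_neg, abs_mul, abs_of_pos h0]
      exact mul_le_of_le_one_left (abs_nonneg _) h1
    have e4 : (-(s * g)) ^ 2 * Real.exp |-(s * g)| ≤ s ^ 2 * (g ^ 2 * Real.exp |g|) := by
      rw [neg_sq, mul_pow, mul_assoc]
      gcongr
    have e5 := mul_le_mul_of_nonneg_left (e2.trans (add_le_add_right e4 _)) (D.wt_nonneg x k o)
    rw [ew] at e5 ⊢
    linarith
  linarith

/-- First-order condition for the weighted least squares objective along the segment to `α`. -/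
theorem SegmentMin.objWL_le {l : ℝ} (hl : 0 ≤ l) {γ α x : D.Coef}
    (h : D.SegmentMin (D.objWL l ω γ) α x) :
    D.sampleMean (fun o => ∑ k : D.Other, -(D.wt γ k o * D.res x k o * D.lin (x - α) k o.2.2)) ω ≤
      l * (D.penalty α - D.penalty x) := by
  refine le_of_forall_mul_sub_sq_le (c := D.sampleMean (fun o => ∑ k : D.Other, D.wt γ k o *
    D.lin (x - α) k o.2.2 ^ 2 / 2) ω) fun s h0 h1 => ?_
  have h2 := h s h0.le h1
  have h3 := mul_le_mul_of_nonneg_left (D.penalty_segment_le x α h0.le h1) hl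
  unfold objWL at h2
  -- The loss is quadratic along the segment, so the expansion is an identity.
  have h4 : s * D.sampleMean (fun o => ∑ k : D.Other,
      -(D.wt γ k o * D.res x k o * D.lin (x - α) k o.2.2)) ω -
      s ^ 2 * D.sampleMean (fun o => ∑ k : D.Other, D.wt γ k o *
        D.lin (x - α) k o.2.2 ^ 2 / 2) ω =
      D.sampleMean (D.lossWL γ x) ω - D.sampleMean (D.lossWL γ (x + s • (α - x))) ω := by
    rw [← sampleMean_const_mul, ← sampleMean_const_mul, ← sampleMean_sub, ← sampleMean_sub]
    refine sampleMean_congr fun i => ?_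
    simp only [lossWL_eq]
    rw [Finset.mul_sum, Finset.mul_sum, ← Finset.sum_sub_distrib, ← Finset.sum_sub_distrib]
    refine Finset.sum_congr rfl fun k _ => ?_
    simp only [res, lin_add, lin_smul, lin_sub]
    ring
  linarith

end Study

end

/-! ### Constants, and the deterministic analysis on a typical sample. -/

noncomputable section

namespace Constants

variable (c : Constants)

/-- Bound for the ratio of fitted to limiting weights. -/
def expBound : ℝ := (1 - 4 * c.A1 ^ 2 / ((c.A1 - 1) ^ 2 * (c.ξ1 + 1) ^ 2))⁻¹

/-- Constant in the `L_1` bound for the propensity score coefficients. -/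
def normCAL : ℝ := 8 * c.A1 ^ 2 * c.expBound / (c.ν1 ^ 2 * (c.A1 - 1))

/-- Constant in the prediction bound for the propensity score coefficients. -/
def predCAL : ℝ := 16 * c.A1 ^ 2 * c.expBound ^ 2 / c.ν1 ^ 2

/-- Bound for the products `ω_k W_k² f_j f_l` in units of `W_k² / σ0²`. -/
def residScale : ℝ := c.B0 ^ 2 * (c.B1 - 1) * c.σ0 ^ 2

/-- Constant in the bound for the residual-weighted prediction error. -/
def residCAL : ℝ := c.σ0 ^ 2 * c.predCAL + 16 * c.residScale * c.normCAL ^ 2 * c.ν1 ^ 2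

/-- Constant in the `L_1` bound for the outcome coefficients. -/
def normWL : ℝ :=
  (c.A2 - 1) * (1 + c.ξ2) ^ 2 * c.expBound / (c.ν2 ^ 2 * (1 - c.η2)) +
    (2 * c.A2 / ((c.A2 - 1) * (c.ξ2 + 1) - 2 * c.A2) + 1) ^ 2 * c.expBound *
      (c.expBound ^ 2 * c.residCAL) / (c.A2 - 1)

/-- The constant of the main bound. -/
def mainConst : ℝ :=
  2 * c.expBound ^ 2 * (c.B1 - 1) * c.residCAL +
    2 * (c.expBound * (c.B1 - 1) + 1) ^ 2 * (c.B0 * c.normWL) ^ 2 + 1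

variable {c}

theorem Admissible.one_le_expBound (hc : c.Admissible) : 1 ≤ c.expBound := by
  have h := coneRatio_lt_one hc.one_lt_ξ1 hc.A1_gt
  have h0 : 0 ≤ 4 * c.A1 ^ 2 / ((c.A1 - 1) ^ 2 * (c.ξ1 + 1) ^ 2) := by positivity
  exact (one_le_inv₀ (by linarith)).2 (by linarith)

theorem Admissible.normCAL_nonneg (hc : c.Admissible) : 0 ≤ c.normCAL := by
  have h1 := hc.one_le_expBound
  have h2 := (two_mul_lt_of_div_lt hc.one_lt_ξ1 hc.A1_gt).1
  have h3 : 0 ≤ c.A1 - 1 := by linarith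
  unfold normCAL; positivity

theorem Admissible.predCAL_nonneg (hc : c.Admissible) : 0 ≤ c.predCAL := by
  have h1 := hc.one_le_expBound
  unfold predCAL; positivity

theorem Admissible.residScale_pos (hc : c.Admissible) : 0 < c.residScale := by
  have h1 := hc.one_le_B0
  have h2 : 0 < c.B1 - 1 := sub_pos.2 hc.one_lt_B1
  have h3 := hc.σ0_pos
  unfold residScale; positivity

theorem Admissible.residCAL_nonneg (hc : c.Admissible) : 0 ≤ c.residCAL := by
  have h1 := hc.predCAL_nonneg
  have h2 := hc.residScale_pos
  unfold residCAL; positivity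

theorem Admissible.mainConst_pos (hc : c.Admissible) : 0 < c.mainConst := by
  have h1 := hc.residCAL_nonneg
  have h2 : 0 ≤ c.B1 - 1 := by linarith [hc.one_lt_B1]
  unfold mainConst; positivity

end Constants

namespace Study

variable (D : Study.{u}) (c : Constants) {ε : ℝ}

theorem rate_nonneg : 0 ≤ D.rate ε := Real.sqrt_nonneg _

theorem lam1_le_lam2 : D.lam1 c ε ≤ D.lam2 c ε := le_max_left _ _

variable {c}

theorem rate_le_lam1 (hc : c.Admissible) : D.rate ε ≤ D.lam1 c ε := by
  have h1 : 1 ≤ 4 * Real.sqrt 2 * c.B0 ^ 2 * c.B1 := by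
    have e1 : 1 ≤ Real.sqrt 2 := Real.one_le_sqrt.2 (by norm_num)
    have e2 : 1 ≤ c.B0 ^ 2 := one_le_pow₀ hc.one_le_B0
    have e3 := hc.one_lt_B1.le
    have e4 : 1 ≤ 4 * Real.sqrt 2 := by linarith
    exact one_le_mul_of_one_le_of_one_le (one_le_mul_of_one_le_of_one_le e4 e2) e3
  exact le_mul_of_one_le_left D.rate_nonneg h1

theorem lam1_nonneg (hc : c.Admissible) : 0 ≤ D.lam1 c ε := D.rate_nonneg.trans (D.rate_le_lam1 hc)

variable (c)

/-- `E{R^(t) ω(k, X; γ) (Y - α_kᵀ f)² f fᵀ}`, entrywise. -/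
def residGram (γ α : D.Coef) (k : D.Other) (j1 j2 : Fin (D.p + 1)) : ℝ :=
  ∫ ω, D.wt γ k (D.obs ω) * D.res α k (D.obs ω) ^ 2 *
    (D.f (D.obs ω).2.2 j1 * D.f (D.obs ω).2.2 j2) ∂D.P

/-- The regressors are bounded and the limiting propensity score is bounded below. -/
def Regular (γ : D.Coef) (o : Obs D.K D.d) : Prop :=
  (∀ j, |D.f o.2.2 j| ≤ c.B0) ∧ ∑ k : D.Other, Real.exp (D.lin γ k o.2.2) ≤ c.B1 - 1

/-- The sample behaves typically: scores and Gram matrices are close to their expectations. -/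
structure GoodSample (ε : ℝ) (γ α : D.Coef) (ω : D.Ω) : Prop where
  regular : ∀ i, D.Regular c γ (D.sample i ω)
  scoreCAL : ∀ j, ∑ k : D.Other,
    D.sampleMean (fun o => (D.wt γ k o - D.R k o) * D.f o.2.2 j) ω ^ 2 ≤ D.lam1 c ε ^ 2
  scoreWL : ∀ j, ∑ k : D.Other,
    D.sampleMean (fun o => D.wt γ k o * D.res α k o * D.f o.2.2 j) ω ^ 2 ≤ D.lam2 c ε ^ 2
  gram : ∀ (k : D.Other) j1 j2,
    |D.sampleMean (fun o => D.wt γ k o * (D.f o.2.2 j1 * D.f o.2.2 j2)) ω - D.gram γ k j1 j2| ≤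
      D.lam1 c ε / 2
  resid : ∀ (k : D.Other) j1 j2,
    |D.sampleMean (fun o => D.wt γ k o * D.res α k o ^ 2 * (D.f o.2.2 j1 * D.f o.2.2 j2)) ω -
      D.residGram γ α k j1 j2| ≤ 16 * c.residScale * D.rate ε

variable {D c} {ω : D.Ω} {γ α : D.Coef}

theorem Regular.wt_sum_le {o : Obs D.K D.d} (h : D.Regular c γ o) :
    ∑ k, D.wt γ k o ≤ c.B1 - 1 := by
  unfold wt
  rw [← Finset.mul_sum]
  have h0 : 0 ≤ ∑ k : D.Other, Real.exp (D.lin γ k o.2.2) :=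
    Finset.sum_nonneg fun _ _ => (Real.exp_pos _).le
  exact (mul_le_of_le_one_left h0 (D.R_le_one _ _)).trans h.2

/-- A score bound controls a sample average that is linear in the coefficients. -/
theorem sampleMean_sum_mul_lin_le {g : D.Other → Obs D.K D.d → ℝ} {τ : ℝ} (hτ : 0 ≤ τ)
    (h : ∀ j, ∑ k, D.sampleMean (fun o => g k o * D.f o.2.2 j) ω ^ 2 ≤ τ ^ 2) (b : D.Coef) :
    |D.sampleMean (fun o => ∑ k, g k o * D.lin b k o.2.2) ω| ≤ τ * D.totalNorm b := by
  have e : D.sampleMean (fun o => ∑ k, g k o * D.lin b k o.2.2) ω =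
      ∑ j, ∑ k, D.sampleMean (fun o => g k o * D.f o.2.2 j) ω * b j k := by
    rw [Finset.sum_comm, sampleMean_sum]
    refine Finset.sum_congr rfl fun k _ => ?_
    simp_rw [lin_other, Finset.mul_sum]
    rw [sampleMean_sum]
    refine Finset.sum_congr rfl fun j _ => ?_
    rw [← sampleMean_mul_const]
    exact sampleMean_congr fun i => by ring
  rw [e, abs_le, totalNorm, Finset.mul_sum, ← Finset.sum_neg_distrib]
  constructor
  · refine Finset.sum_le_sum fun j _ => ?_
    have := D.sum_mul_row_le (fun k => -D.sampleMean (fun o => g k o * D.f o.2.2 j) ω) hτ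
      (by simpa using h j) b j
    simp only [neg_mul, Finset.sum_neg_distrib] at this
    linarith
  · exact Finset.sum_le_sum fun j _ => D.sum_mul_row_le _ hτ (h j) b j

variable {γ' : D.Coef}

/-- Bounds for the regularized calibrated estimate. -/
theorem GoodSample.calibration (hc : c.Admissible) (hC : D.Conditions c ε γ α)
    (hlam : 0 < D.lam1 c ε) (hG : D.GoodSample c ε γ α ω)
    (h : D.SegmentMin (D.objCAL (c.A1 * D.lam1 c ε) ω) γ γ') :
    Real.exp (c.B0 * D.totalNorm (γ' - γ)) ≤ c.expBound ∧
      D.totalNorm (γ' - γ) ≤ c.normCAL * ((D.support γ).card * D.lam1 c ε) ∧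
      D.quad (fun k => D.gram γ k) (γ' - γ) ≤
        c.predCAL * ((D.support γ).card * D.lam1 c ε ^ 2) ∧
      (D.support γ).card * D.lam1 c ε ≤ c.ν1 ^ 2 := by
  obtain ⟨η11, η12, -, h11, -, h12, h6, h7⟩ := hC.sparse_γ
  have hA1 := (two_mul_lt_of_div_lt hc.one_lt_ξ1 hc.A1_gt).1
  have hfo := h.objCAL_le D (by have := hlam.le; positivity)
  set b := γ' - γ with hb
  set l := D.lam1 c ε
  set g : D.Other → Obs D.K D.d → ℝ := fun k o => D.lin b k o.2.2 with hg
  have hgb : ∀ i k, |g k (D.sample i ω)| ≤ c.B0 * D.totalNorm b := fun i k =>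
    D.abs_lin_le (hG.regular i).1 b k
  set Dg := D.sampleMean (fun o => ∑ k, D.wt γ k o * (g k o * (Real.exp (g k o) - 1))) ω with hDg
  set Q := D.sampleMean (fun o => ∑ k, D.wt γ k o * g k o ^ 2) ω with hQ
  have hpos : ∀ x : ℝ, 0 ≤ x * (Real.exp x - 1) := fun x => by
    rw [mul_exp_sub_one_eq_abs]; positivity
  -- The weights at `γ'` are `e^g` times those at `γ`, so the score at `γ'` is the divergence plus
  -- the score at `γ`. The latter is pure noise and is absorbed by one unit of the penalty level,
  -- which turns `A1` into `A1 - 1`.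
  have hsplit : D.sampleMean (fun o => ∑ k : D.Other, (D.wt γ' k o - D.R k o) * g k o) ω =
      Dg + D.sampleMean (fun o => ∑ k : D.Other, (D.wt γ k o - D.R k o) * g k o) ω := by
    rw [hDg, ← sampleMean_add]
    refine sampleMean_congr fun i => ?_
    rw [← Finset.sum_add_distrib]
    refine Finset.sum_congr rfl fun k _ => ?_
    rw [D.wt_eq γ γ']
    simp only [hg, ← hb]; ring
  have hscore := sampleMean_sum_mul_lin_le (g := fun k o => D.wt γ k o - D.R k o) hlam.le
    hG.scoreCAL b
  have hcone := D.totalNorm_add_penalty_sub_le γ' γ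
  rw [← hb] at hcone
  have hsum := D.sum_support_add_sum_compl b γ
  refine calibration_rate (Dg := Dg) (SS := ∑ j ∈ D.support γ, D.rowNorm b j) (Q := Q)
    hc.one_lt_ξ1 hc.A1_gt hlam hc.ν1_pos (D.one_le_card_support γ) hc.one_le_B0 ?_
    (Finset.sum_nonneg fun _ _ => D.rowNorm_nonneg _ _) ?_ ?_ ?_ ?_ ?_ ?_ h11 h12 h6 h7 rfl
  · exact sampleMean_nonneg fun i => Finset.sum_nonneg fun k _ =>
      mul_nonneg (D.wt_nonneg _ _ _) (hpos _)
  · rw [← hsum]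
    exact le_add_of_nonneg_right (Finset.sum_nonneg fun _ _ => D.rowNorm_nonneg _ _)
  · rw [hsplit] at hfo
    have h1 := (abs_le.1 hscore).1
    have h2 := mul_le_mul_of_nonneg_left hcone (show 0 ≤ c.A1 * l by positivity)
    linarith
  · intro hcn
    refine hC.compat_γ b ?_
    linarith
  · rw [hQ, sampleMean_sum_mul_lin_sq (D.wt γ) b]
    exact abs_quad_sub_le (fun k j1 j2 => hG.gram k j1 j2) b
  · rw [hQ, hDg, ← sampleMean_const_mul, ← sampleMean_const_mul]
    refine sampleMean_mono fun i => ?_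
    rw [Finset.mul_sum, Finset.mul_sum]
    refine Finset.sum_le_sum fun k _ => ?_
    have := mul_le_mul_of_nonneg_left (sq_mul_one_sub_exp_neg_le (hgb i k))
      (D.wt_nonneg γ k (D.sample i ω))
    linarith
  · rw [hQ, hDg, ← sampleMean_const_mul]
    refine sampleMean_mono fun i => ?_
    rw [Finset.mul_sum]
    refine Finset.sum_le_sum fun k _ => ?_
    have := mul_le_mul_of_nonneg_left (sq_le_exp_mul (hgb i k))
      (D.wt_nonneg γ k (D.sample i ω))
    linarith

/-- Bound for the residual-weighted prediction error of the calibrated estimate. -/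
theorem GoodSample.residual (hc : c.Admissible) (hC : D.Conditions c ε γ α)
    (hlam : 0 < D.lam1 c ε) (hG : D.GoodSample c ε γ α ω)
    (hres : ∀ b, D.quad (D.residGram γ α) b ≤ c.σ0 ^ 2 * D.quad (fun k => D.gram γ k) b)
    (h : D.SegmentMin (D.objCAL (c.A1 * D.lam1 c ε) ω) γ γ') :
    D.sampleMean (fun o => ∑ k, D.wt γ k o * D.res α k o ^ 2 * D.lin (γ' - γ) k o.2.2 ^ 2) ω ≤
      c.residCAL * ((D.support γ).card * D.lam1 c ε ^ 2) := by
  obtain ⟨-, h1, h2, h3⟩ := hG.calibration hc hC hlam h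
  rw [sampleMean_sum_mul_lin_sq]
  have h4 := (abs_le.1 (abs_quad_sub_le (fun k j1 j2 => hG.resid k j1 j2) (γ' - γ))).2
  have h5 := hres (γ' - γ)
  have h6 := mul_le_mul_of_nonneg_left h2 (sq_nonneg c.σ0)
  have hS := hc.residScale_pos
  -- The rate is at most `λ̃_1`; in `λ̃_1 (|S| λ̃_1)²` one factor `|S| λ̃_1` is at most `ν1²`,
  -- leaving the prediction rate `|S| λ̃_1²`.
  have h7 : 16 * c.residScale * D.rate ε * D.totalNorm (γ' - γ) ^ 2 ≤
      16 * c.residScale * c.normCAL ^ 2 * c.ν1 ^ 2 * ((D.support γ).card * D.lam1 c ε ^ 2) := by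
    calc _ ≤ 16 * c.residScale * D.lam1 c ε *
          (c.normCAL * ((D.support γ).card * D.lam1 c ε)) ^ 2 := by
          have e1 := D.rate_le_lam1 (ε := ε) hc
          have e2 := pow_le_pow_left₀ (D.totalNorm_nonneg (γ' - γ)) h1 2
          gcongr
      _ = 16 * c.residScale * c.normCAL ^ 2 * ((D.support γ).card * D.lam1 c ε) *
          ((D.support γ).card * D.lam1 c ε ^ 2) := by ring
      _ ≤ _ := by gcongr
  unfold Constants.residCAL
  linarith

/-- Bound for the regularized weighted least squares estimate. -/
theorem GoodSample.weightedLS (hc : c.Admissible) (hC : D.Conditions c ε γ α)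
    (hlam : 0 < D.lam1 c ε) (hG : D.GoodSample c ε γ α ω)
    (hres : ∀ b, D.quad (D.residGram γ α) b ≤ c.σ0 ^ 2 * D.quad (fun k => D.gram γ k) b)
    (h : D.SegmentMin (D.objCAL (c.A1 * D.lam1 c ε) ω) γ γ') {α' : D.Coef}
    (hα : D.SegmentMin (D.objWL (c.A2 * D.lam2 c ε) ω γ') α α') :
    D.totalNorm (α' - α) ≤ c.normWL *
      ((D.support γ).card * D.lam1 c ε + (D.support α).card * D.lam2 c ε) := by
  have hA2 := (two_mul_lt_of_div_lt hc.one_lt_ξ2 hc.A2_gt).1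
  have hl12 := D.lam1_le_lam2 c (ε := ε)
  have hl2 : 0 < D.lam2 c ε := hlam.trans_le hl12
  have hfo := hα.objWL_le D (by have := hl2.le; positivity)
  obtain ⟨hexp, -, -, -⟩ := hG.calibration hc hC hlam h
  have hV := hG.residual hc hC hlam hres h
  have hK := hc.one_le_expBound
  set K := c.expBound with hKd
  set b := γ' - γ with hb
  set a := α' - α with ha
  set g : D.Other → Obs D.K D.d → ℝ := fun k o => D.lin b k o.2.2 with hg
  set e : D.Other → Obs D.K D.d → ℝ := fun k o => D.lin a k o.2.2 with he
  have hgb : ∀ i k, |g k (D.sample i ω)| ≤ c.B0 * D.totalNorm b := fun i k =>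
    D.abs_lin_le (hG.regular i).1 b k
  have hexpg : ∀ i k, Real.exp |g k (D.sample i ω)| ≤ K := fun i k =>
    (Real.exp_le_exp.2 (hgb i k)).trans hexp
  set Q := D.sampleMean (fun o => ∑ k, D.wt γ k o * e k o ^ 2) ω with hQ
  set V := D.sampleMean (fun o => ∑ k, D.wt γ k o * D.res α k o ^ 2 * g k o ^ 2) ω with hVd
  have hwt : ∀ k o, 0 ≤ D.wt γ k o := D.wt_nonneg γ
  -- This term is the price of estimated weights. With `|e^g - 1| ≤ K |g|`, Cauchy–Schwarz over the
  -- treatments and then over the sample separates the residual-weighted error of the propensity fit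
  -- from the quadratic form of the outcome error.
  have hcross : D.sampleMean (fun o => ∑ k, D.wt γ k o * (Real.exp (g k o) - 1) *
      D.res α k o * e k o) ω ≤ K * Real.sqrt V * Real.sqrt Q := by
    have h1 : D.sampleMean (fun o => ∑ k, D.wt γ k o * (Real.exp (g k o) - 1) *
        D.res α k o * e k o) ω ≤ D.sampleMean (fun o => K *
          (Real.sqrt (∑ k, D.wt γ k o * D.res α k o ^ 2 * g k o ^ 2) *
            Real.sqrt (∑ k, D.wt γ k o * e k o ^ 2))) ω := by
      refine sampleMean_mono fun i => ?_
      set o := D.sample i ω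
      have hcs : ∑ k, Real.sqrt (D.wt γ k o * D.res α k o ^ 2 * g k o ^ 2) *
          Real.sqrt (D.wt γ k o * e k o ^ 2) ≤
          Real.sqrt (∑ k, D.wt γ k o * D.res α k o ^ 2 * g k o ^ 2) *
            Real.sqrt (∑ k, D.wt γ k o * e k o ^ 2) := by
        refine (Real.sum_mul_le_sqrt_mul_sqrt _ _ _).trans (le_of_eq ?_)
        congr 2 <;> refine Finset.sum_congr rfl fun k _ => Real.sq_sqrt ?_
        · exact mul_nonneg (mul_nonneg (hwt k o) (sq_nonneg _)) (sq_nonneg _)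
        · exact mul_nonneg (hwt k o) (sq_nonneg _)
      refine le_trans ?_ (mul_le_mul_of_nonneg_left hcs (by linarith))
      rw [Finset.mul_sum]
      refine Finset.sum_le_sum fun k _ => ?_
      have e1 : Real.sqrt (D.wt γ k o * D.res α k o ^ 2 * g k o ^ 2) *
          Real.sqrt (D.wt γ k o * e k o ^ 2) =
          D.wt γ k o * |D.res α k o| * |g k o| * |e k o| := by
        rw [← Real.sqrt_mul (mul_nonneg (mul_nonneg (hwt k o) (sq_nonneg _)) (sq_nonneg _))]
        rw [show D.wt γ k o * D.res α k o ^ 2 * g k o ^ 2 * (D.wt γ k o * e k o ^ 2) =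
          (D.wt γ k o * D.res α k o * g k o * e k o) ^ 2 by ring, Real.sqrt_sq_eq_abs]
        simp only [abs_mul, abs_of_nonneg (hwt k o)]
      rw [e1]
      have e2 : |Real.exp (g k o) - 1| ≤ |g k o| * K :=
        (abs_exp_sub_one_le _).trans (mul_le_mul_of_nonneg_left (hexpg i k) (abs_nonneg _))
      calc _ ≤ |D.wt γ k o * (Real.exp (g k o) - 1) * D.res α k o * e k o| := le_abs_self _
        _ = D.wt γ k o * |Real.exp (g k o) - 1| * |D.res α k o| * |e k o| := by
          simp only [abs_mul, abs_of_nonneg (hwt k o)]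
        _ ≤ D.wt γ k o * (|g k o| * K) * |D.res α k o| * |e k o| := by
          have := hwt k o
          gcongr
        _ = _ := by ring
    refine h1.trans ?_
    rw [sampleMean_const_mul, mul_assoc]
    refine mul_le_mul_of_nonneg_left ?_ (by linarith)
    refine (sampleMean_mul_le _ _).trans (le_of_eq ?_)
    congr 2 <;> refine sampleMean_congr fun i => Real.sq_sqrt (Finset.sum_nonneg fun k _ => ?_)
    · exact mul_nonneg (mul_nonneg (hwt _ _) (sq_nonneg _)) (sq_nonneg _)
    · exact mul_nonneg (hwt _ _) (sq_nonneg _)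
  have hscore := sampleMean_sum_mul_lin_le (g := fun k o => D.wt γ k o * D.res α k o) hl2.le
    hG.scoreWL a
  have hsplit : D.sampleMean (fun o => ∑ k : D.Other,
      -(D.wt γ' k o * D.res α' k o * e k o)) ω =
      D.sampleMean (fun o => ∑ k, D.wt γ' k o * e k o ^ 2) ω -
      (D.sampleMean (fun o => ∑ k, D.wt γ k o * D.res α k o * e k o) ω +
      D.sampleMean (fun o => ∑ k, D.wt γ k o * (Real.exp (g k o) - 1) *
        D.res α k o * e k o) ω) := by
    rw [← sampleMean_add, ← sampleMean_sub]
    refine sampleMean_congr fun i => ?_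
    rw [← Finset.sum_add_distrib, ← Finset.sum_sub_distrib]
    refine Finset.sum_congr rfl fun k _ => ?_
    rw [D.wt_eq γ γ', D.res_eq α α']
    simp only [hg, he, ← hb, ← ha]; ring
  -- The bound on `e^{|g|}` also keeps the fitted weights above `1/K` times the limiting ones.
  have hQle : Q / K ≤ D.sampleMean (fun o => ∑ k, D.wt γ' k o * e k o ^ 2) ω := by
    rw [div_eq_mul_inv, hQ, ← sampleMean_mul_const]
    refine sampleMean_mono fun i => ?_
    rw [Finset.sum_mul]
    refine Finset.sum_le_sum fun k _ => ?_
    set o := D.sample i ω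
    rw [D.wt_eq γ γ']
    have e1 : K⁻¹ ≤ Real.exp (g k o) := by
      rw [inv_le_comm₀ (by linarith) (Real.exp_pos _), ← Real.exp_neg]
      exact (Real.exp_le_exp.2 (neg_le_abs _)).trans (hexpg i k)
    have := mul_le_mul_of_nonneg_left e1 (mul_nonneg (hwt k o) (sq_nonneg (e k o)))
    simp only [hg, ← hb] at this ⊢
    linarith
  have hcone := D.totalNorm_add_penalty_sub_le α' α
  rw [← ha] at hcone
  have hsum := D.sum_support_add_sum_compl a α
  have hV0 : 0 ≤ V := sampleMean_nonneg fun i => Finset.sum_nonneg fun k _ =>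
    mul_nonneg (mul_nonneg (hwt _ _) (sq_nonneg _)) (sq_nonneg _)
  refine weightedLS_rate (SS := ∑ j ∈ D.support α, D.rowNorm a j) (Q := Q)
    (U := K * Real.sqrt V) (G := D.quad (fun k => D.gram γ k) a)
    hc.one_lt_ξ2 hc.A2_gt hlam hl12 hc.ν2_pos (Nat.cast_nonneg _) (D.one_le_card_support α)
    (by linarith) (Finset.sum_nonneg fun _ _ => D.rowNorm_nonneg _ _) ?_ ?_ ?_ ?_ ?_ ?_ ?_
    hc.η2_lt hC.sparse_α
  · rw [← hsum]
    exact le_add_of_nonneg_right (Finset.sum_nonneg fun _ _ => D.rowNorm_nonneg _ _)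
  · exact sampleMean_nonneg fun i => Finset.sum_nonneg fun k _ =>
      mul_nonneg (hwt _ _) (sq_nonneg _)
  · have := hc.residCAL_nonneg; positivity
  · rw [mul_pow, Real.sq_sqrt hV0, mul_assoc]
    exact mul_le_mul_of_nonneg_left hV (by positivity)
  · rw [hsplit] at hfo
    have h1 := (abs_le.1 hscore).2
    have h2 := mul_le_mul_of_nonneg_left hcone (show 0 ≤ c.A2 * D.lam2 c ε by positivity)
    linarith
  · intro hcn
    refine hC.compat_α a ?_
    linarith
  · rw [hQ, sampleMean_sum_mul_lin_sq (D.wt γ) a]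
    exact abs_quad_sub_le (fun k j1 j2 => hG.gram k j1 j2) a

/-- As the probability ratio is `exp(γ_kᵀ f)`, the augmentation collapses to weight times residual,
the quantity that the least squares analysis controls. -/
theorem phi_eq (γ α : D.Coef) (o : Obs D.K D.d) :
    D.phi α γ o = D.R D.t o * o.1 +
      ∑ k : D.Other, (D.wt γ k o * D.res α k o + D.R k o * D.lin α k o.2.2) := by
  unfold phi
  congr 1
  refine Finset.sum_congr rfl fun k _ => ?_
  rw [ratio_eq, wt, res]; ring

theorem sum_R_le_one (o : Obs D.K D.d) : ∑ k : D.Other, D.R k o ≤ 1 := by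
  unfold R
  rw [Finset.sum_ite, Finset.sum_const_zero, add_zero, Finset.sum_const, nsmul_eq_mul, mul_one]
  have : (Finset.univ.filter fun k : D.Other => o.2.1 = k).card ≤ 1 :=
    Finset.card_le_one.2 fun a ha b hb => by
      simp only [Finset.mem_filter, Finset.mem_univ, true_and] at ha hb
      exact Subtype.ext (ha.symm.trans hb)
  exact_mod_cast this

/-- The difference is `I - J`. In `I` the propensity error multiplies the limiting residuals, and
Cauchy–Schwarz with weights of total mass at most `B1 - 1` produces the residual-weighted squares.
In `J` the calibration residuals at `γ'` multiply the outcome error, which is bounded uniformly in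
`k`; their absolute sum is at most `K (B1 - 1) + 1` because at most one `R^(k)` is nonzero. Then `(I
- J)² ≤ 2I² + 2J²`. -/
theorem phi_sub_sq_le {o : Obs D.K D.d} (hreg : D.Regular c γ o) {K : ℝ}
    (hK : Real.exp (c.B0 * D.totalNorm (γ' - γ)) ≤ K) (α' : D.Coef) :
    (D.phi α' γ' o - D.phi α γ o) ^ 2 ≤
      2 * K ^ 2 * (c.B1 - 1) *
        ∑ k, D.wt γ k o * D.res α k o ^ 2 * D.lin (γ' - γ) k o.2.2 ^ 2 +
      2 * (K * (c.B1 - 1) + 1) ^ 2 * (c.B0 * D.totalNorm (α' - α)) ^ 2 := by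
  set b := γ' - γ with hb
  set a := α' - α with ha
  have hgb : ∀ k : D.Other, |D.lin b k o.2.2| ≤ c.B0 * D.totalNorm b := D.abs_lin_le hreg.1 b
  have hab : ∀ k : D.Other, |D.lin a k o.2.2| ≤ c.B0 * D.totalNorm a := D.abs_lin_le hreg.1 a
  have hexpg : ∀ k : D.Other, Real.exp |D.lin b k o.2.2| ≤ K := fun k =>
    (Real.exp_le_exp.2 (hgb k)).trans hK
  have hK0 : 0 < K := (Real.exp_pos _).trans_le hK
  have hwt : ∀ k, 0 ≤ D.wt γ k o := fun k => D.wt_nonneg γ k o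
  have hB1 := hreg.wt_sum_le
  have hB10 : 0 ≤ c.B1 - 1 := (Finset.sum_nonneg fun k _ => hwt k).trans hB1
  set I := ∑ k, D.wt γ k o * (Real.exp (D.lin b k o.2.2) - 1) * D.res α k o with hI
  set J := ∑ k, (D.wt γ' k o - D.R k o) * D.lin a k o.2.2 with hJ
  have hsplit : D.phi α' γ' o - D.phi α γ o = I - J := by
    rw [phi_eq, phi_eq, add_sub_add_left_eq_sub, ← Finset.sum_sub_distrib, hI, hJ,
      ← Finset.sum_sub_distrib]
    refine Finset.sum_congr rfl fun k _ => ?_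
    have e : D.lin α' k o.2.2 = D.lin α k o.2.2 + D.lin a k o.2.2 := by
      rw [ha, lin_sub]; ring
    rw [D.res_eq α α', e, ← ha, D.wt_eq γ γ', ← hb]
    ring
  have h1 : I ^ 2 ≤ K ^ 2 * (c.B1 - 1) *
      ∑ k, D.wt γ k o * D.res α k o ^ 2 * D.lin b k o.2.2 ^ 2 := by
    have hle : |I| ≤ K * ∑ k, D.wt γ k o * |D.res α k o| * |D.lin b k o.2.2| := by
      rw [Finset.mul_sum]
      refine (Finset.abs_sum_le_sum_abs _ _).trans (Finset.sum_le_sum fun k _ => ?_)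
      have e2 : |Real.exp (D.lin b k o.2.2) - 1| ≤ |D.lin b k o.2.2| * K :=
        (abs_exp_sub_one_le _).trans (mul_le_mul_of_nonneg_left (hexpg k) (abs_nonneg _))
      rw [abs_mul, abs_mul, abs_of_nonneg (hwt k)]
      calc _ ≤ D.wt γ k o * (|D.lin b k o.2.2| * K) * |D.res α k o| := by
            have := hwt k
            gcongr
        _ = _ := by ring
    have hcs : (∑ k, D.wt γ k o * |D.res α k o| * |D.lin b k o.2.2|) ^ 2 ≤
        (∑ k, D.wt γ k o) * ∑ k, D.wt γ k o * D.res α k o ^ 2 * D.lin b k o.2.2 ^ 2 := by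
      refine Finset.sum_sq_le_sum_mul_sum_of_sq_le_mul _ (fun k _ => hwt k)
        (fun k _ => mul_nonneg (mul_nonneg (hwt k) (sq_nonneg _)) (sq_nonneg _)) fun k _ => ?_
      rw [mul_pow, mul_pow, sq_abs, sq_abs]
      exact le_of_eq (by ring)
    have h0 : 0 ≤ ∑ k, D.wt γ k o * D.res α k o ^ 2 * D.lin b k o.2.2 ^ 2 :=
      Finset.sum_nonneg fun k _ => mul_nonneg (mul_nonneg (hwt k) (sq_nonneg _)) (sq_nonneg _)
    calc I ^ 2 = |I| ^ 2 := (sq_abs _).symm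
      _ ≤ (K * ∑ k, D.wt γ k o * |D.res α k o| * |D.lin b k o.2.2|) ^ 2 :=
        pow_le_pow_left₀ (abs_nonneg _) hle 2
      _ = K ^ 2 * (∑ k, D.wt γ k o * |D.res α k o| * |D.lin b k o.2.2|) ^ 2 := by ring
      _ ≤ K ^ 2 * ((c.B1 - 1) *
          ∑ k, D.wt γ k o * D.res α k o ^ 2 * D.lin b k o.2.2 ^ 2) := by
        refine mul_le_mul_of_nonneg_left (hcs.trans ?_) (by positivity)
        exact mul_le_mul_of_nonneg_right hB1 h0
      _ = _ := by ring
  have h2 : J ^ 2 ≤ (K * (c.B1 - 1) + 1) ^ 2 * (c.B0 * D.totalNorm a) ^ 2 := by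
    rw [← mul_pow, ← sq_abs J]
    refine pow_le_pow_left₀ (abs_nonneg _) ?_ 2
    have hW : ∑ k, (D.wt γ' k o + D.R k o) ≤ K * (c.B1 - 1) + 1 := by
      rw [Finset.sum_add_distrib]
      refine add_le_add ?_ (sum_R_le_one o)
      refine le_trans ?_ (mul_le_mul_of_nonneg_left hB1 hK0.le)
      rw [Finset.mul_sum]
      refine Finset.sum_le_sum fun k _ => ?_
      rw [D.wt_eq γ γ', mul_comm]
      exact mul_le_mul_of_nonneg_right
        ((Real.exp_le_exp.2 (le_abs_self _)).trans (hexpg k)) (hwt k)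
    have hn0 : 0 ≤ c.B0 * D.totalNorm a :=
      mul_nonneg ((abs_nonneg _).trans (hreg.1 0)) (D.totalNorm_nonneg a)
    refine le_trans ?_ (mul_le_mul_of_nonneg_right hW hn0)
    rw [Finset.sum_mul]
    refine (Finset.abs_sum_le_sum_abs _ _).trans (Finset.sum_le_sum fun k _ => ?_)
    rw [abs_mul]
    refine mul_le_mul ?_ (hab k) (abs_nonneg _)
      (add_nonneg (D.wt_nonneg _ _ _) (D.R_nonneg _ _))
    refine (abs_sub _ _).trans (le_of_eq ?_)
    rw [abs_of_nonneg (D.wt_nonneg _ _ _), abs_of_nonneg (D.R_nonneg _ _)]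
  rw [hsplit]
  nlinarith [sq_nonneg (I + J)]

/-- Centring can only lower the mean square of `u - v`. With `w` the difference of the centred
functions, the difference of squares is `2 w v_c + w²`, and Cauchy–Schwarz handles the first term.
-/
theorem abs_sampleMean_sq_sub_le (u v : Obs D.K D.d → ℝ) {m : ℝ}
    (hm : D.sampleMean (fun o => (u o - v o) ^ 2) ω ≤ m) :
    |D.sampleMean (fun o => (u o - D.sampleMean u ω) ^ 2 - (v o - D.sampleMean v ω) ^ 2) ω| ≤
      2 * Real.sqrt m * Real.sqrt (D.sampleMean (fun o => (v o - D.sampleMean v ω) ^ 2) ω) + m := by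
  set uc : Obs D.K D.d → ℝ := fun o => u o - D.sampleMean u ω
  set vc : Obs D.K D.d → ℝ := fun o => v o - D.sampleMean v ω
  set w : Obs D.K D.d → ℝ := fun o => uc o - vc o with hw
  have hwm : D.sampleMean (fun o => w o ^ 2) ω ≤ m := by
    refine le_trans ?_ hm
    have e : D.sampleMean (fun o => (u o - v o) ^ 2) ω = D.sampleMean (fun o => w o ^ 2) ω +
        (D.sampleMean u ω - D.sampleMean v ω) ^ 2 := by
      set r := D.sampleMean u ω - D.sampleMean v ω with hr
      have e1 : ∀ o, (u o - v o) ^ 2 = w o ^ 2 + (2 * r * (u o - v o) - r ^ 2) := fun o => by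
        simp only [hw, uc, vc]
        rw [hr]; ring
      simp_rw [e1]
      rw [sampleMean_add, sampleMean_sub, sampleMean_const_mul, sampleMean_sub, sampleMean_const]
      rw [← hr]; ring
    rw [e]; linarith [sq_nonneg (D.sampleMean u ω - D.sampleMean v ω)]
  have hsplit : D.sampleMean (fun o => uc o ^ 2 - vc o ^ 2) ω =
      2 * D.sampleMean (fun o => w o * vc o) ω + D.sampleMean (fun o => w o ^ 2) ω := by
    rw [← sampleMean_const_mul, ← sampleMean_add]
    refine sampleMean_congr fun i => ?_
    simp only [hw]; ring
  have h0 : 0 ≤ D.sampleMean (fun o => w o ^ 2) ω := sampleMean_nonneg fun _ => sq_nonneg _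
  have hcs : |D.sampleMean (fun o => w o * vc o) ω| ≤
      Real.sqrt m * Real.sqrt (D.sampleMean (fun o => vc o ^ 2) ω) := by
    have e1 := sampleMean_mul_le (ω := ω) w vc
    have e2 := sampleMean_mul_le (ω := ω) (fun o => -w o) vc
    have e3 : D.sampleMean (fun o => -w o * vc o) ω = -D.sampleMean (fun o => w o * vc o) ω := by
      have := sampleMean_const_mul (ω := ω) (-1) fun o => w o * vc o
      simp only [neg_mul, one_mul] at this ⊢
      exact this
    simp only [neg_sq] at e2
    rw [e3] at e2
    have e4 : Real.sqrt (D.sampleMean (fun o => w o ^ 2) ω) ≤ Real.sqrt m :=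
      Real.sqrt_le_sqrt hwm
    exact (abs_le'.2 ⟨e1, e2⟩).trans (mul_le_mul_of_nonneg_right e4 (Real.sqrt_nonneg _))
  rw [hsplit]
  refine (abs_add_le _ _).trans ?_
  rw [abs_mul, abs_of_nonneg h0, abs_of_pos (by norm_num : (0 : ℝ) < 2), mul_assoc]
  linarith

/-- The sample average of `phi_sub_sq_le`. The propensity part has order `|S_γ| λ̃_1²`, at most the
squared scale since a support has at least one element; the outcome part is a squared group norm,
already of that order. -/
theorem GoodSample.phi_bound (hc : c.Admissible) (hC : D.Conditions c ε γ α)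
    (hlam : 0 < D.lam1 c ε) (hG : D.GoodSample c ε γ α ω)
    (hres : ∀ b, D.quad (D.residGram γ α) b ≤ c.σ0 ^ 2 * D.quad (fun k => D.gram γ k) b)
    (h : D.SegmentMin (D.objCAL (c.A1 * D.lam1 c ε) ω) γ γ') {α' : D.Coef}
    (hα : D.SegmentMin (D.objWL (c.A2 * D.lam2 c ε) ω γ') α α') :
    D.sampleMean (fun o => (D.phi α' γ' o - D.phi α γ o) ^ 2) ω ≤ c.mainConst *
      ((D.support γ).card * D.lam1 c ε + (D.support α).card * D.lam2 c ε) ^ 2 := by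
  obtain ⟨hexp, -, -, -⟩ := hG.calibration hc hC hlam h
  have hV := hG.residual hc hC hlam hres h
  have hW := hG.weightedLS hc hC hlam hres h hα
  have hl2 : 0 ≤ D.lam2 c ε := hlam.le.trans (D.lam1_le_lam2 c)
  set T := (D.support γ).card * D.lam1 c ε + (D.support α).card * D.lam2 c ε with hT
  have hB1 : 0 ≤ c.B1 - 1 := by linarith [hc.one_lt_B1]
  have hB0 := hc.one_le_B0
  have hK := hc.one_le_expBound
  have hR := hc.residCAL_nonneg
  have h1 : D.sampleMean (fun o => (D.phi α' γ' o - D.phi α γ o) ^ 2) ω ≤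
      2 * c.expBound ^ 2 * (c.B1 - 1) * D.sampleMean (fun o =>
        ∑ k, D.wt γ k o * D.res α k o ^ 2 * D.lin (γ' - γ) k o.2.2 ^ 2) ω +
      2 * (c.expBound * (c.B1 - 1) + 1) ^ 2 * (c.B0 * D.totalNorm (α' - α)) ^ 2 := by
    rw [← sampleMean_const_mul, ← sampleMean_const (ω := ω)
      (2 * (c.expBound * (c.B1 - 1) + 1) ^ 2 * (c.B0 * D.totalNorm (α' - α)) ^ 2),
      ← sampleMean_add]
    exact sampleMean_mono fun i => phi_sub_sq_le (hG.regular i) hexp α'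
  have hs1 := D.one_le_card_support γ
  have h2 : (D.support γ).card * D.lam1 c ε ^ 2 ≤ T ^ 2 := by
    have e1 : (D.support γ).card * D.lam1 c ε ^ 2 ≤ ((D.support γ).card * D.lam1 c ε) ^ 2 := by
      rw [mul_pow]
      exact mul_le_mul_of_nonneg_right (le_self_pow₀ hs1 two_ne_zero) (sq_nonneg _)
    refine e1.trans (pow_le_pow_left₀ (by positivity) ?_ 2)
    rw [hT]; exact le_add_of_nonneg_right (by positivity)
  have h3 : (c.B0 * D.totalNorm (α' - α)) ^ 2 ≤ (c.B0 * c.normWL) ^ 2 * T ^ 2 := by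
    rw [← mul_pow]
    refine pow_le_pow_left₀ (mul_nonneg (by linarith) (D.totalNorm_nonneg _)) ?_ 2
    rw [mul_assoc]
    exact mul_le_mul_of_nonneg_left hW (by linarith)
  refine h1.trans ?_
  calc _ ≤ 2 * c.expBound ^ 2 * (c.B1 - 1) * (c.residCAL * T ^ 2) +
        2 * (c.expBound * (c.B1 - 1) + 1) ^ 2 * ((c.B0 * c.normWL) ^ 2 * T ^ 2) := by
        gcongr
        exact hV.trans (mul_le_mul_of_nonneg_left h2 hR)
    _ ≤ _ := by
      unfold Constants.mainConst
      linarith [sq_nonneg T]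

/-- On a good sample the estimates exist and the bound for the variance estimator holds. -/
theorem GoodSample.estimatesSatisfy (hc : c.Admissible) (hC : D.Conditions c ε γ α)
    (hlam : 0 < D.lam1 c ε) (hG : D.GoodSample c ε γ α ω)
    (hres : ∀ b, D.quad (D.residGram γ α) b ≤ c.σ0 ^ 2 * D.quad (fun k => D.gram γ k) b) :
    D.EstimatesSatisfy (c.A1 * D.lam1 c ε) (c.A2 * D.lam2 c ε) ω
      fun γhat αhat =>
        |D.sampleMean (fun o => D.phiC αhat γhat ω o ^ 2 - D.phiC α γ ω o ^ 2) ω| ≤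
          2 * Real.sqrt c.mainConst *
              Real.sqrt (D.sampleMean (fun o => D.phiC α γ ω o ^ 2) ω) *
              Real.sqrt ((D.K : ℝ) - 1) *
              ((D.support γ).card * D.lam1 c ε + (D.support α).card * D.lam2 c ε) +
            c.mainConst * ((D.K : ℝ) - 1) *
              ((D.support γ).card * D.lam1 c ε + (D.support α).card * D.lam2 c ε) ^ 2 := by
  have hA1 := (two_mul_lt_of_div_lt hc.one_lt_ξ1 hc.A1_gt).1
  have hA2 := (two_mul_lt_of_div_lt hc.one_lt_ξ2 hc.A2_gt).1
  have hl2 : 0 ≤ D.lam2 c ε := hlam.le.trans (D.lam1_le_lam2 c)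
  have hN := hc.normCAL_nonneg
  refine ⟨D.exists_isRCAL (by positivity) γ
    (ρ := c.normCAL * ((D.support γ).card * D.lam1 c ε) + 1) (by positivity) fun x hx => ?_,
    fun γhat hγ => ?_⟩
  · have := (hG.calibration hc hC hlam hx).2.1
    linarith
  have hγs : D.SegmentMin (D.objCAL (c.A1 * D.lam1 c ε) ω) γ γhat := fun s _ _ => hγ _
  -- The absolute value and the added one make the radius positive and the bound strict without a
  -- sign for `normWL`.
  refine ⟨D.exists_isRWL (by positivity) γhat α
    (ρ := |c.normWL *
      ((D.support γ).card * D.lam1 c ε + (D.support α).card * D.lam2 c ε)| + 1)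
    (by positivity) fun x hx => ?_, fun αhat hα => ?_⟩
  · have := hG.weightedLS hc hC hlam hres hγs hx
    linarith [le_abs_self (c.normWL *
      ((D.support γ).card * D.lam1 c ε + (D.support α).card * D.lam2 c ε))]
  have hαs : D.SegmentMin (D.objWL (c.A2 * D.lam2 c ε) ω γhat) α αhat := fun s _ _ => hα _
  have hφ := hG.phi_bound hc hC hlam hres hγs hαs
  have hM := hc.mainConst_pos
  set T := (D.support γ).card * D.lam1 c ε + (D.support α).card * D.lam2 c ε with hT
  have hT0 : 0 ≤ T := by positivity
  have hK : (1 : ℝ) ≤ (D.K : ℝ) - 1 := by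
    have : (2 : ℝ) ≤ D.K := by exact_mod_cast D.two_le_K
    linarith
  have h1 := abs_sampleMean_sq_sub_le (D.phi αhat γhat) (D.phi α γ) hφ
  refine h1.trans ?_
  rw [Real.sqrt_mul hM.le, Real.sqrt_sq hT0]
  -- The bound already holds without `K - 1`; the factor is inserted by weakening.
  have hsq : 1 ≤ Real.sqrt ((D.K : ℝ) - 1) := Real.one_le_sqrt.2 hK
  refine add_le_add ?_ ?_
  · change _ ≤ 2 * Real.sqrt c.mainConst *
      Real.sqrt (D.sampleMean (fun o => (D.phi α γ o - D.sampleMean (D.phi α γ) ω) ^ 2) ω) * _ * T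
    set W := Real.sqrt (D.sampleMean (fun o => (D.phi α γ o - D.sampleMean (D.phi α γ) ω) ^ 2) ω)
    have : 2 * Real.sqrt c.mainConst * W * T * 1 ≤
        2 * Real.sqrt c.mainConst * W * T * Real.sqrt ((D.K : ℝ) - 1) := by
      gcongr
    linarith
  · have : c.mainConst * T ^ 2 * 1 ≤ c.mainConst * T ^ 2 * ((D.K : ℝ) - 1) := by gcongr
    linarith

end Study

end

/-! ### Conditional expectations and the vanishing of the population scores. -/

noncomputable section

section CondExp

variable {Ω : Type u} {m mΩ : MeasurableSpace Ω} {P : Measure Ω} [IsProbabilityMeasure P]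

/-- A bounded nonnegative `m`-measurable weight can be pulled out of the conditional expectation.
This is how the sub-gaussian condition given `X` is used with weights that depend on `X`. -/
theorem integral_mul_le_of_condExp_le (hm : m ≤ mΩ) {F G : Ω → ℝ} {C : ℝ} (hF : Integrable F P)
    (hG : StronglyMeasurable[m] G) (hG0 : ∀ᵐ ω ∂P, 0 ≤ G ω) {B : ℝ} (hGB : ∀ᵐ ω ∂P, G ω ≤ B)
    (hFC : ∀ᵐ ω ∂P, (P[F | m]) ω ≤ C) :
    Integrable (fun ω => G ω * F ω) P ∧ ∫ ω, G ω * F ω ∂P ≤ C * ∫ ω, G ω ∂P := by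
  have hGb : ∀ᵐ ω ∂P, ‖G ω‖ ≤ B := by
    filter_upwards [hG0, hGB] with ω h0 h1
    rwa [Real.norm_of_nonneg h0]
  have hGm : AEStronglyMeasurable G P := (hG.mono hm).aestronglyMeasurable
  have hGi : Integrable G P := Integrable.of_bound hGm B hGb
  have hGF : Integrable (fun ω => G ω * F ω) P := hF.bdd_mul hGm hGb
  refine ⟨hGF, ?_⟩
  have h1 : ∫ ω, G ω * F ω ∂P = ∫ ω, (P[fun ω => G ω * F ω | m]) ω ∂P :=
    (integral_condExp hm).symm
  have h2 : P[fun ω => G ω * F ω | m] =ᵐ[P] fun ω => G ω * (P[F | m]) ω :=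
    condExp_mul_of_stronglyMeasurable_left hG hGF hF
  rw [h1, integral_congr_ae h2, ← integral_const_mul]
  refine integral_mono_ae (integrable_condExp.bdd_mul hGm hGb) (hGi.const_mul _) ?_
  filter_upwards [hFC, hG0] with ω h3 h4
  rw [mul_comm C]
  exact mul_le_mul_of_nonneg_left h3 h4

theorem integral_le_of_condExp_le (hm : m ≤ mΩ) {F : Ω → ℝ} {C : ℝ} (hF : Integrable F P)
    (hFC : ∀ᵐ ω ∂P, (P[F | m]) ω ≤ C) : ∫ ω, F ω ∂P ≤ C := by
  have := (integral_mul_le_of_condExp_le hm hF (G := fun _ => (1 : ℝ)) stronglyMeasurable_const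
    (ae_of_all _ fun _ => zero_le_one) (ae_of_all _ fun _ => le_rfl) hFC).2
  simpa using this

/-- Conditional independence of an event and a variable given `X`, tested against functions of
`(X, Z)`. -/
theorem CondIndepEventVar.lintegral_eq (hm : m ≤ mΩ) {β : Type*} [MeasurableSpace β] {X : Ω → β}
    (hX : Measurable[m] X) {A : Set Ω} (hA : MeasurableSet A) {Z : Ω → ℝ} (hZ : Measurable Z)
    (h : CondIndepEventVar m P A Z) {H : β × ℝ → ENNReal} (hH : Measurable H) :
    ∫⁻ ω in A, H (X ω, Z ω) ∂P =
      ∫⁻ ω, ENNReal.ofReal ((P[A.indicator (fun _ => (1 : ℝ)) | m]) ω) * H (X ω, Z ω) ∂P := by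
  set π : Ω → ℝ := P[A.indicator (fun _ => (1 : ℝ)) | m] with hπ
  have hπm : StronglyMeasurable[m] π := stronglyMeasurable_condExp
  have hπm' : Measurable π := (hπm.mono hm).measurable
  have hπ0 : ∀ᵐ ω ∂P, 0 ≤ π ω :=
    condExp_nonneg (ae_of_all _ fun ω => Set.indicator_nonneg (fun _ _ => zero_le_one) ω)
  have hind : ∀ S : Set Ω, MeasurableSet S → Integrable (S.indicator fun _ => (1 : ℝ)) P :=
    fun S hS => (integrable_const _).indicator hS
  have hXZ : Measurable fun ω => (X ω, Z ω) := (hX.mono hm le_rfl).prodMk hZ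
  -- It suffices to compare the two laws of `(X, Z)` on rectangles, and there conditional
  -- independence is the factorization `E[1_A 1_{Z ∈ t} | m] = π E[1_{Z ∈ t} | m]`.
  have hmeas : (P.restrict A).map (fun ω => (X ω, Z ω)) =
      (P.withDensity fun ω => ENNReal.ofReal (π ω)).map fun ω => (X ω, Z ω) := by
    refine Measure.ext_prod fun {s t} hs ht => ?_
    have hs' : MeasurableSet[m] (X ⁻¹' s) := hX hs
    have ht' : MeasurableSet (Z ⁻¹' t) := hZ ht
    rw [Measure.map_apply hXZ (hs.prod ht), Measure.map_apply hXZ (hs.prod ht),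
      Set.mk_preimage_prod, Measure.restrict_apply ((hm _ hs').inter ht'),
      withDensity_apply _ ((hm _ hs').inter ht')]
    have hπi : Integrable π P := integrable_condExp
    have e1 : ∫ ω in X ⁻¹' s, (A ∩ Z ⁻¹' t).indicator (fun _ => (1 : ℝ)) ω ∂P =
        ∫ ω in X ⁻¹' s, π ω * (Z ⁻¹' t).indicator (fun _ => (1 : ℝ)) ω ∂P := by
      have hint : Integrable (fun ω => π ω * (Z ⁻¹' t).indicator (fun _ => (1 : ℝ)) ω) P := by
        refine hπi.mul_bdd (c := 1) (hind _ ht').1 (ae_of_all _ fun ω => ?_)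
        by_cases hω : ω ∈ Z ⁻¹' t <;> simp [hω]
      rw [← setIntegral_condExp hm (hind _ (hA.inter ht')) hs',
        ← setIntegral_condExp hm hint hs']
      refine setIntegral_congr_ae (hm _ hs') ?_
      have h2 : P[fun ω => π ω * (Z ⁻¹' t).indicator (fun _ => (1 : ℝ)) ω | m] =ᵐ[P]
          fun ω => π ω * (P[(Z ⁻¹' t).indicator (fun _ => (1 : ℝ)) | m]) ω :=
        condExp_mul_of_stronglyMeasurable_left hπm hint (hind _ ht')
      filter_upwards [h t ht, h2] with ω h3 h4 _
      rw [h3, h4]; rfl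
    have e2 : ∫ ω in X ⁻¹' s, (A ∩ Z ⁻¹' t).indicator (fun _ => (1 : ℝ)) ω ∂P =
        P.real (X ⁻¹' s ∩ Z ⁻¹' t ∩ A) := by
      rw [integral_indicator (hA.inter ht'), Measure.restrict_restrict (hA.inter ht')]
      simp only [integral_const, smul_eq_mul, mul_one, measureReal_restrict_apply_univ]
      congr 1
      ext ω; simp only [Set.mem_inter_iff]; tauto
    have e3 : ∫ ω in X ⁻¹' s, π ω * (Z ⁻¹' t).indicator (fun _ => (1 : ℝ)) ω ∂P =
        ∫ ω in X ⁻¹' s ∩ Z ⁻¹' t, π ω ∂P := by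
      rw [Set.inter_comm, ← Measure.restrict_restrict ht', ← integral_indicator ht']
      refine integral_congr_ae (ae_of_all _ fun ω => ?_)
      by_cases hω : ω ∈ Z ⁻¹' t <;> simp [hω]
    rw [← ofReal_integral_eq_lintegral_ofReal hπi.integrableOn (ae_restrict_of_ae hπ0), ← e3, ← e1,
      e2, ofReal_measureReal]
  rw [← lintegral_map hH hXZ, hmeas, lintegral_map hH hXZ]
  exact lintegral_withDensity_eq_lintegral_mul _ hπm'.ennreal_ofReal (hH.comp hXZ)

theorem CondIndepEventVar.integral_eq (hm : m ≤ mΩ) {β : Type*} [MeasurableSpace β] {X : Ω → β}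
    (hX : Measurable[m] X) {A : Set Ω} (hA : MeasurableSet A) {Z : Ω → ℝ} (hZ : Measurable Z)
    (h : CondIndepEventVar m P A Z) {H : β × ℝ → ℝ} (hH : Measurable H) (hH0 : ∀ q, 0 ≤ H q) :
    ∫ ω in A, H (X ω, Z ω) ∂P =
      ∫ ω, (P[A.indicator (fun _ => (1 : ℝ)) | m]) ω * H (X ω, Z ω) ∂P := by
  have hπ0 : ∀ᵐ ω ∂P, 0 ≤ (P[A.indicator (fun _ => (1 : ℝ)) | m]) ω :=
    condExp_nonneg (ae_of_all _ fun ω => Set.indicator_nonneg (fun _ _ => zero_le_one) ω)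
  have hXZ : Measurable fun ω => (X ω, Z ω) := (hX.mono hm le_rfl).prodMk hZ
  have hπm : Measurable (P[A.indicator (fun _ => (1 : ℝ)) | m]) :=
    (stronglyMeasurable_condExp.mono hm).measurable
  have hHm : Measurable fun ω => H (X ω, Z ω) := hH.comp hXZ
  rw [integral_eq_lintegral_of_nonneg_ae (ae_of_all _ fun _ => hH0 _)
      hHm.aestronglyMeasurable,
    integral_eq_lintegral_of_nonneg_ae (hπ0.mono fun ω h => mul_nonneg h (hH0 _))
      (hπm.mul hHm).aestronglyMeasurable]
  congr 1
  rw [CondIndepEventVar.lintegral_eq hm hX hA hZ h (H := fun q => ENNReal.ofReal (H q))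
    hH.ennreal_ofReal]
  refine lintegral_congr_ae (hπ0.mono fun ω h => ?_)
  exact (ENNReal.ofReal_mul h).symm

end CondExp

namespace Study

variable {D : Study.{u}} {c : Constants} {ε : ℝ} {γ α : D.Coef}

theorem measurable_obs : Measurable D.obs := by
  refine Measurable.prodMk ?_ (D.measurable_T.prodMk D.measurable_X)
  have h : Measurable fun q : Fin D.K × D.Ω => D.Ypot q.1 q.2 :=
    measurable_from_prod_countable_right fun k => D.measurable_Ypot k
  exact h.comp (D.measurable_T.prodMk measurable_id)

theorem Conditions.ae_regular (hc : c.Admissible) (hC : D.Conditions c ε γ α) :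
    ∀ᵐ ω ∂D.P, D.Regular c γ (D.obs ω) := by
  filter_upwards [hC.bounded, hC.overlap] with ω h1 h2
  refine ⟨fun j => ?_, ?_⟩
  · refine Fin.cases ?_ (fun j => h1 j) j
    change |D.f (D.X ω) 0| ≤ _
    rw [D.f_zero, abs_one]; exact hc.one_le_B0
  · rw [inv_prop_t] at h2
    change ∑ k : D.Other, Real.exp (D.lin γ k (D.X ω)) ≤ _
    linarith

theorem measurable_lin_obs (b : D.Coef) (k : D.Other) :
    Measurable fun o : Obs D.K D.d => D.lin b k o.2.2 :=
  (D.measurable_lin b k).comp (measurable_snd.comp measurable_snd)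

theorem measurable_f_obs (j : Fin (D.p + 1)) : Measurable fun o : Obs D.K D.d => D.f o.2.2 j :=
  (measurable_pi_apply j).comp (D.measurable_f.comp (measurable_snd.comp measurable_snd))

variable (D) in
/-- The residual of the potential outcome. -/
def resT (α : D.Coef) (k : D.Other) (ω : D.Ω) : ℝ := D.Ypot D.t ω - D.lin α k (D.X ω)

theorem measurable_resT (α : D.Coef) (k : D.Other) : Measurable (D.resT α k) :=
  (D.measurable_Ypot _).sub ((D.measurable_lin α k).comp D.measurable_X)

/-- Consistency: the observed outcome is the potential outcome under `t` when `T = t`, and otherwise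
the weight vanishes. Hence moment conditions on the potential outcome apply to weighted observed
residuals. -/
theorem wt_eq_zero_or (γ : D.Coef) (α : D.Coef) (k : D.Other) (ω : D.Ω) :
    D.wt γ k (D.obs ω) = 0 ∨ D.res α k (D.obs ω) = D.resT α k ω := by
  by_cases h : D.T ω = D.t
  · right
    simp only [res, resT, obs, h]
  · left
    simp [wt, R, obs, h]

theorem wt_mul_res (γ α : D.Coef) (k : D.Other) (ω : D.Ω) :
    D.wt γ k (D.obs ω) * D.res α k (D.obs ω) = D.wt γ k (D.obs ω) * D.resT α k ω := by
  rcases wt_eq_zero_or γ α k ω with h | h <;> rw [h]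
  simp

theorem wt_mul_res_sq (γ α : D.Coef) (k : D.Other) (ω : D.Ω) :
    D.wt γ k (D.obs ω) * D.res α k (D.obs ω) ^ 2 = D.wt γ k (D.obs ω) * D.resT α k ω ^ 2 := by
  rcases wt_eq_zero_or γ α k ω with h | h <;> rw [h]
  simp

theorem Regular.wt_le {o : Obs D.K D.d} (h : D.Regular c γ o) (k : D.Other) :
    D.wt γ k o ≤ c.B1 - 1 :=
  (Finset.single_le_sum (f := fun k => D.wt γ k o) (fun k _ => D.wt_nonneg γ k o)
    (Finset.mem_univ k)).trans h.wt_sum_le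

theorem Conditions.exp_resT (hC : D.Conditions c ε γ α) (k : D.Other) :
    Integrable (fun ω => Real.exp (D.resT α k ω ^ 2 / c.σ0 ^ 2)) D.P ∧
      ∫ ω, Real.exp (D.resT α k ω ^ 2 / c.σ0 ^ 2) ∂D.P ≤ 2 :=
  ⟨(hC.subgaussian k).1,
    integral_le_of_condExp_le D.measurable_X.comap_le (hC.subgaussian k).1 (hC.subgaussian k).2⟩

theorem Conditions.integrable_resT_sq (hc : c.Admissible) (hC : D.Conditions c ε γ α)
    (k : D.Other) : Integrable (fun ω => D.resT α k ω ^ 2) D.P := by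
  refine ((hC.exp_resT k).1.const_mul (c.σ0 ^ 2)).mono'
    ((measurable_resT α k).pow_const 2).aestronglyMeasurable (ae_of_all _ fun ω => ?_)
  have hσ : 0 < c.σ0 ^ 2 := by have := hc.σ0_pos; positivity
  rw [Real.norm_of_nonneg (sq_nonneg _)]
  have h := Real.add_one_le_exp (D.resT α k ω ^ 2 / c.σ0 ^ 2)
  calc D.resT α k ω ^ 2 = c.σ0 ^ 2 * (D.resT α k ω ^ 2 / c.σ0 ^ 2) := by
        have := hc.σ0_pos.ne'
        field_simp
    _ ≤ _ := by gcongr; linarith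

/-- Integrability of functions of the observation with a quadratic bound in the residuals. -/
theorem Conditions.integrable_of_le (hc : c.Admissible) (hC : D.Conditions c ε γ α)
    {F : Obs D.K D.d → ℝ} (hF : Measurable F) (a : ℝ)
    (h : ∀ ω, D.Regular c γ (D.obs ω) → |F (D.obs ω)| ≤ a * (1 + ∑ k, D.resT α k ω ^ 2)) :
    Integrable (fun ω => F (D.obs ω)) D.P := by
  have e : Integrable (fun ω => ∑ k, D.resT α k ω ^ 2) D.P :=
    integrable_finsetSum Finset.univ fun k _ => hC.integrable_resT_sq hc k
  refine (((integrable_const (1 : ℝ)).add e).const_mul a).mono'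
    (hF.comp measurable_obs).aestronglyMeasurable ?_
  filter_upwards [hC.ae_regular hc] with ω hω
  simpa using h ω hω

theorem Conditions.integrable_of_bdd (hc : c.Admissible) (hC : D.Conditions c ε γ α)
    {F : Obs D.K D.d → ℝ} (hF : Measurable F) (a : ℝ)
    (h : ∀ o, D.Regular c γ o → |F o| ≤ a) :
    Integrable (fun ω => F (D.obs ω)) D.P := by
  refine Integrable.of_bound (hF.comp measurable_obs).aestronglyMeasurable a ?_
  filter_upwards [hC.ae_regular hc] with ω hω
  exact h _ hω

theorem measurable_lossCAL (γ : D.Coef) : Measurable (D.lossCAL γ) :=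
  Finset.measurable_sum _ fun k _ =>
    ((D.measurable_R _).mul (Real.measurable_exp.comp (measurable_lin_obs γ k))).sub
      ((D.measurable_R _).mul (measurable_lin_obs γ k))

/-- The expected calibration score vanishes in every direction. -/
theorem Conditions.integral_scoreCAL (hc : c.Admissible) (hC : D.Conditions c ε γ α)
    (b : D.Coef) :
    ∫ ω, ∑ k : D.Other, (D.wt γ k (D.obs ω) - D.R k (D.obs ω)) * D.lin b k (D.obs ω).2.2 ∂D.P =
      0 := by
  have hB1 : 0 ≤ c.B1 - 1 := by linarith [hc.one_lt_B1]
  have hB0 : 0 ≤ c.B0 := by linarith [hc.one_le_B0]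
  have hloss : ∀ γ', Integrable (fun ω => D.lossCAL γ' (D.obs ω)) D.P := fun γ' => by
    refine hC.integrable_of_bdd hc (measurable_lossCAL γ')
      (∑ _k : D.Other, (Real.exp (c.B0 * D.totalNorm γ') + c.B0 * D.totalNorm γ')) fun o ho => ?_
    refine (Finset.abs_sum_le_sum_abs _ _).trans (Finset.sum_le_sum fun k _ => ?_)
    have h1 := D.abs_lin_le ho.1 γ' k
    refine (abs_sub _ _).trans ?_
    rw [abs_mul, abs_mul, abs_of_nonneg (D.R_nonneg _ _), abs_of_nonneg (D.R_nonneg _ _),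
      abs_of_pos (Real.exp_pos _)]
    refine add_le_add ?_ ?_
    · exact (mul_le_of_le_one_left (Real.exp_pos _).le (D.R_le_one _ _)).trans
        (Real.exp_le_exp.2 ((le_abs_self _).trans h1))
    · exact (mul_le_of_le_one_left (abs_nonneg _) (D.R_le_one _ _)).trans h1
  set S : Obs D.K D.d → ℝ := fun o => ∑ k : D.Other, (D.wt γ k o - D.R k o) * D.lin b k o.2.2
  set Q : Obs D.K D.d → ℝ := fun o => ∑ k : D.Other, D.wt γ k o *
    (D.lin b k o.2.2 ^ 2 * Real.exp |D.lin b k o.2.2|)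
  have hS : Integrable (fun ω => S (D.obs ω)) D.P := by
    refine hC.integrable_of_bdd hc (Finset.measurable_sum _ fun k _ =>
      ((D.measurable_wt γ k).sub (D.measurable_R _)).mul (measurable_lin_obs b k))
      (∑ _k : D.Other, (c.B1 - 1 + 1) * (c.B0 * D.totalNorm b)) fun o ho => ?_
    refine (Finset.abs_sum_le_sum_abs _ _).trans (Finset.sum_le_sum fun k _ => ?_)
    rw [abs_mul]
    refine mul_le_mul ((abs_sub _ _).trans ?_) (D.abs_lin_le ho.1 b k) (abs_nonneg _) (by linarith)
    rw [abs_of_nonneg (D.wt_nonneg _ _ _), abs_of_nonneg (D.R_nonneg _ _)]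
    exact add_le_add (ho.wt_le k) (D.R_le_one _ _)
  have hQ : Integrable (fun ω => Q (D.obs ω)) D.P := by
    refine hC.integrable_of_bdd hc (Finset.measurable_sum _ fun k _ =>
      (D.measurable_wt γ k).mul (((measurable_lin_obs b k).pow_const 2).mul
        (Real.measurable_exp.comp (measurable_lin_obs b k).abs)))
      (∑ _k : D.Other, (c.B1 - 1) * ((c.B0 * D.totalNorm b) ^ 2 *
        Real.exp (c.B0 * D.totalNorm b))) fun o ho => ?_
    refine (Finset.abs_sum_le_sum_abs _ _).trans (Finset.sum_le_sum fun k _ => ?_)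
    have h1 := D.abs_lin_le ho.1 b k
    rw [abs_mul, abs_mul, abs_of_nonneg (D.wt_nonneg _ _ _), abs_of_pos (Real.exp_pos _), abs_pow]
    have h2 := ho.wt_le k
    have h3 := D.wt_nonneg γ k o
    gcongr
  -- Minimality is tested at `γ + s b` for both signs of `s`; the remainder is quadratic, so the
  -- linear coefficient must vanish.
  have key : ∀ s : ℝ, |s| ≤ 1 →
      0 ≤ s * ∫ ω, S (D.obs ω) ∂D.P + s ^ 2 * ∫ ω, Q (D.obs ω) ∂D.P := fun s hs => by
    have h1 := hC.target_γ (γ + s • b)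
    have h2 : ∫ ω, D.lossCAL (γ + s • b) (D.obs ω) ∂D.P ≤ ∫ ω, (D.lossCAL γ (D.obs ω) +
        (s * S (D.obs ω) + s ^ 2 * Q (D.obs ω))) ∂D.P := by
      refine integral_mono (hloss _)
        ((hloss γ).add ((hS.const_mul s).add (hQ.const_mul (s ^ 2)))) fun ω => ?_
      set o := D.obs ω
      simp only [lossCAL, S, Q]
      rw [Finset.mul_sum, Finset.mul_sum, ← Finset.sum_add_distrib, ← Finset.sum_add_distrib]
      refine Finset.sum_le_sum fun k _ => ?_
      rw [lin_add, lin_smul, Real.exp_add]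
      set g := D.lin b k o.2.2
      have ew : D.wt γ k o = D.R D.t o * Real.exp (D.lin γ k o.2.2) := rfl
      have e2 := exp_le_one_add_add_sq_mul_exp_abs (s * g)
      have e3 : |s * g| ≤ |g| := by
        rw [abs_mul]
        exact mul_le_of_le_one_left (abs_nonneg _) hs
      have e4 : (s * g) ^ 2 * Real.exp |s * g| ≤ s ^ 2 * (g ^ 2 * Real.exp |g|) := by
        rw [mul_pow, mul_assoc]
        gcongr
      have e5 := mul_le_mul_of_nonneg_left (e2.trans (add_le_add_right e4 _)) (D.wt_nonneg γ k o)
      rw [ew] at e5 ⊢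
      linarith
    rw [integral_add (hloss γ) (g := fun ω => s * S (D.obs ω) + s ^ 2 * Q (D.obs ω)) ((hS.const_mul s).add (hQ.const_mul (s ^ 2))),
      integral_add (hS.const_mul s) (hQ.const_mul (s ^ 2)), integral_const_mul,
      integral_const_mul] at h2
    linarith
  refine le_antisymm ?_ ?_
  · refine le_of_forall_mul_sub_sq_le (c := ∫ ω, Q (D.obs ω) ∂D.P) fun s h0 h1 => ?_
    have := key (-s) (by rwa [abs_neg, abs_of_pos h0])
    rw [neg_sq] at this
    linarith
  · rw [← neg_nonpos]
    refine le_of_forall_mul_sub_sq_le (c := ∫ ω, Q (D.obs ω) ∂D.P) fun s h0 h1 => ?_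
    have := key s (by rwa [abs_of_pos h0])
    linarith

theorem abs_le_one_add_sq (x : ℝ) : |x| ≤ 1 + x ^ 2 := by
  rw [← sq_abs]; nlinarith [sq_nonneg (|x| - 1), abs_nonneg x]

theorem one_add_resT_sq_le (k : D.Other) (ω : D.Ω) :
    1 + D.resT α k ω ^ 2 ≤ 1 + ∑ k, D.resT α k ω ^ 2 := by
  have := Finset.single_le_sum (f := fun k => D.resT α k ω ^ 2) (fun _ _ => sq_nonneg _)
    (Finset.mem_univ k)
  linarith

theorem measurable_lossWL (γ α : D.Coef) : Measurable (D.lossWL γ α) :=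
  Finset.measurable_sum _ fun k _ =>
    ((D.measurable_wt γ k).mul ((D.measurable_res α k).pow_const 2)).div_const _

/-- The expected weighted least squares score vanishes in every direction. -/
theorem Conditions.integral_scoreWL (hc : c.Admissible) (hC : D.Conditions c ε γ α)
    (b : D.Coef) :
    ∫ ω, ∑ k : D.Other, D.wt γ k (D.obs ω) * D.res α k (D.obs ω) * D.lin b k (D.obs ω).2.2 ∂D.P =
      0 := by
  have hB1 : 0 ≤ c.B1 - 1 := by linarith [hc.one_lt_B1]
  have hB0 : 0 ≤ c.B0 := by linarith [hc.one_le_B0]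
  have hn := D.totalNorm_nonneg b
  set S : Obs D.K D.d → ℝ := fun o => ∑ k : D.Other, D.wt γ k o * D.res α k o * D.lin b k o.2.2
  set Q : Obs D.K D.d → ℝ := fun o => ∑ k : D.Other, D.wt γ k o * D.lin b k o.2.2 ^ 2 / 2
  have hloss : Integrable (fun ω => D.lossWL γ α (D.obs ω)) D.P := by
    refine hC.integrable_of_le hc (measurable_lossWL γ α) (∑ _k : D.Other, (c.B1 - 1))
      fun ω hω => ?_
    rw [lossWL_eq, Finset.sum_mul]
    refine (Finset.abs_sum_le_sum_abs _ _).trans (Finset.sum_le_sum fun k _ => ?_)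
    rw [wt_mul_res_sq, abs_of_nonneg (div_nonneg (mul_nonneg (D.wt_nonneg _ _ _) (sq_nonneg _))
      zero_le_two)]
    have h1 := hω.wt_le k
    have h2 := one_add_resT_sq_le (α := α) k ω
    calc D.wt γ k (D.obs ω) * D.resT α k ω ^ 2 / 2 ≤ (c.B1 - 1) * D.resT α k ω ^ 2 / 2 := by gcongr
      _ ≤ (c.B1 - 1) * D.resT α k ω ^ 2 := half_le_self (by positivity)
      _ ≤ _ := mul_le_mul_of_nonneg_left (by linarith) hB1
  have hS : Integrable (fun ω => S (D.obs ω)) D.P := by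
    refine hC.integrable_of_le hc (Finset.measurable_sum _ fun k _ =>
      ((D.measurable_wt γ k).mul (D.measurable_res α k)).mul (measurable_lin_obs b k))
      (∑ _k : D.Other, (c.B1 - 1) * (c.B0 * D.totalNorm b)) fun ω hω => ?_
    rw [Finset.sum_mul]
    refine (Finset.abs_sum_le_sum_abs _ _).trans (Finset.sum_le_sum fun k _ => ?_)
    rw [wt_mul_res, abs_mul, abs_mul, abs_of_nonneg (D.wt_nonneg _ _ _)]
    have h1 := hω.wt_le k
    have h2 := (abs_le_one_add_sq _).trans (one_add_resT_sq_le (α := α) k ω)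
    have h3 := D.abs_lin_le hω.1 b k
    calc _ ≤ (c.B1 - 1) * (1 + ∑ k, D.resT α k ω ^ 2) * (c.B0 * D.totalNorm b) := by gcongr
      _ = _ := by ring
  have hQ : Integrable (fun ω => Q (D.obs ω)) D.P := by
    refine hC.integrable_of_bdd hc (Finset.measurable_sum _ fun k _ =>
      ((D.measurable_wt γ k).mul ((measurable_lin_obs b k).pow_const 2)).div_const 2)
      (∑ _k : D.Other, (c.B1 - 1) * (c.B0 * D.totalNorm b) ^ 2 / 2) fun o ho => ?_
    refine (Finset.abs_sum_le_sum_abs _ _).trans (Finset.sum_le_sum fun k _ => ?_)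
    have h1 := D.abs_lin_le ho.1 b k
    rw [abs_div, abs_mul, abs_of_nonneg (D.wt_nonneg _ _ _), abs_pow, abs_two]
    have h2 := ho.wt_le k
    have h3 := D.wt_nonneg γ k o
    gcongr
  have key : ∀ s : ℝ, 0 ≤ s * -∫ ω, S (D.obs ω) ∂D.P + s ^ 2 * ∫ ω, Q (D.obs ω) ∂D.P :=
    fun s => by
    have h1 := hC.target_α (α + s • b)
    have h2 : ∫ ω, D.lossWL γ (α + s • b) (D.obs ω) ∂D.P = ∫ ω, (D.lossWL γ α (D.obs ω) +
        (-s * S (D.obs ω) + s ^ 2 * Q (D.obs ω))) ∂D.P := by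
      refine integral_congr_ae (ae_of_all _ fun ω => ?_)
      simp only [lossWL_eq, S, Q]
      rw [Finset.mul_sum, Finset.mul_sum, ← Finset.sum_add_distrib, ← Finset.sum_add_distrib]
      refine Finset.sum_congr rfl fun k _ => ?_
      simp only [res, lin_add, lin_smul]
      ring
    rw [integral_add hloss (g := fun ω => -s * S (D.obs ω) + s ^ 2 * Q (D.obs ω)) ((hS.const_mul (-s)).add (hQ.const_mul (s ^ 2))),
      integral_add (hS.const_mul (-s)) (hQ.const_mul (s ^ 2)), integral_const_mul,
      integral_const_mul] at h2
    linarith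
  refine le_antisymm ?_ ?_
  · refine le_of_forall_mul_sub_sq_le (c := ∫ ω, Q (D.obs ω) ∂D.P) fun s h0 h1 => ?_
    have := key s
    linarith
  · rw [← neg_nonpos]
    refine le_of_forall_mul_sub_sq_le (c := ∫ ω, Q (D.obs ω) ∂D.P) fun s h0 h1 => ?_
    have := key (-s)
    rw [neg_sq] at this
    linarith

end Study

end

/-! ### Population Gram matrices and exponential moments of the scores. -/

noncomputable section

namespace Study

variable {D : Study.{u}} {c : Constants} {ε : ℝ} {γ α : D.Coef}

theorem integral_quad {g : D.Other → Obs D.K D.d → ℝ}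
    {M : D.Other → Fin (D.p + 1) → Fin (D.p + 1) → ℝ}
    (hg : ∀ k j1 j2, Integrable (fun ω => g k (D.obs ω) *
      (D.f (D.obs ω).2.2 j1 * D.f (D.obs ω).2.2 j2)) D.P)
    (hM : ∀ k j1 j2, M k j1 j2 = ∫ ω, g k (D.obs ω) *
      (D.f (D.obs ω).2.2 j1 * D.f (D.obs ω).2.2 j2) ∂D.P) (b : D.Coef) :
    D.quad M b = ∑ k : D.Other, ∫ ω, g k (D.obs ω) * D.lin b k (D.obs ω).2.2 ^ 2 ∂D.P := by
  unfold quad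
  refine Finset.sum_congr rfl fun k _ => ?_
  have e : ∀ ω, g k (D.obs ω) * D.lin b k (D.obs ω).2.2 ^ 2 = ∑ j1, ∑ j2, b j1 k * b j2 k *
      (g k (D.obs ω) * (D.f (D.obs ω).2.2 j1 * D.f (D.obs ω).2.2 j2)) := fun ω => by
    rw [lin_sq, Finset.mul_sum]
    refine Finset.sum_congr rfl fun j1 _ => ?_
    rw [Finset.mul_sum]
    exact Finset.sum_congr rfl fun j2 _ => by ring
  simp_rw [e]
  rw [integral_finsetSum _ fun j1 _ => integrable_finsetSum _ fun j2 _ => (hg k j1 j2).const_mul _]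
  refine Finset.sum_congr rfl fun j1 _ => ?_
  rw [integral_finsetSum _ fun j2 _ => (hg k j1 j2).const_mul _]
  refine Finset.sum_congr rfl fun j2 _ => ?_
  rw [integral_const_mul, hM]; ring

theorem Regular.abs_f_mul_le {o : Obs D.K D.d} (h : D.Regular c γ o) (j1 j2 : Fin (D.p + 1)) :
    |D.f o.2.2 j1 * D.f o.2.2 j2| ≤ c.B0 ^ 2 := by
  rw [abs_mul, sq]
  exact mul_le_mul (h.1 j1) (h.1 j2) (abs_nonneg _) ((abs_nonneg _).trans (h.1 j1))

theorem Regular.abs_gram_le {o : Obs D.K D.d} (h : D.Regular c γ o) (k : D.Other)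
    (j1 j2 : Fin (D.p + 1)) :
    |D.wt γ k o * (D.f o.2.2 j1 * D.f o.2.2 j2)| ≤ c.B0 ^ 2 * (c.B1 - 1) := by
  rw [abs_mul, abs_of_nonneg (D.wt_nonneg _ _ _), mul_comm]
  exact mul_le_mul (h.abs_f_mul_le j1 j2) (h.wt_le k) (D.wt_nonneg _ _ _) (sq_nonneg _)

theorem Regular.abs_residGram_le {ω : D.Ω} (h : D.Regular c γ (D.obs ω)) (k : D.Other)
    (j1 j2 : Fin (D.p + 1)) :
    |D.wt γ k (D.obs ω) * D.res α k (D.obs ω) ^ 2 *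
      (D.f (D.obs ω).2.2 j1 * D.f (D.obs ω).2.2 j2)| ≤
      c.B0 ^ 2 * (c.B1 - 1) * D.resT α k ω ^ 2 := by
  rw [wt_mul_res_sq, mul_right_comm, abs_mul, abs_of_nonneg (sq_nonneg (D.resT α k ω))]
  exact mul_le_mul_of_nonneg_right (h.abs_gram_le k j1 j2) (sq_nonneg _)

theorem measurable_gramEntry (γ : D.Coef) (k : D.Other) (j1 j2 : Fin (D.p + 1)) :
    Measurable fun o : Obs D.K D.d => D.wt γ k o * (D.f o.2.2 j1 * D.f o.2.2 j2) :=
  (D.measurable_wt γ k).mul ((measurable_f_obs j1).mul (measurable_f_obs j2))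

theorem measurable_residEntry (γ α : D.Coef) (k : D.Other) (j1 j2 : Fin (D.p + 1)) :
    Measurable fun o : Obs D.K D.d =>
      D.wt γ k o * D.res α k o ^ 2 * (D.f o.2.2 j1 * D.f o.2.2 j2) :=
  ((D.measurable_wt γ k).mul ((D.measurable_res α k).pow_const 2)).mul
    ((measurable_f_obs j1).mul (measurable_f_obs j2))

theorem Conditions.integrable_gramEntry (hc : c.Admissible) (hC : D.Conditions c ε γ α)
    (k : D.Other) (j1 j2 : Fin (D.p + 1)) :
    Integrable (fun ω => D.wt γ k (D.obs ω) *
      (D.f (D.obs ω).2.2 j1 * D.f (D.obs ω).2.2 j2)) D.P :=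
  hC.integrable_of_bdd hc (measurable_gramEntry γ k j1 j2) _ fun _ ho => ho.abs_gram_le k j1 j2

theorem Conditions.integrable_residEntry (hc : c.Admissible) (hC : D.Conditions c ε γ α)
    (k : D.Other) (j1 j2 : Fin (D.p + 1)) :
    Integrable (fun ω => D.wt γ k (D.obs ω) * D.res α k (D.obs ω) ^ 2 *
      (D.f (D.obs ω).2.2 j1 * D.f (D.obs ω).2.2 j2)) D.P :=
  hC.integrable_of_le hc (measurable_residEntry γ α k j1 j2) (c.B0 ^ 2 * (c.B1 - 1)) fun ω hω => by
    have h1 : 0 ≤ c.B1 - 1 := by linarith [hc.one_lt_B1]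
    refine (hω.abs_residGram_le k j1 j2).trans (mul_le_mul_of_nonneg_left ?_ (by positivity))
    linarith [one_add_resT_sq_le (α := α) k ω]

theorem gram_eq (γ : D.Coef) (k : D.Other) (j1 j2 : Fin (D.p + 1)) :
    D.gram γ k j1 j2 = ∫ ω, D.wt γ k (D.obs ω) *
      (D.f (D.obs ω).2.2 j1 * D.f (D.obs ω).2.2 j2) ∂D.P := by
  unfold gram ratio
  simp_rw [ratio_eq]
  rfl

/-- Unconfoundedness and the sub-gaussian condition compare the residual-weighted Gram matrix with
the Gram matrix. -/
theorem Conditions.quad_residGram_le (hc : c.Admissible) (hC : D.Conditions c ε γ α)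
    (b : D.Coef) : D.quad (D.residGram γ α) b ≤ c.σ0 ^ 2 * D.quad (fun k => D.gram γ k) b := by
  have hσ : 0 < c.σ0 ^ 2 := by have := hc.σ0_pos; positivity
  rw [integral_quad (g := fun k o => D.wt γ k o * D.res α k o ^ 2) (M := D.residGram γ α)
      (hC.integrable_residEntry hc) (fun _ _ _ => rfl) b,
    integral_quad (hC.integrable_gramEntry hc) (fun k j1 j2 => gram_eq γ k j1 j2) b, Finset.mul_sum]
  refine Finset.sum_le_sum fun k _ => ?_
  have hm : MeasurableSpace.comap D.X inferInstance ≤ D.mΩ := D.measurable_X.comap_le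
  have hX : Measurable[MeasurableSpace.comap D.X inferInstance] D.X := comap_measurable D.X
  set A : Set D.Ω := {ω | D.T ω = D.t} with hAdef
  have hA : MeasurableSet A := D.measurable_T (measurableSet_singleton D.t)
  set π : D.Ω → ℝ := D.P[A.indicator (fun _ => (1 : ℝ)) | MeasurableSpace.comap D.X inferInstance] with hπdef
  set G : (Fin D.d → ℝ) → ℝ := fun x => Real.exp (D.lin γ k x) * D.lin b k x ^ 2 with hGdef
  have hG : Measurable G := (Real.measurable_exp.comp (D.measurable_lin γ k)).mul
    ((D.measurable_lin b k).pow_const 2)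
  have hG0 : ∀ x, 0 ≤ G x := fun x => by positivity
  have hwt : ∀ ω, D.wt γ k (D.obs ω) * D.lin b k (D.obs ω).2.2 ^ 2 =
      A.indicator (fun ω => G (D.X ω)) ω := fun ω => by
    by_cases h : D.T ω = D.t
    · rw [Set.indicator_of_mem (show ω ∈ A from h)]
      simp [wt, R, obs, h, G]
    · rw [Set.indicator_of_notMem (show ω ∉ A from h)]
      simp [wt, R, obs, h]
  -- Unconfoundedness replaces the indicator of `T = t` by its conditional probability `π`. All
  -- weights are then functions of `X`, and the residual moment can be taken given `X`.
  have e1 : ∫ ω, D.wt γ k (D.obs ω) * D.res α k (D.obs ω) ^ 2 * D.lin b k (D.obs ω).2.2 ^ 2 ∂D.P =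
      ∫ ω, π ω * (G (D.X ω) * D.resT α k ω ^ 2) ∂D.P := by
    refine Eq.trans ?_ (CondIndepEventVar.integral_eq hm hX hA (D.measurable_Ypot D.t)
      D.unconfounded (H := fun q => G q.1 * (q.2 - D.lin α k q.1) ^ 2)
      ((hG.comp measurable_fst).mul ((measurable_snd.sub
        ((D.measurable_lin α k).comp measurable_fst)).pow_const 2))
      (fun q => mul_nonneg (hG0 _) (sq_nonneg _)))
    rw [← integral_indicator hA]
    refine integral_congr_ae (ae_of_all _ fun ω => ?_)
    simp only
    rw [wt_mul_res_sq, mul_right_comm, hwt]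
    by_cases h : ω ∈ A <;> simp [h, resT]
  have e2 : ∫ ω, D.wt γ k (D.obs ω) * D.lin b k (D.obs ω).2.2 ^ 2 ∂D.P =
      ∫ ω, π ω * G (D.X ω) ∂D.P := by
    refine Eq.trans ?_ (CondIndepEventVar.integral_eq hm hX hA (D.measurable_Ypot D.t)
      D.unconfounded (H := fun q => G q.1) (hG.comp measurable_fst) (fun q => hG0 _))
    rw [← integral_indicator hA]
    exact integral_congr_ae (ae_of_all _ hwt)
  have hindi : Integrable (A.indicator fun _ => (1 : ℝ)) D.P :=
    (integrable_const _).indicator hA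
  have hπ0 : ∀ᵐ ω ∂D.P, 0 ≤ π ω :=
    condExp_nonneg (ae_of_all _ fun ω => Set.indicator_nonneg (fun _ _ => zero_le_one) ω)
  have hπ1 : ∀ᵐ ω ∂D.P, π ω ≤ 1 := by
    have h := condExp_mono (m := MeasurableSpace.comap D.X inferInstance) hindi (integrable_const (1 : ℝ)) (ae_of_all _ fun ω =>
      Set.indicator_le_self' (fun _ _ => zero_le_one) ω)
    rw [condExp_const hm] at h
    exact h
  have hF := (hC.subgaussian k).1
  set F : D.Ω → ℝ := fun ω => Real.exp (D.resT α k ω ^ 2 / c.σ0 ^ 2) with hFdef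
  have hFi : Integrable (fun ω => F ω - 1) D.P := hF.sub (integrable_const _)
  -- With `u` the squared scaled residual, `u ≤ e^u - 1` and `E[e^u - 1 | X] ≤ 1`. Subtracting one
  -- first gives the constant `σ0²` instead of `2σ0²`.
  have hFC : ∀ᵐ ω ∂D.P, (D.P[fun ω => F ω - 1 | MeasurableSpace.comap D.X inferInstance]) ω ≤ 1 := by
    have h1 : D.P[fun ω => F ω - 1 | MeasurableSpace.comap D.X inferInstance] =ᵐ[D.P] D.P[F | MeasurableSpace.comap D.X inferInstance] - D.P[fun _ => (1 : ℝ) | MeasurableSpace.comap D.X inferInstance] :=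
      condExp_sub hF (integrable_const _) _
    rw [condExp_const hm] at h1
    filter_upwards [h1, (hC.subgaussian k).2] with ω h2 h3
    rw [h2]
    have h4 : (D.P[F | MeasurableSpace.comap D.X inferInstance]) ω ≤ 2 := h3
    simp only [Pi.sub_apply]
    linarith
  have hGb : ∀ᵐ ω ∂D.P, G (D.X ω) ≤ (c.B1 - 1) * (c.B0 * D.totalNorm b) ^ 2 := by
    filter_upwards [hC.ae_regular hc] with ω h
    have h1 : Real.exp (D.lin γ k (D.X ω)) ≤ c.B1 - 1 :=
      (Finset.single_le_sum (f := fun k : D.Other => Real.exp (D.lin γ k (D.X ω)))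
        (fun _ _ => (Real.exp_pos _).le) (Finset.mem_univ k)).trans h.2
    have h2 : D.lin b k (D.X ω) ^ 2 ≤ (c.B0 * D.totalNorm b) ^ 2 := by
      rw [← sq_abs]
      exact pow_le_pow_left₀ (abs_nonneg _) (D.abs_lin_le h.1 b k) 2
    exact mul_le_mul h1 h2 (sq_nonneg _) ((Real.exp_pos _).le.trans h1)
  have hGm : StronglyMeasurable[MeasurableSpace.comap D.X inferInstance] fun ω => π ω * G (D.X ω) :=
    stronglyMeasurable_condExp.mul (hG.comp hX).stronglyMeasurable
  obtain ⟨hi, hle⟩ := integral_mul_le_of_condExp_le hm hFi hGm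
    (hπ0.mono fun ω h => mul_nonneg h (hG0 _)) (B := (c.B1 - 1) * (c.B0 * D.totalNorm b) ^ 2)
    (by
      filter_upwards [hπ1, hGb] with ω h1 h2
      exact (mul_le_of_le_one_left (hG0 _) h1).trans h2) hFC
  rw [e1, e2]
  calc ∫ ω, π ω * (G (D.X ω) * D.resT α k ω ^ 2) ∂D.P
      ≤ ∫ ω, c.σ0 ^ 2 * (π ω * G (D.X ω) * (F ω - 1)) ∂D.P := by
        refine integral_mono_of_nonneg
          (hπ0.mono fun ω h => mul_nonneg h (mul_nonneg (hG0 _) (sq_nonneg _)))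
          (hi.const_mul _) (hπ0.mono fun ω h => ?_)
        have h1 := Real.add_one_le_exp (D.resT α k ω ^ 2 / c.σ0 ^ 2)
        have h2 : D.resT α k ω ^ 2 ≤ c.σ0 ^ 2 * (F ω - 1) := by
          calc D.resT α k ω ^ 2 = c.σ0 ^ 2 * (D.resT α k ω ^ 2 / c.σ0 ^ 2) := by
                have := hc.σ0_pos.ne'
                field_simp
            _ ≤ _ := mul_le_mul_of_nonneg_left (by simp only [F]; linarith) hσ.le
        calc π ω * (G (D.X ω) * D.resT α k ω ^ 2)
            ≤ π ω * (G (D.X ω) * (c.σ0 ^ 2 * (F ω - 1))) :=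
              mul_le_mul_of_nonneg_left (mul_le_mul_of_nonneg_left h2 (hG0 _)) h
          _ = _ := by ring
    _ = c.σ0 ^ 2 * ∫ ω, π ω * G (D.X ω) * (F ω - 1) ∂D.P := integral_const_mul _ _
    _ ≤ _ := by
      refine mul_le_mul_of_nonneg_left ?_ hσ.le
      linarith

/-! Exponential moments of the scores. -/

variable (D) in
/-- The coefficient matrix with a single nonzero row. -/
def rowCoef (j : Fin (D.p + 1)) (v : D.Other → ℝ) : D.Coef :=
  Matrix.of fun j' k => if j' = j then v k else 0

theorem lin_rowCoef (j : Fin (D.p + 1)) (v : D.Other → ℝ) (k : D.Other) (x : Fin D.d → ℝ) :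
    D.lin (D.rowCoef j v) k x = v k * D.f x j := by
  simp [lin_other, rowCoef]

theorem abs_le_sqrt_sum_sq (v : D.Other → ℝ) (k : D.Other) : |v k| ≤ Real.sqrt (∑ k, v k ^ 2) := by
  rw [← Real.sqrt_sq_eq_abs]
  exact Real.sqrt_le_sqrt
    (Finset.single_le_sum (f := fun k => v k ^ 2) (fun _ _ => sq_nonneg _) (Finset.mem_univ k))

/-- In a direction `v` the score is at most `‖v‖ B0 Σ_k (weight + R^(k)) ≤ ‖v‖ B0 B1`, and it is
centred by stationarity of the limit value, so Hoeffding's lemma applies with a proxy free of `K`.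
-/
theorem Conditions.exp_scoreCAL (hc : c.Admissible) (hC : D.Conditions c ε γ α)
    (j : Fin (D.p + 1)) (v : D.Other → ℝ) :
    ∫⁻ ω, ENNReal.ofReal (Real.exp (∑ k : D.Other, v k *
      ((D.wt γ k (D.obs ω) - D.R k (D.obs ω)) * D.f (D.obs ω).2.2 j))) ∂D.P ≤
      ENNReal.ofReal (Real.exp ((c.B0 * c.B1) ^ 2 / 2 * ∑ k, v k ^ 2)) := by
  have hB0 : 0 ≤ c.B0 := by linarith [hc.one_le_B0]
  have hB1 : 0 ≤ c.B1 := by linarith [hc.one_lt_B1]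
  have h0 := hC.integral_scoreCAL hc (D.rowCoef j v)
  simp_rw [lin_rowCoef] at h0
  have h1 := lintegral_exp_le_of_abs_le (P := D.P)
    (Z := fun ω => ∑ k : D.Other, v k *
      ((D.wt γ k (D.obs ω) - D.R k (D.obs ω)) * D.f (D.obs ω).2.2 j))
    (M := Real.sqrt (∑ k, v k ^ 2) * (c.B0 * c.B1)) (by positivity)
    ((Finset.measurable_sum Finset.univ fun (k : D.Other) _ =>
      ((((D.measurable_wt γ k).sub (D.measurable_R k)).mul (measurable_f_obs j)).const_mul
        (v k)).comp measurable_obs).aemeasurable)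
    (by
      rw [← h0]
      refine integral_congr_ae (ae_of_all _ fun ω => Finset.sum_congr rfl fun k _ => ?_)
      ring)
    (by
      filter_upwards [hC.ae_regular hc] with ω hω
      set o := D.obs ω
      calc |∑ k : D.Other, v k * ((D.wt γ k o - D.R k o) * D.f o.2.2 j)|
          ≤ ∑ k : D.Other, Real.sqrt (∑ k, v k ^ 2) * ((D.wt γ k o + D.R k o) * c.B0) := by
            refine (Finset.abs_sum_le_sum_abs _ _).trans (Finset.sum_le_sum fun k _ => ?_)
            rw [abs_mul, abs_mul]
            have e1 : |D.wt γ k o - D.R k o| ≤ D.wt γ k o + D.R k o := by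
              refine (abs_sub _ _).trans (le_of_eq ?_)
              rw [abs_of_nonneg (D.wt_nonneg _ _ _), abs_of_nonneg (D.R_nonneg _ _)]
            have e2 := hω.1 j
            have e3 := abs_le_sqrt_sum_sq v k
            have e4 := add_nonneg (D.wt_nonneg γ k o) (D.R_nonneg k o)
            gcongr
        _ = Real.sqrt (∑ k, v k ^ 2) * (c.B0 * ∑ k : D.Other, (D.wt γ k o + D.R k o)) := by
            rw [← Finset.mul_sum, ← Finset.sum_mul, mul_comm c.B0]
        _ ≤ _ := by
            refine mul_le_mul_of_nonneg_left (mul_le_mul_of_nonneg_left ?_ hB0)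
              (Real.sqrt_nonneg _)
            rw [Finset.sum_add_distrib]
            linarith [hω.wt_sum_le, sum_R_le_one (D := D) o])
  refine h1.trans (le_of_eq ?_)
  congr 2
  rw [mul_pow, Real.sq_sqrt (Finset.sum_nonneg fun _ _ => sq_nonneg _)]
  ring

instance nonempty_other : Nonempty D.Other := by
  have : 1 < Fintype.card (Fin D.K) := by rw [Fintype.card_fin]; exact D.two_le_K
  obtain ⟨k, hk⟩ := Fintype.exists_ne_of_one_lt_card this D.t
  exact ⟨⟨k, hk⟩⟩

theorem card_other : Fintype.card D.Other = D.K - 1 := by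
  simp [Other, Fintype.card_subtype_compl]

/-- A weighted average of the scaled residuals has the same sub-gaussian bound. -/
theorem Conditions.exp_average (hc : c.Admissible) (hC : D.Conditions c ε γ α) :
    let V : D.Ω → ℝ := fun ω => (∑ k : D.Other, Real.exp (D.lin γ k (D.X ω)) *
      |D.resT α k ω|) / ((∑ k : D.Other, Real.exp (D.lin γ k (D.X ω))) * c.σ0)
    Integrable (fun ω => Real.exp (V ω ^ 2)) D.P ∧ ∫ ω, Real.exp (V ω ^ 2) ∂D.P ≤ 2 := by
  intro V
  have hσ := hc.σ0_pos
  set e : D.Other → (Fin D.d → ℝ) → ℝ := fun k x => Real.exp (D.lin γ k x) with he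
  have hem : ∀ k, Measurable (e k) := fun k => Real.measurable_exp.comp (D.measurable_lin γ k)
  have hS : ∀ x, 0 < ∑ k, e k x := fun x =>
    Finset.sum_pos (fun _ _ => Real.exp_pos _) Finset.univ_nonempty
  set w : D.Other → D.Ω → ℝ := fun k ω => e k (D.X ω) / ∑ k, e k (D.X ω) with hw
  have hw0 : ∀ k ω, 0 ≤ w k ω := fun k ω => div_nonneg (Real.exp_pos _).le (hS _).le
  have hw1 : ∀ ω, ∑ k, w k ω = 1 := fun ω => by
    simp only [w]
    rw [← Finset.sum_div, div_self (hS _).ne']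
  set F : D.Other → D.Ω → ℝ := fun k ω => Real.exp (D.resT α k ω ^ 2 / c.σ0 ^ 2) with hFdef
  -- Jensen twice, for the square and for the exponential. The weights depend on `X` only and sum to
  -- one, so the conditional bound 2 survives the averaging.
  have hle : ∀ ω, Real.exp (V ω ^ 2) ≤ ∑ k, w k ω * F k ω := fun ω => by
    have h1 := (even_two.convexOn_pow (𝕜 := ℝ)).map_sum_le (t := Finset.univ)
      (w := fun k => w k ω) (p := fun k => |D.resT α k ω| / c.σ0) (fun k _ => hw0 k ω) (hw1 ω)
      (fun _ _ => Set.mem_univ _)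
    have h2 := convexOn_exp.map_sum_le (t := Finset.univ)
      (w := fun k => w k ω) (p := fun k => D.resT α k ω ^ 2 / c.σ0 ^ 2) (fun k _ => hw0 k ω)
      (hw1 ω) (fun _ _ => Set.mem_univ _)
    simp only [smul_eq_mul, div_pow, sq_abs] at h1 h2
    refine (Real.exp_le_exp.2 ?_).trans h2
    refine le_trans (le_of_eq ?_) h1
    congr 1
    simp only [V, w]
    rw [Finset.sum_div]
    refine Finset.sum_congr rfl fun k _ => ?_
    have := (hS (D.X ω)).ne'
    simp only [he] at this ⊢
    field_simp
  have hm : MeasurableSpace.comap D.X inferInstance ≤ D.mΩ := D.measurable_X.comap_le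
  have hwm : ∀ k, StronglyMeasurable[MeasurableSpace.comap D.X inferInstance] (w k) := fun k =>
    (((hem k).div (Finset.measurable_sum _ fun k _ => hem k)).comp
      (comap_measurable D.X)).stronglyMeasurable
  have hwle : ∀ k ω, w k ω ≤ 1 := fun k ω => by
    rw [← hw1 ω]
    exact Finset.single_le_sum (f := fun k => w k ω) (fun k _ => hw0 k ω) (Finset.mem_univ k)
  have hk : ∀ k, Integrable (fun ω => w k ω * F k ω) D.P ∧
      ∫ ω, w k ω * F k ω ∂D.P ≤ 2 * ∫ ω, w k ω ∂D.P := fun k => integral_mul_le_of_condExp_le hm (hC.subgaussian k).1 (hwm k)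
    (ae_of_all _ (hw0 k)) (ae_of_all _ (hwle k)) (hC.subgaussian k).2
  have hsum : Integrable (fun ω => ∑ k, w k ω * F k ω) D.P :=
    integrable_finsetSum _ fun k _ => (hk k).1
  have hVm : Measurable V := by
    refine Measurable.div (Finset.measurable_sum _ fun k _ => ?_)
      ((Finset.measurable_sum _ fun k _ => (hem k).comp D.measurable_X).mul_const _)
    exact ((hem k).comp D.measurable_X).mul (measurable_resT α k).abs
  have hVi : Integrable (fun ω => Real.exp (V ω ^ 2)) D.P := by
    refine hsum.mono' (Real.measurable_exp.comp (hVm.pow_const 2)).aestronglyMeasurable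
      (ae_of_all _ fun ω => ?_)
    rw [Real.norm_of_nonneg (Real.exp_pos _).le]
    exact hle ω
  refine ⟨hVi, (integral_mono hVi hsum hle).trans ?_⟩
  rw [integral_finsetSum _ fun k _ => (hk k).1]
  refine (Finset.sum_le_sum fun k _ => (hk k).2).trans (le_of_eq ?_)
  have hwi : ∀ k ∈ Finset.univ, Integrable (w k) D.P := fun k _ =>
    Integrable.of_bound ((hwm k).mono hm).aestronglyMeasurable 1 (ae_of_all _ fun ω => by
      rw [Real.norm_of_nonneg (hw0 k ω)]; exact hwle k ω)
  rw [← Finset.mul_sum, ← integral_finsetSum _ hwi]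
  simp [hw1]

/-- The residuals for different `k` share one outcome, so they are not treated separately: the score
in direction `v` is at most `‖v‖ B0 (B1 - 1) σ0` times the single averaged variable of
`exp_average`, and `lintegral_exp_le_of_sq_exp` applies. The factor 32/25 is twice 16/25. -/
theorem Conditions.exp_scoreWL (hc : c.Admissible) (hC : D.Conditions c ε γ α)
    (j : Fin (D.p + 1)) (v : D.Other → ℝ) :
    ∫⁻ ω, ENNReal.ofReal (Real.exp (∑ k : D.Other, v k *
      (D.wt γ k (D.obs ω) * D.res α k (D.obs ω) * D.f (D.obs ω).2.2 j))) ∂D.P ≤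
      ENNReal.ofReal (Real.exp (32 / 25 * (c.B0 * (c.B1 - 1) * c.σ0) ^ 2 / 2 *
        ∑ k, v k ^ 2)) := by
  have hB0 : 0 ≤ c.B0 := by linarith [hc.one_le_B0]
  have hB1 : 0 ≤ c.B1 - 1 := by linarith [hc.one_lt_B1]
  have hσ := hc.σ0_pos
  have h0 := hC.integral_scoreWL hc (D.rowCoef j v)
  simp_rw [lin_rowCoef] at h0
  obtain ⟨hV1, hV2⟩ := hC.exp_average hc
  set Z : D.Ω → ℝ := fun ω => ∑ k : D.Other, v k *
      (D.wt γ k (D.obs ω) * D.res α k (D.obs ω) * D.f (D.obs ω).2.2 j) with hZ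
  have hZm : Measurable Z := Finset.measurable_sum Finset.univ fun (k : D.Other) _ =>
    ((((D.measurable_wt γ k).mul (D.measurable_res α k)).mul (measurable_f_obs j)).const_mul
      (v k)).comp measurable_obs
  set s := Real.sqrt (∑ k, v k ^ 2) with hs
  have hZb : ∀ ω, D.Regular c γ (D.obs ω) → |Z ω| ≤
      s * (c.B0 * ∑ k : D.Other, Real.exp (D.lin γ k (D.X ω)) * |D.resT α k ω|) := fun ω hω => by
    rw [Finset.mul_sum, Finset.mul_sum]
    refine (Finset.abs_sum_le_sum_abs _ _).trans (Finset.sum_le_sum fun k _ => ?_)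
    rw [wt_mul_res, abs_mul, abs_mul, abs_mul, abs_of_nonneg (D.wt_nonneg _ _ _)]
    have e1 : D.wt γ k (D.obs ω) ≤ Real.exp (D.lin γ k (D.X ω)) :=
      mul_le_of_le_one_left (Real.exp_pos _).le (D.R_le_one _ _)
    have e2 := hω.1 j
    have e3 := abs_le_sqrt_sum_sq v k
    have e4 := D.wt_nonneg γ k (D.obs ω)
    calc _ ≤ s * (Real.exp (D.lin γ k (D.X ω)) * |D.resT α k ω| * c.B0) := by gcongr
      _ = _ := by ring
  have h1 := lintegral_exp_le_of_sq_exp (P := D.P) (Z := Z)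
    (q := s * (c.B0 * (c.B1 - 1) * c.σ0))
    (by
      refine ((integrable_finsetSum Finset.univ fun (k : D.Other) _ =>
        (integrable_const (1 : ℝ)).add (hC.integrable_resT_sq hc k)).const_mul
        (s * (c.B0 * (c.B1 - 1)))).mono' hZm.aestronglyMeasurable ?_
      filter_upwards [hC.ae_regular hc] with ω hω
      refine (hZb ω hω).trans ?_
      rw [mul_assoc s, mul_assoc c.B0]
      refine mul_le_mul_of_nonneg_left (mul_le_mul_of_nonneg_left ?_ hB0) (Real.sqrt_nonneg _)
      rw [Finset.mul_sum]
      refine Finset.sum_le_sum fun k _ => ?_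
      have e1 : Real.exp (D.lin γ k (D.X ω)) ≤ c.B1 - 1 :=
        (Finset.single_le_sum (f := fun k : D.Other => Real.exp (D.lin γ k (D.X ω)))
          (fun _ _ => (Real.exp_pos _).le) (Finset.mem_univ k)).trans hω.2
      exact mul_le_mul e1 (abs_le_one_add_sq _) (abs_nonneg _) hB1)
    (by
      rw [← h0]
      refine integral_congr_ae (ae_of_all _ fun ω => Finset.sum_congr rfl fun k _ => ?_)
      ring) hV1 hV2
    (by
      filter_upwards [hC.ae_regular hc] with ω hω
      refine (hZb ω hω).trans ?_
      have hS : 0 < ∑ k : D.Other, Real.exp (D.lin γ k (D.X ω)) :=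
        Finset.sum_pos (fun _ _ => Real.exp_pos _) Finset.univ_nonempty
      have hle : ∑ k : D.Other, Real.exp (D.lin γ k (D.X ω)) ≤ c.B1 - 1 := hω.2
      set S := ∑ k : D.Other, Real.exp (D.lin γ k (D.X ω))
      set W := ∑ k : D.Other, Real.exp (D.lin γ k (D.X ω)) * |D.resT α k ω|
      have hW : 0 ≤ W := Finset.sum_nonneg fun k _ =>
        mul_nonneg (Real.exp_pos _).le (abs_nonneg _)
      calc s * (c.B0 * W) = s * (c.B0 * S * c.σ0) * (W / (S * c.σ0)) := by field_simp
        _ ≤ _ := by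
          have : 0 ≤ W / (S * c.σ0) := by positivity
          have hs0 : 0 ≤ s := Real.sqrt_nonneg _
          gcongr)
  refine h1.trans (le_of_eq ?_)
  congr 2
  rw [mul_pow, hs, Real.sq_sqrt (Finset.sum_nonneg fun _ _ => sq_nonneg _)]
  ring

end Study

end

/-! ### Tail bounds and the probability of a typical sample. -/

noncomputable section

namespace Study

variable {D : Study.{u}} {c : Constants} {ε : ℝ} {γ α : D.Coef}

theorem one_le_K_sub_one : (1 : ℝ) ≤ (D.K : ℝ) - 1 := by
  have : (2 : ℝ) ≤ D.K := by exact_mod_cast D.two_le_K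
  linarith

theorem card_other_cast : (Fintype.card D.Other : ℝ) = (D.K : ℝ) - 1 := by
  rw [card_other, Nat.cast_sub (by have := D.two_le_K; omega)]; simp

theorem log_nonneg (h0 : 0 < ε) (h1 : ε < 1) : 0 ≤ Real.log (((D.p : ℝ) + 1) / ε) := by
  apply Real.log_nonneg
  rw [le_div_iff₀ h0]
  have : (0 : ℝ) ≤ D.p := Nat.cast_nonneg _
  linarith

theorem n_mul_rate_sq (h0 : 0 < ε) (h1 : ε < 1) :
    D.n * D.rate ε ^ 2 = ((D.K : ℝ) - 1) + Real.log (((D.p : ℝ) + 1) / ε) := by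
  have hn := natCast_n_pos (D := D)
  have h2 := log_nonneg (D := D) h0 h1
  have h3 := one_le_K_sub_one (D := D)
  have h4 : 0 ≤ (D.K : ℝ) - 1 := by linarith
  unfold rate
  rw [Real.sq_sqrt (by positivity)]
  field_simp

theorem rate_pos (h0 : 0 < ε) (h1 : ε < 1) : 0 < D.rate ε := by
  have h := n_mul_rate_sq (D := D) h0 h1
  have h2 := log_nonneg (D := D) h0 h1
  have h3 := one_le_K_sub_one (D := D)
  refine D.rate_nonneg.lt_of_ne fun h4 => ?_
  rw [← h4] at h
  simp at h
  linarith

theorem Conditions.rate_le_one (hC : D.Conditions c ε γ α) : D.rate ε ≤ 1 := by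
  unfold rate
  rw [← add_div]
  exact Real.sqrt_le_one.2 hC.sample_size

theorem exp_neg_rate (h0 : 0 < ε) (h1 : ε < 1) :
    Real.exp (-(D.n * D.rate ε ^ 2)) =
      Real.exp (-((D.K : ℝ) - 1)) * (ε / ((D.p : ℝ) + 1)) := by
  have hp : (0 : ℝ) < (D.p : ℝ) + 1 := by positivity
  rw [n_mul_rate_sq h0 h1, neg_add, Real.exp_add, Real.exp_neg (Real.log _),
    Real.exp_log (by positivity), inv_div]

/-- The linearization costs at most a factor `e` per coordinate, hence `e^{K-1}`, which the summand
`K - 1` in `n r²` cancels exactly. What remains suits a union over `p + 1` rows. -/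
theorem score_tail_le (h0 : 0 < ε) (h1 : ε < 1) {θ x : ℝ} (hθ : (Real.sqrt (1 - θ))⁻¹ ≤ Real.exp 1)
    (hx : D.n * D.rate ε ^ 2 ≤ x) :
    (Real.sqrt (1 - θ))⁻¹ ^ Fintype.card D.Other * Real.exp (-x) ≤ ε / ((D.p : ℝ) + 1) := by
  have e1 : (Real.sqrt (1 - θ))⁻¹ ^ Fintype.card D.Other ≤ Real.exp ((D.K : ℝ) - 1) := by
    refine (pow_le_pow_left₀ (by positivity) hθ _).trans (le_of_eq ?_)
    rw [← Real.exp_nat_mul, card_other_cast, mul_one]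
  have e2 : Real.exp (-x) ≤ Real.exp (-((D.K : ℝ) - 1)) * (ε / ((D.p : ℝ) + 1)) := by
    rw [← exp_neg_rate h0 h1]
    exact Real.exp_le_exp.2 (neg_le_neg hx)
  calc _ ≤ Real.exp ((D.K : ℝ) - 1) * (Real.exp (-((D.K : ℝ) - 1)) * (ε / ((D.p : ℝ) + 1))) := by
        gcongr
    _ = _ := by rw [← mul_assoc, ← Real.exp_add]; simp

/-- The fourth power of `e^{-(K-1)} ε/(p+1)` pays for the factor 2 and for a union over
`(K-1)(p+1)²` matrix entries. -/
theorem entry_tail_le (h0 : 0 < ε) (h1 : ε < 1) :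
    2 * Real.exp (-(4 * (D.n * D.rate ε ^ 2))) ≤
      ε / (((D.K : ℝ) - 1) * ((D.p : ℝ) + 1) ^ 2) := by
  have hp : (1 : ℝ) ≤ (D.p : ℝ) + 1 := by simp
  have hN := one_le_K_sub_one (D := D)
  set N := (D.K : ℝ) - 1
  set q := (D.p : ℝ) + 1
  have hN0 : 0 < N := by linarith
  have hq0 : 0 < q := by linarith
  rw [le_div_iff₀ (by positivity),
    show -(4 * (D.n * D.rate ε ^ 2)) = ((4 : ℕ) : ℝ) * -(D.n * D.rate ε ^ 2) by push_cast; ring,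
    Real.exp_nat_mul, exp_neg_rate h0 h1, mul_pow, ← Real.exp_nat_mul]
  have e1 : 2 * N * Real.exp ((4 : ℕ) * -N) ≤ 1 := by
    have h2 := Real.add_one_le_exp (4 * N)
    have h3 : Real.exp (4 * N) * Real.exp ((4 : ℕ) * -N) = 1 := by
      rw [← Real.exp_add]; push_cast; simp
    rw [← h3]
    exact mul_le_mul_of_nonneg_right (by linarith) (Real.exp_pos _).le
  have e2 : (ε / q) ^ 4 * q ^ 2 ≤ ε := by
    have h2 : (ε / q) ^ 4 * q ^ 2 = ε * (ε ^ 3 * (1 / q) ^ 2) := by field_simp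
    have h3 : ε ^ 3 ≤ 1 := pow_le_one₀ h0.le h1.le
    have h4 : (1 / q) ^ 2 ≤ 1 := pow_le_one₀ (by positivity) (by rw [div_le_one hq0]; exact hp)
    rw [h2]
    exact mul_le_of_le_one_right h0.le (mul_le_one₀ h3 (by positivity) h4)
  calc 2 * (Real.exp ((4 : ℕ) * -N) * (ε / q) ^ 4) * (N * q ^ 2)
      = (2 * N * Real.exp ((4 : ℕ) * -N)) * ((ε / q) ^ 4 * q ^ 2) := by ring
    _ ≤ 1 * ε := by gcongr
    _ = ε := one_mul ε

theorem lam1_sq : D.lam1 c ε ^ 2 = 32 * c.B0 ^ 4 * c.B1 ^ 2 * D.rate ε ^ 2 := by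
  unfold lam1
  have := Real.sq_sqrt (show (0 : ℝ) ≤ 2 by norm_num)
  calc _ = 16 * Real.sqrt 2 ^ 2 * c.B0 ^ 4 * c.B1 ^ 2 * D.rate ε ^ 2 := by ring
    _ = _ := by rw [this]; ring

theorem Conditions.measure_scoreCAL (hc : c.Admissible) (hC : D.Conditions c ε γ α)
    (j : Fin (D.p + 1)) :
    D.P {ω | D.lam1 c ε ^ 2 ≤ ∑ k : D.Other,
      D.sampleMean (fun o => (D.wt γ k o - D.R k o) * D.f o.2.2 j) ω ^ 2} ≤
      ENNReal.ofReal (ε / ((D.p : ℝ) + 1)) := by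
  have hB0 := hc.one_le_B0
  have hB1 := hc.one_lt_B1
  refine measure_sum_sq_ge_le D.measurable_sample D.indep_sample D.law_sample D.n_pos
    (ψ := fun o (k : D.Other) => (D.wt γ k o - D.R k o) * D.f o.2.2 j)
    (measurable_pi_lambda _ fun k =>
      ((D.measurable_wt γ k).sub (D.measurable_R k)).mul (measurable_f_obs j))
    -- `θ = 1/2` costs `√2 ≤ e` per coordinate, and with the value of `λ̃_1` the exponent is `8 B0²
    -- n r²`, more than enough.
    (L := (c.B0 * c.B1) ^ 2) (θ := 1 / 2) (by positivity) (by norm_num) (by norm_num)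
    (fun v => hC.exp_scoreCAL hc j v) (score_tail_le hC.ε_pos hC.ε_lt ?_ ?_)
  · rw [inv_le_comm₀ (by norm_num) (Real.exp_pos _), ← Real.exp_neg]
    apply Real.le_sqrt_of_sq_le
    have h2 := Real.exp_neg_one_lt_d9
    nlinarith [Real.exp_pos (-1)]
  · rw [lam1_sq]
    have e : 1 / 2 * (D.n : ℝ) * (32 * c.B0 ^ 4 * c.B1 ^ 2 * D.rate ε ^ 2) /
        (2 * (c.B0 * c.B1) ^ 2) = 8 * c.B0 ^ 2 * (D.n * D.rate ε ^ 2) := by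
      field_simp; ring
    rw [e]
    refine le_mul_of_one_le_left (by positivity) ?_
    have := one_le_pow₀ hB0 (n := 2)
    linarith

theorem Conditions.measure_scoreWL (hc : c.Admissible) (hC : D.Conditions c ε γ α)
    (j : Fin (D.p + 1)) :
    D.P {ω | D.lam2 c ε ^ 2 ≤ ∑ k : D.Other,
      D.sampleMean (fun o => D.wt γ k o * D.res α k o * D.f o.2.2 j) ω ^ 2} ≤
      ENNReal.ofReal (ε / ((D.p : ℝ) + 1)) := by
  have hB0 := hc.one_le_B0
  have hB1 : 0 < c.B1 - 1 := by linarith [hc.one_lt_B1]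
  have hσ := hc.σ0_pos
  refine measure_sum_sq_ge_le D.measurable_sample D.indep_sample D.law_sample D.n_pos
    (ψ := fun o (k : D.Other) => D.wt γ k o * D.res α k o * D.f o.2.2 j)
    (measurable_pi_lambda _ fun k =>
      ((D.measurable_wt γ k).mul (D.measurable_res α k)).mul (measurable_f_obs j))
    -- The constant `√3` in `λ̃_2` makes the exponent `θ (75/64) n r²`, so `θ = 64/75` yields
    -- exactly `n r²`; its cost per coordinate is `√(75/11) < e`.
    (L := 32 / 25 * (c.B0 * (c.B1 - 1) * c.σ0) ^ 2) (θ := 64 / 75) (by positivity)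
    (by norm_num) (by norm_num)
    (fun v => hC.exp_scoreWL hc j v) (score_tail_le hC.ε_pos hC.ε_lt ?_ ?_)
  · rw [inv_le_comm₀ (by norm_num) (Real.exp_pos _), ← Real.exp_neg]
    apply Real.le_sqrt_of_sq_le
    have h2 := Real.exp_neg_one_lt_d9
    nlinarith [Real.exp_pos (-1)]
  · have e1 : (Real.sqrt 3 * c.B0 * (c.B1 - 1) * c.σ0 * D.rate ε) ^ 2 ≤ D.lam2 c ε ^ 2 := by
      have := D.rate_nonneg (ε := ε)
      exact pow_le_pow_left₀ (by positivity) (le_max_right _ _) 2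
    have e2 : (Real.sqrt 3 * c.B0 * (c.B1 - 1) * c.σ0 * D.rate ε) ^ 2 =
        3 * (c.B0 * (c.B1 - 1) * c.σ0) ^ 2 * D.rate ε ^ 2 := by
      have := Real.sq_sqrt (show (0 : ℝ) ≤ 3 by norm_num)
      calc _ = Real.sqrt 3 ^ 2 * (c.B0 * (c.B1 - 1) * c.σ0) ^ 2 * D.rate ε ^ 2 := by ring
        _ = _ := by rw [this]
    rw [e2] at e1
    set L := c.B0 * (c.B1 - 1) * c.σ0
    have hL : 0 < L := by positivity
    rw [le_div_iff₀ (by positivity)]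
    have hn := natCast_n_pos (D := D)
    calc (D.n : ℝ) * D.rate ε ^ 2 * (2 * (32 / 25 * L ^ 2)) =
          64 / 75 * D.n * (3 * L ^ 2 * D.rate ε ^ 2) := by ring
      _ ≤ _ := by gcongr

theorem Conditions.measure_gram (hc : c.Admissible) (hC : D.Conditions c ε γ α)
    (k : D.Other) (j1 j2 : Fin (D.p + 1)) :
    D.P {ω | D.lam1 c ε / 2 ≤
      |D.sampleMean (fun o => D.wt γ k o * (D.f o.2.2 j1 * D.f o.2.2 j2)) ω - D.gram γ k j1 j2|} ≤
      ENNReal.ofReal (ε / (((D.K : ℝ) - 1) * ((D.p : ℝ) + 1) ^ 2)) := by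
  have hB0 := hc.one_le_B0
  have hB1 := hc.one_lt_B1
  have hlam := D.lam1_nonneg (ε := ε) hc
  set a := c.B0 ^ 2 * c.B1 with ha
  have ha0 : 0 < a := by positivity
  have hsub := hasSubgaussianMGF_of_mem_Icc (μ := D.P) (a := -a) (b := a)
    ((measurable_gramEntry γ k j1 j2).comp measurable_obs).aemeasurable
    (by
      filter_upwards [hC.ae_regular hc] with ω hω
      refine abs_le.1 ((hω.abs_gram_le k j1 j2).trans ?_)
      rw [ha]
      have : 0 ≤ c.B0 ^ 2 := sq_nonneg _
      nlinarith)
  have key : ∀ s : ℝ, ∫⁻ ω, ENNReal.ofReal (Real.exp (s * (D.wt γ k (D.obs ω) *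
      (D.f (D.obs ω).2.2 j1 * D.f (D.obs ω).2.2 j2) - D.gram γ k j1 j2))) ∂D.P ≤
      ENNReal.ofReal (Real.exp (a ^ 2 * s ^ 2 / 2)) := fun s => by
    have h1 := hsub.integrable_exp_mul s
    have h2 := hsub.mgf_le s
    simp only [mgf, Function.comp_apply] at h1 h2
    rw [gram_eq, ← ofReal_integral_eq_lintegral_ofReal h1 (ae_of_all _ fun _ => (Real.exp_pos _).le)]
    refine ENNReal.ofReal_le_ofReal (h2.trans (Real.exp_le_exp.2 (le_of_eq ?_)))
    rw [show a - -a = 2 * a by ring]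
    simp [abs_of_pos ha0]
  -- The choice `s = δ/a²` minimizes `a² s²/2 - s δ`; at `δ = λ̃_1/2` the minimum is `-4r²`.
  refine measure_abs_mean_sub_ge_le D.measurable_sample D.indep_sample D.law_sample D.n_pos
    (measurable_gramEntry γ k j1 j2) (s := D.lam1 c ε / 2 / a ^ 2) (by positivity)
    (key _) ((key _).trans (le_of_eq (by rw [neg_sq]))) ?_
  refine le_trans (le_of_eq ?_) (entry_tail_le hC.ε_pos hC.ε_lt)
  congr 2
  have e : a ^ 2 * (D.lam1 c ε / 2 / a ^ 2) ^ 2 / 2 - D.lam1 c ε / 2 / a ^ 2 * (D.lam1 c ε / 2) =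
      -(D.lam1 c ε ^ 2 / (8 * a ^ 2)) := by field_simp; ring
  rw [e, lam1_sq, ha]
  field_simp
  ring

theorem Conditions.measure_resid (hc : c.Admissible) (hC : D.Conditions c ε γ α)
    (k : D.Other) (j1 j2 : Fin (D.p + 1)) :
    D.P {ω | 16 * c.residScale * D.rate ε ≤
      |D.sampleMean (fun o => D.wt γ k o * D.res α k o ^ 2 * (D.f o.2.2 j1 * D.f o.2.2 j2)) ω -
        D.residGram γ α k j1 j2|} ≤
      ENNReal.ofReal (ε / (((D.K : ℝ) - 1) * ((D.p : ℝ) + 1) ^ 2)) := by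
  have hσ := hc.σ0_pos
  have hr0 := D.rate_nonneg (ε := ε)
  have hr1 := hC.rate_le_one
  have ha0 := hc.residScale_pos
  set a := c.residScale with ha
  set r := D.rate ε
  set U : D.Ω → ℝ := fun ω => D.wt γ k (D.obs ω) * D.res α k (D.obs ω) ^ 2 *
    (D.f (D.obs ω).2.2 j1 * D.f (D.obs ω).2.2 j2) / a with hU
  have hUi : Integrable U D.P := (hC.integrable_residEntry hc k j1 j2).div_const a
  have hUb : ∀ᵐ ω ∂D.P, |U ω| ≤ D.resT α k ω ^ 2 / c.σ0 ^ 2 := by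
    filter_upwards [hC.ae_regular hc] with ω hω
    rw [hU, abs_div, abs_of_pos ha0, div_le_iff₀ ha0]
    refine (hω.abs_residGram_le k j1 j2).trans (le_of_eq ?_)
    rw [ha, Constants.residScale]
    field_simp
  have key : ∀ s : ℝ, |s| ≤ 1 / 2 → ∫⁻ ω, ENNReal.ofReal (Real.exp (s / a *
      (D.wt γ k (D.obs ω) * D.res α k (D.obs ω) ^ 2 *
      (D.f (D.obs ω).2.2 j1 * D.f (D.obs ω).2.2 j2) - D.residGram γ α k j1 j2))) ∂D.P ≤
      ENNReal.ofReal (Real.exp (16 * s ^ 2)) := fun s hs => by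
    have h := lintegral_exp_le_of_abs_le_exp hUi
      (ae_of_all _ fun ω => div_nonneg (sq_nonneg _) (sq_nonneg _))
      (hC.exp_resT k).1 (hC.exp_resT k).2 hs hUb
    have e : ∫ ω, U ω ∂D.P = D.residGram γ α k j1 j2 / a := integral_div _ _
    rw [e] at h
    refine le_trans (le_of_eq ?_) h
    refine lintegral_congr fun ω => ?_
    congr 2
    simp only [hU]
    field_simp
  have hr2 : |r / 2| ≤ 1 / 2 := by rw [abs_of_nonneg (by positivity)]; linarith
  -- In units of `1/a`, `s = r/2` minimizes `16 s² - 16 r s`, with value `-4r²`. The sub-exponential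
  -- bound requires `|s| ≤ 1/2`, which is where `r ≤ 1` enters.
  refine measure_abs_mean_sub_ge_le D.measurable_sample D.indep_sample D.law_sample D.n_pos
    (measurable_residEntry γ α k j1 j2) (s := r / 2 / a) (by positivity)
    (key _ hr2) ?_ ?_ (c := 16 * (r / 2) ^ 2)
  · have := key (-(r / 2)) (by rwa [abs_neg])
    rw [neg_sq, neg_div] at this
    exact this
  · refine le_trans (le_of_eq ?_) (entry_tail_le hC.ε_pos hC.ε_lt)
    congr 2
    field_simp
    ring

theorem measurableSet_regular : MeasurableSet {o : Obs D.K D.d | D.Regular c γ o} := by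
  have e : {o : Obs D.K D.d | D.Regular c γ o} = (⋂ j, {o | |D.f o.2.2 j| ≤ c.B0}) ∩
      {o | ∑ k : D.Other, Real.exp (D.lin γ k o.2.2) ≤ c.B1 - 1} := by
    ext o; simp [Regular]
  rw [e]
  refine (MeasurableSet.iInter fun j => measurableSet_le (measurable_f_obs j).abs
    measurable_const).inter (measurableSet_le ?_ measurable_const)
  exact Finset.measurable_sum _ fun k _ => Real.measurable_exp.comp (measurable_lin_obs γ k)

theorem ofReal_card_mul {ι : Type*} [Fintype ι] {x y : ℝ} (h : Fintype.card ι * x = y) :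
    ∑ _i : ι, ENNReal.ofReal x = ENNReal.ofReal y := by
  rw [Finset.sum_const, Finset.card_univ, nsmul_eq_mul, ← h,
    ENNReal.ofReal_mul (Nat.cast_nonneg _), ENNReal.ofReal_natCast]

/-- Typical samples have high probability. -/
theorem Conditions.exists_goodSample (hc : c.Admissible) (hC : D.Conditions c ε γ α) :
    ∃ E : Set D.Ω, MeasurableSet E ∧ ENNReal.ofReal (1 - 8 * ε) ≤ D.P E ∧
      ∀ ω ∈ E, D.GoodSample c ε γ α ω := by
  set S1 : Fin (D.p + 1) → Set D.Ω := fun j => {ω | D.lam1 c ε ^ 2 ≤ ∑ k : D.Other,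
      D.sampleMean (fun o => (D.wt γ k o - D.R k o) * D.f o.2.2 j) ω ^ 2} with hS1
  set S2 : Fin (D.p + 1) → Set D.Ω := fun j => {ω | D.lam2 c ε ^ 2 ≤ ∑ k : D.Other,
      D.sampleMean (fun o => D.wt γ k o * D.res α k o * D.f o.2.2 j) ω ^ 2} with hS2
  set S3 : D.Other × Fin (D.p + 1) × Fin (D.p + 1) → Set D.Ω := fun q => {ω | D.lam1 c ε / 2 ≤
      |D.sampleMean (fun o => D.wt γ q.1 o * (D.f o.2.2 q.2.1 * D.f o.2.2 q.2.2)) ω -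
        D.gram γ q.1 q.2.1 q.2.2|} with hS3
  set S4 : D.Other × Fin (D.p + 1) × Fin (D.p + 1) → Set D.Ω := fun q =>
    {ω | 16 * c.residScale * D.rate ε ≤
      |D.sampleMean (fun o => D.wt γ q.1 o * D.res α q.1 o ^ 2 *
        (D.f o.2.2 q.2.1 * D.f o.2.2 q.2.2)) ω - D.residGram γ α q.1 q.2.1 q.2.2|} with hS4
  set S5 : Fin D.n → Set D.Ω := fun i => {ω | ¬ D.Regular c γ (D.sample i ω)} with hS5
  have m1 : ∀ j, MeasurableSet (S1 j) := fun j => measurableSet_le measurable_const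
    (Finset.measurable_sum _ fun k _ => (measurable_sampleMean
      (((D.measurable_wt γ k).sub (D.measurable_R k)).mul (measurable_f_obs j))).pow_const 2)
  have m2 : ∀ j, MeasurableSet (S2 j) := fun j => measurableSet_le measurable_const
    (Finset.measurable_sum _ fun k _ => (measurable_sampleMean
      (((D.measurable_wt γ k).mul (D.measurable_res α k)).mul (measurable_f_obs j))).pow_const 2)
  have m3 : ∀ q, MeasurableSet (S3 q) := fun q => measurableSet_le measurable_const
    ((measurable_sampleMean (measurable_gramEntry γ q.1 q.2.1 q.2.2)).sub_const _).abs
  have m4 : ∀ q, MeasurableSet (S4 q) := fun q => measurableSet_le measurable_const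
    ((measurable_sampleMean (measurable_residEntry γ α q.1 q.2.1 q.2.2)).sub_const _).abs
  have m5 : ∀ i, MeasurableSet (S5 i) := fun i =>
    (D.measurable_sample i measurableSet_regular).compl
  set B : Set D.Ω := (⋃ j, S1 j) ∪ (⋃ j, S2 j) ∪ (⋃ q, S3 q) ∪ (⋃ q, S4 q) ∪ (⋃ i, S5 i) with hB
  have mB : MeasurableSet B :=
    ((((MeasurableSet.iUnion m1).union (MeasurableSet.iUnion m2)).union
      (MeasurableSet.iUnion m3)).union (MeasurableSet.iUnion m4)).union (MeasurableSet.iUnion m5)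
  have hε := hC.ε_pos
  have hp : (0 : ℝ) < (D.p : ℝ) + 1 := by positivity
  have hN : (0 : ℝ) < (D.K : ℝ) - 1 := by linarith [one_le_K_sub_one (D := D)]
  have hcard1 : (Fintype.card (Fin (D.p + 1)) : ℝ) * (ε / ((D.p : ℝ) + 1)) = ε := by
    rw [Fintype.card_fin]; push_cast; field_simp
  have hcard2 : (Fintype.card (D.Other × Fin (D.p + 1) × Fin (D.p + 1)) : ℝ) *
      (ε / (((D.K : ℝ) - 1) * ((D.p : ℝ) + 1) ^ 2)) = ε := by
    rw [Fintype.card_prod, Fintype.card_prod, Fintype.card_fin, Nat.cast_mul, card_other_cast]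
    push_cast; field_simp
  have p1 : D.P (⋃ j, S1 j) ≤ ENNReal.ofReal ε := by
    rw [← ofReal_card_mul hcard1]
    exact (measure_iUnion_fintype_le _ _).trans
      (Finset.sum_le_sum fun j _ => hC.measure_scoreCAL hc j)
  have p2 : D.P (⋃ j, S2 j) ≤ ENNReal.ofReal ε := by
    rw [← ofReal_card_mul hcard1]
    exact (measure_iUnion_fintype_le _ _).trans
      (Finset.sum_le_sum fun j _ => hC.measure_scoreWL hc j)
  have p3 : D.P (⋃ q, S3 q) ≤ ENNReal.ofReal ε := by
    rw [← ofReal_card_mul hcard2]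
    exact (measure_iUnion_fintype_le _ _).trans
      (Finset.sum_le_sum fun q _ => hC.measure_gram hc q.1 q.2.1 q.2.2)
  have p4 : D.P (⋃ q, S4 q) ≤ ENNReal.ofReal ε := by
    rw [← ofReal_card_mul hcard2]
    exact (measure_iUnion_fintype_le _ _).trans
      (Finset.sum_le_sum fun q _ => hC.measure_resid hc q.1 q.2.1 q.2.2)
  have p5 : D.P (⋃ i, S5 i) = 0 := by
    refine measure_iUnion_null fun i => ?_
    have h1 : D.P (D.sample i ⁻¹' {o | D.Regular c γ o}ᶜ) =
        D.P (D.obs ⁻¹' {o | D.Regular c γ o}ᶜ) :=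
      (D.law_sample i).measure_mem_eq measurableSet_regular.compl
    exact h1.trans (hC.ae_regular hc)
  -- Each of the four concentration families fails with probability at most `ε` and irregular
  -- observations form a null event, so the total is `4ε`, below the allowed `8ε`.
  have pB : D.P B ≤ ENNReal.ofReal (8 * ε) := by
    calc D.P B ≤ ENNReal.ofReal ε + ENNReal.ofReal ε + ENNReal.ofReal ε + ENNReal.ofReal ε + 0 := by
          refine (measure_union_le _ _).trans (add_le_add ?_ p5.le)
          refine (measure_union_le _ _).trans (add_le_add ?_ p4)
          refine (measure_union_le _ _).trans (add_le_add ?_ p3)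
          exact (measure_union_le _ _).trans (add_le_add p1 p2)
      _ = ENNReal.ofReal (4 * ε) := by
          rw [add_zero, ← ENNReal.ofReal_add hε.le hε.le, ← ENNReal.ofReal_add (by positivity) hε.le,
            ← ENNReal.ofReal_add (by positivity) hε.le]
          congr 1; ring
      _ ≤ _ := ENNReal.ofReal_le_ofReal (by linarith)
  refine ⟨Bᶜ, mB.compl, ?_, fun ω hω => ?_⟩
  · rw [prob_compl_eq_one_sub mB, ENNReal.ofReal_sub _ (by positivity), ENNReal.ofReal_one]
    exact tsub_le_tsub_left pB 1
  · simp only [hB, Set.mem_compl_iff, Set.mem_union, Set.mem_iUnion, not_or, not_exists] at hω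
    obtain ⟨⟨⟨⟨h1, h2⟩, h3⟩, h4⟩, h5⟩ := hω
    exact
      { regular := fun i => not_not.1 (h5 i)
        scoreCAL := fun j => (not_le.1 (h1 j)).le
        scoreWL := fun j => (not_le.1 (h2 j)).le
        gram := fun k j1 j2 => (not_le.1 (h3 (k, j1, j2))).le
        resid := fun k j1 j2 => (not_le.1 (h4 (k, j1, j2))).le }

theorem Conditions.lam1_pos (hc : c.Admissible) (hC : D.Conditions c ε γ α) : 0 < D.lam1 c ε :=
  (rate_pos hC.ε_pos hC.ε_lt).trans_le (D.rate_le_lam1 hc)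

theorem Conditions.exists_event (hc : c.Admissible) (hC : D.Conditions c ε γ α) :
    ∃ E : Set D.Ω, MeasurableSet E ∧ ENNReal.ofReal (1 - 8 * ε) ≤ D.P E ∧
      ∀ ω ∈ E, D.EstimatesSatisfy (c.A1 * D.lam1 c ε) (c.A2 * D.lam2 c ε) ω
        fun γhat αhat =>
          |D.sampleMean (fun o => D.phiC αhat γhat ω o ^ 2 - D.phiC α γ ω o ^ 2) ω| ≤
            2 * Real.sqrt c.mainConst *
                Real.sqrt (D.sampleMean (fun o => D.phiC α γ ω o ^ 2) ω) *
                Real.sqrt ((D.K : ℝ) - 1) *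
                ((D.support γ).card * D.lam1 c ε + (D.support α).card * D.lam2 c ε) +
              c.mainConst * ((D.K : ℝ) - 1) *
                ((D.support γ).card * D.lam1 c ε + (D.support α).card * D.lam2 c ε) ^ 2 := by
  obtain ⟨E, hE, hPE, hG⟩ := hC.exists_goodSample hc
  exact ⟨E, hE, hPE, fun ω hω =>
    (hG ω hω).estimatesSatisfy hc hC (hC.lam1_pos hc) (hC.quad_residGram_le hc)⟩

end Study

end

/-! ### Weak law of large numbers and consistency of the variance estimator. -/

noncomputable section

namespace Study

section WeakLaw

variable {D : Study.{u}} {g ψ : Obs D.K D.d → ℝ}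

theorem identDistrib_sample (i : Fin D.n) : IdentDistrib (D.sample i) D.obs D.P D.P :=
  D.law_sample i

theorem integral_sampleMean (hg : Measurable g) (hi : Integrable (fun ω => g (D.obs ω)) D.P) :
    Integrable (D.sampleMean g) D.P ∧
      ∫ ω, D.sampleMean g ω ∂D.P = ∫ ω, g (D.obs ω) ∂D.P := by
  have hid := fun i => (identDistrib_sample (D := D) i).comp hg
  have hint : ∀ i, Integrable (fun ω => g (D.sample i ω)) D.P := fun i =>
    (hid i).integrable_iff.2 hi
  have he : ∀ i, ∫ ω, g (D.sample i ω) ∂D.P = ∫ ω, g (D.obs ω) ∂D.P := fun i =>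
    (hid i).integral_eq
  refine ⟨(integrable_finsetSum _ fun i _ => hint i).div_const _, ?_⟩
  have hn := natCast_n_pos (D := D)
  unfold sampleMean
  rw [integral_div, integral_finsetSum _ fun i _ => hint i]
  simp only [he, Finset.sum_const, Finset.card_univ, Fintype.card_fin, nsmul_eq_mul]
  field_simp

theorem variance_sampleMean (hg : Measurable g) (hi : MemLp (fun ω => g (D.obs ω)) 2 D.P) :
    MemLp (D.sampleMean g) 2 D.P ∧
      Var[D.sampleMean g; D.P] = Var[fun ω => g (D.obs ω); D.P] / D.n := by
  have hid := fun i => (identDistrib_sample (D := D) i).comp hg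
  have hint : ∀ i, MemLp (fun ω => g (D.sample i ω)) 2 D.P := fun i =>
    (hid i).memLp_iff.2 hi
  have hn := natCast_n_pos (D := D)
  have e : D.sampleMean g = fun ω => (D.n : ℝ)⁻¹ * (∑ i, fun ω => g (D.sample i ω)) ω := by
    ext ω
    simp [sampleMean, div_eq_inv_mul]
  have hv : ∀ i, Var[fun ω => g (D.sample i ω); D.P] = Var[fun ω => g (D.obs ω); D.P] := fun i =>
    (hid i).variance_eq
  refine ⟨?_, ?_⟩
  · rw [e]
    exact (memLp_finsetSum' _ fun i _ => hint i).const_mul _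
  · rw [e, variance_const_mul, IndepFun.variance_sum (fun i _ => hint i)
      fun i _ j _ hij => (D.indep_sample.indepFun hij).comp hg hg]
    simp only [hv, Finset.sum_const, Finset.card_univ, Fintype.card_fin, nsmul_eq_mul]
    field_simp

theorem measure_sampleMean_sub_ge_le (hg : Measurable g)
    (hi : MemLp (fun ω => g (D.obs ω)) 2 D.P) {η : ℝ} (hη : 0 < η) :
    D.P {ω | η ≤ |D.sampleMean g ω - ∫ ω, g (D.obs ω) ∂D.P|} ≤
      ENNReal.ofReal ((∫ ω, g (D.obs ω) ^ 2 ∂D.P) / (D.n * η ^ 2)) := by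
  obtain ⟨h1, h2⟩ := variance_sampleMean hg hi
  have h3 := meas_ge_le_variance_div_sq h1 hη
  rw [(integral_sampleMean hg (hi.integrable (by norm_num))).2, h2] at h3
  refine h3.trans (ENNReal.ofReal_le_ofReal ?_)
  rw [div_div]
  exact div_le_div_of_nonneg_right (variance_le_expectation_sq hi.1) (by positivity)

/-- Sample variance. -/
theorem sampleMean_sub_sq (ω : D.Ω) :
    D.sampleMean (fun o => (g o - D.sampleMean g ω) ^ 2) ω =
      D.sampleMean (fun o => g o ^ 2) ω - D.sampleMean g ω ^ 2 := by
  have e : D.sampleMean (fun o => (g o - D.sampleMean g ω) ^ 2) ω =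
      D.sampleMean (fun o => g o ^ 2 - 2 * D.sampleMean g ω * g o + D.sampleMean g ω ^ 2) ω :=
    sampleMean_congr fun i => by ring
  rw [e, sampleMean_add, sampleMean_const, sampleMean_sub, sampleMean_const_mul]
  ring

theorem sampleMean_sub_sq_shift (a : ℝ) (ω : D.Ω) :
    D.sampleMean (fun o => (g o - D.sampleMean g ω) ^ 2) ω =
      D.sampleMean (fun o => (g o - a) ^ 2) ω - D.sampleMean (fun o => g o - a) ω ^ 2 := by
  rw [← sampleMean_sub_sq, sampleMean_sub, sampleMean_const]
  exact sampleMean_congr fun i => by ring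

theorem integral_sq_le_of_tail (hψ : Measurable ψ) (hi : MemLp (fun ω => ψ (D.obs ω)) 2 D.P)
    {C τ : ℝ} (htail : ∫ ω in {ω | C < ψ (D.obs ω) ^ 2}, ψ (D.obs ω) ^ 2 ∂D.P ≤ τ) :
    ∫ ω, ψ (D.obs ω) ^ 2 ∂D.P ≤ |C| + τ := by
  have hA : MeasurableSet {ω | C < ψ (D.obs ω) ^ 2} :=
    measurableSet_lt measurable_const ((hψ.comp measurable_obs).pow_const 2)
  have h1 := integral_add_compl hA hi.integrable_sq
  have h2 : ∫ ω in {ω | C < ψ (D.obs ω) ^ 2}ᶜ, ψ (D.obs ω) ^ 2 ∂D.P ≤ |C| := by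
    calc _ ≤ ∫ _ in {ω | C < ψ (D.obs ω) ^ 2}ᶜ, |C| ∂D.P := by
          refine setIntegral_mono_on hi.integrable_sq.integrableOn
            (integrable_const _).integrableOn hA.compl fun ω hω => ?_
          have h3 : ψ (D.obs ω) ^ 2 ≤ C := not_lt.1 hω
          exact h3.trans (le_abs_self C)
      _ ≤ |C| := by
          rw [setIntegral_const, smul_eq_mul]
          exact mul_le_of_le_one_left (abs_nonneg _) measureReal_le_one
  linarith

/-- Weak law of large numbers for the sample variance of a centred function, by truncation. -/
theorem measure_sampleVariance_sub_ge_le (hψ : Measurable ψ)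
    (hi : MemLp (fun ω => ψ (D.obs ω)) 2 D.P) (h0 : ∫ ω, ψ (D.obs ω) ∂D.P = 0)
    {C τ η : ℝ} (hη : 0 < η) (hτ0 : 0 ≤ τ) (hτ : τ < η / 4)
    (htail : ∫ ω in {ω | C < ψ (D.obs ω) ^ 2}, ψ (D.obs ω) ^ 2 ∂D.P ≤ τ) :
    D.P {ω | η ≤ |D.sampleMean (fun o => ψ o ^ 2) ω - D.sampleMean ψ ω ^ 2 -
        ∫ ω, ψ (D.obs ω) ^ 2 ∂D.P|} ≤
      ENNReal.ofReal ((16 * C ^ 2 / η ^ 2 + 4 * (|C| + τ) / η) / D.n + 4 * τ / η) := by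
  classical
  have hn := natCast_n_pos (D := D)
  have hV := integral_sq_le_of_tail hψ hi htail
  -- Truncation: Chebyshev for the bounded part `g`, Markov for the tail part `h`, and Chebyshev for
  -- the mean at level `√(η/4)`, because the mean enters squared. Each error is then below `η/4`, as
  -- is the expected tail.
  set g : Obs D.K D.d → ℝ := fun o => if C < ψ o ^ 2 then 0 else ψ o ^ 2 with hg
  set h : Obs D.K D.d → ℝ := fun o => if C < ψ o ^ 2 then ψ o ^ 2 else 0 with hh
  have hA : MeasurableSet {o | C < ψ o ^ 2} :=
    measurableSet_lt measurable_const (hψ.pow_const 2)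
  have hgm : Measurable g := Measurable.ite hA measurable_const (hψ.pow_const 2)
  have hhm : Measurable h := Measurable.ite hA (hψ.pow_const 2) measurable_const
  have hgh : ∀ o, ψ o ^ 2 = g o + h o := fun o => by simp only [hg, hh]; split_ifs <;> ring
  have hg0 : ∀ o, 0 ≤ g o := fun o => by simp only [hg]; split_ifs <;> positivity
  have hh0 : ∀ o, 0 ≤ h o := fun o => by simp only [hh]; split_ifs <;> positivity
  have hgC : ∀ o, g o ≤ |C| := fun o => by
    simp only [hg]; split_ifs with hc
    · positivity
    · exact (not_lt.1 hc).trans (le_abs_self C)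
  have hgi : MemLp (fun ω => g (D.obs ω)) 2 D.P :=
    MemLp.of_bound (hgm.comp measurable_obs).aestronglyMeasurable |C|
      (ae_of_all _ fun ω => by rw [Real.norm_of_nonneg (hg0 _)]; exact hgC _)
  have hhi : Integrable (fun ω => h (D.obs ω)) D.P := by
    refine hi.integrable_sq.mono' (hhm.comp measurable_obs).aestronglyMeasurable
      (ae_of_all _ fun ω => ?_)
    rw [Real.norm_of_nonneg (hh0 _), hgh]
    linarith [hg0 (D.obs ω)]
  have hhE : ∫ ω, h (D.obs ω) ∂D.P ≤ τ := by
    refine le_trans (le_of_eq ?_) htail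
    have hA' : MeasurableSet {ω | C < ψ (D.obs ω) ^ 2} :=
      measurableSet_lt measurable_const ((hψ.comp measurable_obs).pow_const 2)
    rw [← integral_indicator hA']
    refine integral_congr_ae (ae_of_all _ fun ω => ?_)
    simp only [hh, Set.indicator, Set.mem_ofPred_eq]
  have hhE0 : 0 ≤ ∫ ω, h (D.obs ω) ∂D.P := integral_nonneg fun _ => hh0 _
  have hsum : ∫ ω, ψ (D.obs ω) ^ 2 ∂D.P =
      ∫ ω, g (D.obs ω) ∂D.P + ∫ ω, h (D.obs ω) ∂D.P := by
    rw [← integral_add (hgi.integrable (by norm_num)) hhi]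
    simp_rw [hgh]
  have p1 : D.P {ω | η / 4 ≤ |D.sampleMean g ω - ∫ ω, g (D.obs ω) ∂D.P|} ≤
      ENNReal.ofReal (16 * C ^ 2 / η ^ 2 / D.n) := by
    refine (measure_sampleMean_sub_ge_le hgm hgi (by positivity)).trans
      (ENNReal.ofReal_le_ofReal ?_)
    have : ∫ ω, g (D.obs ω) ^ 2 ∂D.P ≤ C ^ 2 := by
      have := integral_mono hgi.integrable_sq (integrable_const (C ^ 2)) fun ω => by
        rw [← sq_abs C]
        exact pow_le_pow_left₀ (hg0 (D.obs ω)) (hgC _) 2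
      simpa using this
    calc _ ≤ C ^ 2 / (D.n * (η / 4) ^ 2) := by gcongr
      _ = _ := by field_simp; norm_num
  have p2 : D.P {ω | Real.sqrt (η / 4) ≤ |D.sampleMean ψ ω - ∫ ω, ψ (D.obs ω) ∂D.P|} ≤
      ENNReal.ofReal (4 * (|C| + τ) / η / D.n) := by
    refine (measure_sampleMean_sub_ge_le hψ hi (Real.sqrt_pos.2 (by positivity))).trans
      (ENNReal.ofReal_le_ofReal ?_)
    rw [Real.sq_sqrt (by positivity)]
    calc _ ≤ (|C| + τ) / (D.n * (η / 4)) := by gcongr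
      _ = _ := by field_simp
  have p3 : D.P {ω | η / 4 ≤ D.sampleMean h ω} ≤ ENNReal.ofReal (4 * τ / η) := by
    obtain ⟨m1, m2⟩ := integral_sampleMean hhm hhi
    have m3 := mul_meas_ge_le_integral_of_nonneg (μ := D.P) (f := D.sampleMean h)
      (ae_of_all _ fun ω => sampleMean_nonneg fun i => hh0 _) m1 (η / 4)
    rw [m2] at m3
    rw [← ofReal_measureReal]
    refine ENNReal.ofReal_le_ofReal ?_
    rw [le_div_iff₀ hη]
    linarith
  have hsub : {ω | η ≤ |D.sampleMean (fun o => ψ o ^ 2) ω - D.sampleMean ψ ω ^ 2 -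
        ∫ ω, ψ (D.obs ω) ^ 2 ∂D.P|} ⊆
      ({ω | η / 4 ≤ |D.sampleMean g ω - ∫ ω, g (D.obs ω) ∂D.P|} ∪
      {ω | Real.sqrt (η / 4) ≤ |D.sampleMean ψ ω - ∫ ω, ψ (D.obs ω) ∂D.P|}) ∪
      {ω | η / 4 ≤ D.sampleMean h ω} := by
    intro ω hω
    by_contra hcon
    simp only [Set.mem_union, Set.mem_ofPred_eq, not_or, not_le] at hcon hω
    obtain ⟨⟨c1, c2⟩, c3⟩ := hcon
    rw [h0, sub_zero, ← Real.sqrt_sq_eq_abs, Real.sqrt_lt_sqrt_iff (sq_nonneg _)] at c2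
    have e1 : D.sampleMean (fun o => ψ o ^ 2) ω = D.sampleMean g ω + D.sampleMean h ω := by
      rw [← sampleMean_add]; exact sampleMean_congr fun i => hgh _
    have c4 : 0 ≤ D.sampleMean h ω := sampleMean_nonneg fun i => hh0 _
    have c5 := sq_nonneg (D.sampleMean ψ ω)
    rw [abs_lt] at c1
    rw [e1, hsum] at hω
    refine absurd hω (not_le.2 (abs_lt.2 ⟨?_, ?_⟩)) <;> linarith [c1.1, c1.2]
  refine (measure_mono hsub).trans ((measure_union_le _ _).trans ?_)
  refine (add_le_add ((measure_union_le _ _).trans (add_le_add p1 p2)) p3).trans (le_of_eq ?_)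
  have hC := abs_nonneg C
  rw [← ENNReal.ofReal_add (by positivity) (by positivity),
    ← ENNReal.ofReal_add (by positivity) (by positivity)]
  congr 1; ring

end WeakLaw

section Phi

variable {D : Study.{u}} {c : Constants} {ε : ℝ} {γ α : D.Coef}

theorem measurable_phi : Measurable (D.phi α γ) := by
  rw [show D.phi α γ = _ from funext (D.phi_eq γ α)]
  exact ((D.measurable_R _).mul measurable_fst).add (Finset.measurable_sum _ fun k _ =>
    ((D.measurable_wt γ k).mul (D.measurable_res α k)).add
      ((D.measurable_R _).mul (measurable_lin_obs α k)))

theorem Conditions.memLp_phi (hc : c.Admissible) (hC : D.Conditions c ε γ α) :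
    MemLp (fun ω => D.phi α γ (D.obs ω)) 2 D.P := by
  have hr : ∀ k, MemLp (fun ω => D.resT α k ω) 2 D.P := fun k =>
    (memLp_two_iff_integrable_sq (measurable_resT α k).aestronglyMeasurable).2
      (hC.integrable_resT_sq hc k)
  have hB1 : 0 ≤ c.B1 - 1 := by linarith [hc.one_lt_B1]
  set b := c.B0 * D.totalNorm α
  -- The term `R^(t) Y` comes without a residual; it is written through the residual of one
  -- arbitrary treatment, whose second moment is known.
  obtain ⟨k₀⟩ : Nonempty D.Other := inferInstance
  have hF : MemLp (fun ω => (|D.resT α k₀ ω| + b) +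
      ∑ k : D.Other, ((c.B1 - 1) * |D.resT α k ω| + b)) 2 D.P :=
    ((hr k₀).abs.add (memLp_const b)).add (memLp_finsetSum _ fun k _ =>
      ((hr k).abs.const_mul _).add (memLp_const b))
  refine hF.mono' (measurable_phi.comp measurable_obs).aestronglyMeasurable ?_
  filter_upwards [hC.ae_regular hc] with ω hω
  have hlin : ∀ k : D.Other, |D.lin α k (D.obs ω).2.2| ≤ b := fun k => D.abs_lin_le hω.1 α k
  rw [phi_eq, Real.norm_eq_abs]
  refine (abs_add_le _ _).trans (add_le_add ?_ ((Finset.abs_sum_le_sum_abs _ _).trans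
    (Finset.sum_le_sum fun k _ => (abs_add_le _ _).trans (add_le_add ?_ ?_))))
  · have hRn := D.R_nonneg D.t (D.obs ω)
    have h1 : D.R D.t (D.obs ω) * (D.obs ω).1 =
        D.R D.t (D.obs ω) * (D.resT α k₀ ω + D.lin α k₀ (D.obs ω).2.2) := by
      by_cases h : D.T ω = D.t
      · simp [resT, obs, h]
      · simp [R, obs, h]
    rw [h1, abs_mul, abs_of_nonneg hRn]
    refine (mul_le_of_le_one_left (abs_nonneg _) (D.R_le_one _ _)).trans
      ((abs_add_le _ _).trans (add_le_add le_rfl (hlin k₀)))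
  · rw [wt_mul_res, abs_mul, abs_of_nonneg (D.wt_nonneg _ _ _)]
    exact mul_le_mul_of_nonneg_right (hω.wt_le k) (abs_nonneg _)
  · rw [abs_mul, abs_of_nonneg (D.R_nonneg _ _)]
    exact (mul_le_of_le_one_left (abs_nonneg _) (D.R_le_one _ _)).trans (hlin k)

theorem Vhat_eq (a : ℝ) (ω : D.Ω) :
    D.Vhat α γ ω = D.sampleMean (fun o => (D.phi α γ o - a) ^ 2) ω -
      D.sampleMean (fun o => D.phi α γ o - a) ω ^ 2 :=
  sampleMean_sub_sq_shift a ω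

theorem measurable_Vhat : Measurable (D.Vhat α γ) := by
  rw [show D.Vhat α γ = _ from funext (Vhat_eq 0)]
  exact (measurable_sampleMean ((measurable_phi.sub_const 0).pow_const 2)).sub
    ((measurable_sampleMean (measurable_phi.sub_const 0)).pow_const 2)

theorem V_eq : D.V α γ =
    ∫ ω, (D.phi α γ (D.obs ω) - ∫ ω', D.phi α γ (D.obs ω') ∂D.P) ^ 2 ∂D.P :=
  variance_eq_integral (measurable_phi.comp measurable_obs).aemeasurable

theorem Conditions.V_le (hc : c.Admissible) (hC : D.Conditions c ε γ α) {C τ : ℝ}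
    (htail : ∫ ω in {ω | C < (D.phi α γ (D.obs ω) - ∫ ω', D.phi α γ (D.obs ω') ∂D.P) ^ 2},
      (D.phi α γ (D.obs ω) - ∫ ω', D.phi α γ (D.obs ω') ∂D.P) ^ 2 ∂D.P ≤ τ) :
    D.V α γ ≤ |C| + τ := by
  rw [V_eq]
  exact integral_sq_le_of_tail (ψ := fun o => D.phi α γ o - ∫ ω', D.phi α γ (D.obs ω') ∂D.P)
    (measurable_phi.sub_const _) ((hC.memLp_phi hc).sub (memLp_const _)) htail

/-- Weak law of large numbers for the infeasible variance estimator. -/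
theorem Conditions.measure_Vhat_sub_V (hc : c.Admissible) (hC : D.Conditions c ε γ α)
    {C τ η : ℝ} (hη : 0 < η) (hτ0 : 0 ≤ τ) (hτ : τ < η / 4)
    (htail : ∫ ω in {ω | C < (D.phi α γ (D.obs ω) - ∫ ω', D.phi α γ (D.obs ω') ∂D.P) ^ 2},
      (D.phi α γ (D.obs ω) - ∫ ω', D.phi α γ (D.obs ω') ∂D.P) ^ 2 ∂D.P ≤ τ) :
    D.P {ω | η ≤ |D.Vhat α γ ω - D.V α γ|} ≤
      ENNReal.ofReal ((16 * C ^ 2 / η ^ 2 + 4 * (|C| + τ) / η) / D.n + 4 * τ / η) := by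
  have hφ := hC.memLp_phi hc
  set a := ∫ ω', D.phi α γ (D.obs ω') ∂D.P with ha
  have h0 : ∫ ω, (D.phi α γ (D.obs ω) - a) ∂D.P = 0 := by
    rw [integral_sub (hφ.integrable (by norm_num)) (integrable_const _)]
    simp [ha]
  have := measure_sampleVariance_sub_ge_le (ψ := fun o => D.phi α γ o - a)
    (measurable_phi.sub_const _) (hφ.sub (memLp_const _)) h0 hη hτ0 hτ htail
  simp_rw [Vhat_eq a, V_eq]
  exact this

/-- Both terms of the maximum are controlled by multiples of `λ̃_1`, so the growth assumption on
`λ̃_1` alone controls the whole error scale. -/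
theorem Conditions.lam2_le (hc : c.Admissible) :
    D.lam2 c ε ≤ (1 + Real.sqrt 3 * c.B0 * (c.B1 - 1) * c.σ0) * D.lam1 c ε := by
  have hB0 := hc.one_le_B0
  have hB1 : 0 < c.B1 - 1 := by linarith [hc.one_lt_B1]
  have hσ := hc.σ0_pos
  have h1 := D.lam1_nonneg (ε := ε) hc
  have h2 : 0 ≤ Real.sqrt 3 * c.B0 * (c.B1 - 1) * c.σ0 := by positivity
  have h3 := mul_le_mul_of_nonneg_left (D.rate_le_lam1 (ε := ε) hc) h2
  rw [add_mul, one_mul]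
  have h4 := mul_nonneg h2 h1
  exact max_le (by linarith) (by linarith)

theorem Conditions.sqrt_mul_scale_le (hc : c.Admissible) (γ α : D.Coef) :
    Real.sqrt ((D.K : ℝ) - 1) *
        ((D.support γ).card * D.lam1 c ε + (D.support α).card * D.lam2 c ε) ≤
      (1 + Real.sqrt 3 * c.B0 * (c.B1 - 1) * c.σ0) *
        (((D.support γ).card + (D.support α).card) * Real.sqrt ((D.K : ℝ) - 1) * D.lam1 c ε) := by
  have h1 := Conditions.lam2_le (D := D) (ε := ε) hc
  have h2 := (D.lam1_le_lam2 c (ε := ε)).trans h1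
  set C := 1 + Real.sqrt 3 * c.B0 * (c.B1 - 1) * c.σ0
  have h3 := Real.sqrt_nonneg ((D.K : ℝ) - 1)
  calc _ ≤ Real.sqrt ((D.K : ℝ) - 1) *
        ((D.support γ).card * (C * D.lam1 c ε) + (D.support α).card * (C * D.lam1 c ε)) := by
        gcongr
    _ = _ := by ring

/-- `n r² ≥ K - 1 ≥ 1`, so the growth assumption forces `n → ∞`, and this need not be assumed
separately. -/
theorem Conditions.inv_n_le (hc : c.Admissible) (hC : D.Conditions c ε γ α) :
    (D.n : ℝ)⁻¹ ≤
      (((D.support γ).card + (D.support α).card) * Real.sqrt ((D.K : ℝ) - 1) * D.lam1 c ε) ^ 2 := by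
  have hn := natCast_n_pos (D := D)
  have hK := one_le_K_sub_one (D := D)
  have h1 : (D.n : ℝ)⁻¹ ≤ D.rate ε ^ 2 := by
    rw [inv_le_iff_one_le_mul₀ hn, mul_comm, n_mul_rate_sq hC.ε_pos hC.ε_lt]
    linarith [log_nonneg (D := D) hC.ε_pos hC.ε_lt]
  refine h1.trans (pow_le_pow_left₀ D.rate_nonneg ((D.rate_le_lam1 hc).trans ?_) 2)
  refine le_mul_of_one_le_left (D.lam1_nonneg hc) (one_le_mul_of_one_le_of_one_le ?_ ?_)
  · linarith [D.one_le_card_support γ, D.one_le_card_support α]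
  · exact Real.one_le_sqrt.2 hK

theorem measure_compl_le_of_le {E : Set D.Ω} (hE : MeasurableSet E) {x : ℝ}
    (h : ENNReal.ofReal (1 - x) ≤ D.P E) : D.P Eᶜ ≤ ENNReal.ofReal x := by
  rw [prob_compl_eq_one_sub hE, tsub_le_iff_left]
  calc (1 : ENNReal) = ENNReal.ofReal ((1 - x) + x) := by simp
    _ ≤ ENNReal.ofReal (1 - x) + ENNReal.ofReal x := ENNReal.ofReal_add_le
    _ ≤ _ := by gcongr

end Phi

/-- The infeasible variance estimator is consistent along sequences of studies. -/
theorem tendsto_measure_Vhat_sub_V {c : Constants} (hc : c.Admissible) {D : ℕ → Study.{u}}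
    {ε : ℕ → ℝ} {γ α : ∀ m, (D m).Coef} (hC : ∀ m, (D m).Conditions c (ε m) (γ m) (α m))
    (hn : Tendsto (fun m => ((D m).n : ℝ)⁻¹) atTop (𝓝 0))
    (hUI : ∀ δ : ℝ, 0 < δ → ∃ C : ℝ, ∀ m,
        ∫ ω in {ω | C < ((D m).phi (α m) (γ m) ((D m).obs ω) -
              ∫ ω', (D m).phi (α m) (γ m) ((D m).obs ω') ∂(D m).P) ^ 2},
          ((D m).phi (α m) (γ m) ((D m).obs ω) -
              ∫ ω', (D m).phi (α m) (γ m) ((D m).obs ω') ∂(D m).P) ^ 2 ∂(D m).P ≤ δ)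
    {η : ℝ} (hη : 0 < η) :
    Tendsto (fun m => (D m).P {ω | η ≤ |(D m).Vhat (α m) (γ m) ω - (D m).V (α m) (γ m)|})
      atTop (𝓝 0) := by
  rw [ENNReal.tendsto_nhds_zero]
  intro x hx
  obtain ⟨y, hy0, hyx⟩ : ∃ y : ℝ, 0 < y ∧ ENNReal.ofReal y ≤ x := by
    obtain ⟨y, hy0, hyx⟩ := ENNReal.lt_iff_exists_nnreal_btwn.1 hx
    exact ⟨y, by exact_mod_cast hy0, by simpa using hyx.le⟩
  -- The first entry ensures `τ < η/4`, the second makes the Markov term `4τ/η` at most `y/2`. With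
  -- `C` then fixed, the remaining terms vanish as `n` grows.
  set τ := min (η / 8) (η * y / 8) with hτd
  have hτ0 : 0 < τ := lt_min (by positivity) (by positivity)
  obtain ⟨C, hCt⟩ := hUI τ hτ0
  have h1 : Tendsto (fun m => (16 * C ^ 2 / η ^ 2 + 4 * (|C| + τ) / η) / ((D m).n : ℝ)) atTop
      (𝓝 0) := by
    have h2 := hn.const_mul (16 * C ^ 2 / η ^ 2 + 4 * (|C| + τ) / η)
    rw [mul_zero] at h2
    exact h2
  filter_upwards [h1.eventually (gt_mem_nhds (half_pos hy0))] with m hm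
  refine ((hC m).measure_Vhat_sub_V hc hη hτ0.le
    ((min_le_left _ _).trans_lt (by linarith)) (hCt m)).trans
    ((ENNReal.ofReal_le_ofReal ?_).trans hyx)
  have h2 : 4 * τ / η ≤ y / 2 := by
    rw [div_le_iff₀ hη]
    linarith [min_le_right (η / 8) (η * y / 8)]
  linarith

theorem EstimatesSatisfy.mono {D : Study.{u}} {l1 l2 : ℝ} {ω : D.Ω} {Q Q' : D.Coef → D.Coef → Prop}
    (h : D.EstimatesSatisfy l1 l2 ω Q) (hQ : ∀ γ α, Q γ α → Q' γ α) :
    D.EstimatesSatisfy l1 l2 ω Q' :=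
  ⟨h.1, fun γ hγ => ⟨(h.2 γ hγ).1, fun α hα => hQ γ α ((h.2 γ hγ).2 α hα)⟩⟩

/-- Consistency of the variance estimator along sequences of studies. -/
theorem exists_event_Vhat_sub_V_le {c : Constants} (hc : c.Admissible) (D : ℕ → Study.{u})
    (ε : ℕ → ℝ) (γ α : ∀ m, (D m).Coef) (hC : ∀ m, (D m).Conditions c (ε m) (γ m) (α m))
    (hε : Tendsto ε atTop (𝓝 0))
    (hq : Tendsto (fun m => (((D m).support (γ m)).card + ((D m).support (α m)).card : ℝ) *
        Real.sqrt (((D m).K : ℝ) - 1) * (D m).lam1 c (ε m)) atTop (𝓝 0))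
    (hUI : ∀ δ : ℝ, 0 < δ → ∃ C : ℝ, ∀ m,
        ∫ ω in {ω | C < ((D m).phi (α m) (γ m) ((D m).obs ω) -
              ∫ ω', (D m).phi (α m) (γ m) ((D m).obs ω') ∂(D m).P) ^ 2},
          ((D m).phi (α m) (γ m) ((D m).obs ω) -
              ∫ ω', (D m).phi (α m) (γ m) ((D m).obs ω') ∂(D m).P) ^ 2 ∂(D m).P ≤ δ)
    {δ : ℝ} (hδ : 0 < δ) :
    ∃ E : ∀ m, Set (D m).Ω, (∀ m, MeasurableSet (E m)) ∧
      Tendsto (fun m => (D m).P (E m)) atTop (𝓝 1) ∧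
      ∀ m, ∀ ω ∈ E m,
        (D m).EstimatesSatisfy (c.A1 * (D m).lam1 c (ε m)) (c.A2 * (D m).lam2 c (ε m)) ω
          fun γhat αhat => |(D m).Vhat αhat γhat ω - (D m).V (α m) (γ m)| ≤ δ := by
  classical
  -- Uniform integrability at level one bounds all the limiting variances at once.
  obtain ⟨C, hCV⟩ := hUI 1 one_pos
  have hV : ∀ m, (D m).V (α m) (γ m) ≤ |C| + 1 := fun m => (hC m).V_le hc (hCV m)
  choose E hEm hPE hEst using fun m => (hC m).exists_event hc
  set q : ℕ → ℝ := fun m => (((D m).support (γ m)).card + ((D m).support (α m)).card : ℝ) *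
        Real.sqrt (((D m).K : ℝ) - 1) * (D m).lam1 c (ε m) with hqd
  set M := c.mainConst
  have hM : 0 < M := hc.mainConst_pos
  set A := 1 + Real.sqrt 3 * c.B0 * (c.B1 - 1) * c.σ0 with hAd
  -- The cap at one keeps the infeasible estimator below `|C| + 2` outside the exceptional set, so
  -- the square root factor in (a) stays bounded.
  set η := min (δ / 2) 1 with hηd
  have hη : 0 < η := lt_min (half_pos hδ) one_pos
  set b : ℕ → ℝ := fun m => 2 * Real.sqrt M * Real.sqrt (|C| + 2) * (A * q m) +
    M * (A * q m) ^ 2 with hbd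
  have hb : Tendsto b atTop (𝓝 0) := by
    have h1 := hq.const_mul A
    have h2 := (h1.const_mul (2 * Real.sqrt M * Real.sqrt (|C| + 2))).add
      ((h1.pow 2).const_mul M)
    simpa using h2
  have hn : Tendsto (fun m => ((D m).n : ℝ)⁻¹) atTop (𝓝 0) := by
    refine squeeze_zero (fun m => by positivity) (fun m => (hC m).inv_n_le hc) ?_
    simpa using hq.pow 2
  have hF := tendsto_measure_Vhat_sub_V hc hC hn hUI hη
  set F : ∀ m, Set (D m).Ω := fun m =>
    {ω | η ≤ |(D m).Vhat (α m) (γ m) ω - (D m).V (α m) (γ m)|} with hFd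
  have hFm : ∀ m, MeasurableSet (F m) := fun m =>
    measurableSet_le measurable_const (measurable_Vhat.sub_const _).abs
  -- For indices where the deterministic bound `b m` is still too large the event is taken empty.
  -- Since `b` tends to zero, this does not affect the limit.
  refine ⟨fun m => if b m ≤ δ / 2 then E m \ F m else ∅, fun m => ?_, ?_, fun m ω hω => ?_⟩
  · dsimp only
    split_ifs
    · exact (hEm m).diff (hFm m)
    · exact MeasurableSet.empty
  · have h1 : Tendsto (fun m => (D m).P (E m \ F m)ᶜ) atTop (𝓝 0) := by
      have h2 : Tendsto (fun m => ENNReal.ofReal (8 * ε m) + (D m).P (F m)) atTop (𝓝 0) := by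
        have h3 := (ENNReal.tendsto_ofReal (hε.const_mul 8)).add hF
        simpa using h3
      refine tendsto_of_tendsto_of_tendsto_of_le_of_le tendsto_const_nhds h2
        (fun _ => zero_le) fun m => ?_
      rw [Set.sdiff_eq, Set.compl_inter, compl_compl]
      exact (measure_union_le _ _).trans
        (add_le_add (measure_compl_le_of_le (hEm m) (hPE m)) le_rfl)
    have h2 := ENNReal.Tendsto.sub (tendsto_const_nhds (x := (1 : ENNReal))) h1
      (Or.inl ENNReal.one_ne_top)
    rw [tsub_zero] at h2
    refine h2.congr' ?_
    filter_upwards [hb.eventually (ge_mem_nhds (half_pos hδ))] with m hm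
    rw [if_pos hm, prob_compl_eq_one_sub ((hEm m).diff (hFm m)),
      ENNReal.sub_sub_cancel ENNReal.one_ne_top prob_le_one]
  · dsimp only at hω
    split_ifs at hω with hm
    swap
    · exact absurd hω (Set.notMem_empty _)
    refine (hEst m ω hω.1).mono fun γ' α' hQ => ?_
    have hVh : |(D m).Vhat (α m) (γ m) ω - (D m).V (α m) (γ m)| < η := not_le.1 hω.2
    rw [sampleMean_sub] at hQ
    change |(D m).Vhat α' γ' ω - (D m).Vhat (α m) (γ m) ω| ≤
      2 * Real.sqrt M * Real.sqrt ((D m).Vhat (α m) (γ m) ω) * _ * _ + _ at hQ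
    have hK := one_le_K_sub_one (D := D m)
    have hT := Conditions.sqrt_mul_scale_le (D := D m) (ε := ε m) hc (γ m) (α m)
    set T := ((D m).support (γ m)).card * (D m).lam1 c (ε m) +
      ((D m).support (α m)).card * (D m).lam2 c (ε m) with hTd
    have hT0 : 0 ≤ T := by
      have h1 := (D m).lam1_nonneg (ε := ε m) hc
      have h2 := h1.trans ((D m).lam1_le_lam2 c (ε := ε m))
      positivity
    have hKT : ((D m).K - 1 : ℝ) * T ^ 2 = (Real.sqrt (((D m).K : ℝ) - 1) * T) ^ 2 := by
      rw [mul_pow, Real.sq_sqrt (by linarith)]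
    have hVle : (D m).Vhat (α m) (γ m) ω ≤ |C| + 2 := by
      have h1 := (abs_lt.1 hVh).2
      have h2 := hV m
      have h3 : η ≤ 1 := min_le_right _ _
      linarith
    have hle : 2 * Real.sqrt M * Real.sqrt ((D m).Vhat (α m) (γ m) ω) *
        Real.sqrt (((D m).K : ℝ) - 1) * T + M * (((D m).K : ℝ) - 1) * T ^ 2 ≤ b m := by
      rw [mul_assoc M, hKT, mul_assoc (2 * Real.sqrt M * _)]
      simp only [hbd]
      gcongr
    have hη2 : η ≤ δ / 2 := min_le_left _ _
    have h3 := abs_sub_le ((D m).Vhat α' γ' ω) ((D m).Vhat (α m) (γ m) ω) ((D m).V (α m) (γ m))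
    linarith

end Study

end

theorem mainTheorem7 (c : Constants) (hc : c.Admissible) :
    (∃ M : ℝ, 0 < M ∧
      ∀ (D : Study.{u}) (ε : ℝ) (γbar αbar : D.Coef), D.Conditions c ε γbar αbar →
        ∃ E : Set D.Ω, MeasurableSet E ∧ ENNReal.ofReal (1 - 8 * ε) ≤ D.P E ∧
          ∀ ω ∈ E, D.EstimatesSatisfy (c.A1 * D.lam1 c ε) (c.A2 * D.lam2 c ε) ω
            fun γhat αhat =>
              |D.sampleMean (fun o => D.phiC αhat γhat ω o ^ 2 - D.phiC αbar γbar ω o ^ 2) ω| ≤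
                2 * Real.sqrt M *
                    Real.sqrt (D.sampleMean (fun o => D.phiC αbar γbar ω o ^ 2) ω) *
                    Real.sqrt ((D.K : ℝ) - 1) *
                    ((D.support γbar).card * D.lam1 c ε + (D.support αbar).card * D.lam2 c ε) +
                  M * ((D.K : ℝ) - 1) *
                    ((D.support γbar).card * D.lam1 c ε +
                      (D.support αbar).card * D.lam2 c ε) ^ 2) ∧
    (∀ (D : ℕ → Study.{u}) (ε : ℕ → ℝ) (γbar αbar : ∀ m, (D m).Coef),
      (∀ m, (D m).Conditions c (ε m) (γbar m) (αbar m)) →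
      Tendsto ε atTop (𝓝 0) →
      Tendsto (fun m => (((D m).support (γbar m)).card + ((D m).support (αbar m)).card : ℝ) *
        Real.sqrt (((D m).K : ℝ) - 1) * (D m).lam1 c (ε m)) atTop (𝓝 0) →
      (∀ δ : ℝ, 0 < δ → ∃ C : ℝ, ∀ m,
        ∫ ω in {ω | C < ((D m).phi (αbar m) (γbar m) ((D m).obs ω) -
              ∫ ω', (D m).phi (αbar m) (γbar m) ((D m).obs ω') ∂(D m).P) ^ 2},
          ((D m).phi (αbar m) (γbar m) ((D m).obs ω) -
              ∫ ω', (D m).phi (αbar m) (γbar m) ((D m).obs ω') ∂(D m).P) ^ 2 ∂(D m).P ≤ δ) →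
      ∀ δ : ℝ, 0 < δ →
        ∃ E : ∀ m, Set (D m).Ω, (∀ m, MeasurableSet (E m)) ∧
          Tendsto (fun m => (D m).P (E m)) atTop (𝓝 1) ∧
          ∀ m, ∀ ω ∈ E m,
            (D m).EstimatesSatisfy (c.A1 * (D m).lam1 c (ε m)) (c.A2 * (D m).lam2 c (ε m)) ω
              fun γhat αhat => |(D m).Vhat αhat γhat ω - (D m).V (αbar m) (γbar m)| ≤ δ) :=
  ⟨⟨c.mainConst, hc.mainConst_pos, fun _ _ _ _ hC => hC.exists_event hc⟩,
    fun D ε γbar αbar hC hε hq hUI _ hδ =>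
      Study.exists_event_Vhat_sub_V_le hc D ε γbar αbar hC hε hq hUI hδ⟩
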